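/- \textbf{Setting.} Let $n\ge 2$ and let $\Omega\subset\mathbb{R}^n$ be a bounded, connected open set with Lipschitz boundary. Let $\nu>0$ and $\kappa\ge 0$ be constants. Let $\mathcal{A}$ be a nonempty compact metric space, let $b:\overline\Omega\times\mathcal{A}\to\mathbb{R}^n$ and $f:\overline\Omega\times\mathcal{A}\to\mathbb{R}$ be uniformly continuous, and set $$H(x,p)=\sup_{\alpha\in\mathcal{A}}\bigl(b(x,\alpha)\cdot p-f(x,\alpha)\bigr),\qquad \partial_pH(x,p)=\{\tilde b\in\mathbb{R}^n: H(x,q)\ge H(x,p)+\tilde b\cdot(q-p)\ \ \forall q\in\mathbb{R}^n\}.$$ For $v\in H^1_0(\Omega)$ let $D_pH[v]$ be the set of all $\tilde b\in L^\infty(\Omega;\mathbb{R}^n)$ with $\tilde b(x)\in\partial_pH(x,\nabla v(x))$ for a.e. $x\in\Omega$. Let $G\in H^{-1}(\Omega)=(H^1_0(\Omega))^*$ and let $F:L^2(\Omega)\to H^{-1}(\Omega)$ satisfy, for some constants $c_1,c_2\ge 0$, $$\|F[z]\|_{H^{-1}}\le c_1(\|z\|_{L^2}+1),\qquad \|F[m_1]-F[m_2]\|_{H^{-1}}\le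 c_2\|m_1-m_2\|_{L^2}\qquad\forall z,m_1,m_2\in L^2(\Omega).$$ A pair $(u,m)\in H^1_0(\Omega)\times H^1_0(\Omega)$ is a \emph{weak solution} of the mean field game partial differential inclusion $$-\nu\Delta u+H(x,\nabla u)+\kappa u=F[m],\qquad -\nu\Delta m+\kappa m-G\in\operatorname{div}\bigl(m\,\partial_pH(x,\nabla u)\bigr)\ \text{ in }\Omega,\qquad u=m=0\ \text{ on }\partial\Omega,$$ if there exists $\tilde b_*\in D_pH[u]$ such that for all $\psi,\phi\in H^1_0(\Omega)$ $$\int_\Omega \nu\nabla u\cdot\nabla\psi+H(x,\nabla u)\psi+\kappa u\psi\,dx=\langle F[m],\psi\rangle,\qquad \int_\Omega \nu\nabla m\cdot\nabla\phi+m\,\tilde b_*\cdot\nabla\phi+\kappa m\phi\,dx=\langle G,\phi\rangle,$$ where $\langle\cdot,\cdot\rangle$ is the duality pairing of $H^{-1}(\Omega)$ with $H^1_0(\Omega)$. \textbf{Theorem (Uniqueness of Weak Solutions).} Assume that $F$ is strictly monotone, i.e. for all $m_1,m_2\in H^1_0(\Omega)$, $\langle F[m_1]-F[m_2],m_1-m_2\rangle\le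 0$ implies $m_1=m_2$; and that $G$ is nonnegative in the sense of distributions, i.e. $\langle G,\phi\rangle\ge 0$ for every $\phi\in H^1_0(\Omega)$ with $\phi\ge 0$ a.e. in $\Omega$. Then there exists a unique weak solution pair $(u,m)\in H^1_0(\Omega)\times H^1_0(\Omega)$. (Uniqueness is asserted for the pair $(u,m)$ only, not for the field $\tilde b_*\in D_pH[u]$.) -/

import Mathlib

open MeasureTheory Set
open scoped Gradient Distributions ENNReal NNReal

noncomputable section

namespace MFG

/-- `ℝⁿ` with its Euclidean norm. -/
abbrev Eucl (n : ℕ) : Type := EuclideanSpace ℝ (Fin n)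

/-- The open set `Ω` has Lipschitz boundary: near every boundary point, `Ω` is, in the direction of
some unit vector `e`, the strict epigraph of a Lipschitz function `γ` of the component orthogonal
to `e`. -/
def HasLipschitzBoundary {n : ℕ} (Ω : TopologicalSpace.Opens (Eucl n)) : Prop :=
  ∀ x₀ ∈ frontier (Ω : Set (Eucl n)), ∃ r : ℝ, 0 < r ∧ ∃ e : Eucl n, ‖e‖ = 1 ∧
    ∃ (K : ℝ≥0) (γ : Eucl n → ℝ), LipschitzWith K γ ∧
      ∀ y ∈ Metric.ball x₀ r, y ∈ Ω ↔ γ (y - (inner ℝ e y : ℝ) • e) < inner ℝ e y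

/-! ### Sobolev spaces -/

section Sobolev

variable {n : ℕ} (Ω : TopologicalSpace.Opens (Eucl n))

/-- Lebesgue measure on `Ω`. -/
abbrev vol : Measure (Eucl n) := volume.restrict (Ω : Set (Eucl n))

/-- `L²(Ω)`. -/
abbrev L2 : Type := Lp ℝ 2 (vol Ω)

/-- `L²(Ω) × L²(Ω; ℝⁿ)` with the Hilbert norm `(‖v‖² + ‖g‖²)^{1/2}`. On the pairs `(v, ∇v)` this is
the `H¹(Ω)` norm of `v`. -/
abbrev L2Pair : Type := WithLp 2 (L2 Ω × Lp (Eucl n) 2 (vol Ω))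

/-- The pairs `(φ, ∇φ)` with `φ ∈ C_c^∞(Ω)`. -/
def testPairs : Submodule ℝ (L2Pair Ω) where
  carrier := {w | ∃ φ : 𝓓(Ω, ℝ), (w.fst =ᵐ[vol Ω] fun x => φ x) ∧
    (w.snd =ᵐ[vol Ω] fun x => ∇ (φ : Eucl n → ℝ) x)}
  zero_mem' := by
    refine ⟨0, ?_, ?_⟩
    · filter_upwards [Lp.coeFn_zero ℝ 2 (vol Ω)] with x hx
      simpa using hx
    · filter_upwards [Lp.coeFn_zero (Eucl n) 2 (vol Ω)] with x hx
      have h0 : ((0 : 𝓓(Ω, ℝ)) : Eucl n → ℝ) = fun _ => 0 := by ext; simp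
      rw [h0]
      simpa [gradient] using hx
  add_mem' := by
    rintro v w ⟨φ, h1, h2⟩ ⟨ψ, h3, h4⟩
    refine ⟨φ + ψ, ?_, ?_⟩
    · filter_upwards [Lp.coeFn_add v.fst w.fst, h1, h3] with x hx hx1 hx3
      simpa [hx1, hx3] using hx
    · filter_upwards [Lp.coeFn_add v.snd w.snd, h2, h4] with x hx hx2 hx4
      have e : ((φ + ψ : 𝓓(Ω, ℝ)) : Eucl n → ℝ) = (φ : Eucl n → ℝ) + ψ := by ext; simp
      have d1 : DifferentiableAt ℝ (φ : Eucl n → ℝ) x :=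
        (φ.contDiff.differentiable (by simp)) x
      have d2 : DifferentiableAt ℝ (ψ : Eucl n → ℝ) x :=
        (ψ.contDiff.differentiable (by simp)) x
      rw [e]
      simp only [WithLp.add_snd, hx, Pi.add_apply, hx2, hx4]
      simp [gradient, fderiv_add d1 d2]
  smul_mem' := by
    rintro c w ⟨φ, h1, h2⟩
    refine ⟨c • φ, ?_, ?_⟩
    · filter_upwards [Lp.coeFn_smul c w.fst, h1] with x hx hx1
      simpa [hx1] using hx
    · filter_upwards [Lp.coeFn_smul c w.snd, h2] with x hx hx2
      have e : ((c • φ : 𝓓(Ω, ℝ)) : Eucl n → ℝ) = c • (φ : Eucl n → ℝ) := by ext; simp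
      have d1 : DifferentiableAt ℝ (φ : Eucl n → ℝ) x :=
        (φ.contDiff.differentiable (by simp)) x
      rw [e]
      simp only [WithLp.smul_snd, hx, Pi.smul_apply, hx2]
      simp [gradient, fderiv_const_smul d1]

/-- `H¹₀(Ω)`, the closure of `C_c^∞(Ω)` in the `H¹` norm; a function `v` is represented by the
pair `(v, ∇v)`, and it inherits the `H¹` norm and inner product. -/
abbrev H01 : Submodule ℝ (L2Pair Ω) := (testPairs Ω).topologicalClosure

/-- `H⁻¹(Ω)`, the dual of `H¹₀(Ω)`; the duality pairing is application. -/
abbrev Hneg1 : Type := StrongDual ℝ (H01 Ω)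

variable {Ω}

/-- The underlying `L²` function of an element of `H¹₀(Ω)`. -/
def fn (v : H01 Ω) : L2 Ω := (v : L2Pair Ω).fst

/-- The (weak) gradient of an element of `H¹₀(Ω)`. -/
def grad (v : H01 Ω) : Lp (Eucl n) 2 (vol Ω) := (v : L2Pair Ω).snd

/-- `g` is the weak gradient of `v` in `Ω`. -/
def IsWeakGradient (v : L2 Ω) (g : Lp (Eucl n) 2 (vol Ω)) : Prop :=
  ∀ (φ : 𝓓(Ω, ℝ)) (i : Fin n),
    ∫ x, v x * (∇ (φ : Eucl n → ℝ) x) i ∂(vol Ω) = - ∫ x, g x i * φ x ∂(vol Ω)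

/-- Every element `(v, g)` of `H¹₀(Ω)` consists of a function and its weak gradient. -/
theorem isWeakGradient (v : H01 Ω) : IsWeakGradient (fn v) (grad v) := by
  intro φ i
  have hφc : Continuous (φ : Eucl n → ℝ) := φ.contDiff.continuous
  have hd : Differentiable ℝ (φ : Eucl n → ℝ) := φ.contDiff.differentiable (by simp)
  have hgr : Continuous fun x => ∇ (φ : Eucl n → ℝ) x := by
    unfold gradient
    exact (LinearIsometryEquiv.continuous _).comp (φ.contDiff.continuous_fderiv (by simp))
  have hgi : Continuous fun x => (∇ (φ : Eucl n → ℝ) x) i := by fun_prop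
  have hgs : HasCompactSupport fun x => (∇ (φ : Eucl n → ℝ) x) i := by
    refine (φ.hasCompactSupport.fderiv (𝕜 := ℝ)).mono ?_
    intro x hx h0
    apply hx
    simp [gradient, h0]
  have hes : HasCompactSupport fun x => φ x • EuclideanSpace.single i (1 : ℝ) :=
    φ.hasCompactSupport.smul_right
  have m1 : MemLp (fun x => (∇ (φ : Eucl n → ℝ) x) i) 2 (vol Ω) :=
    (hgi.memLp_of_hasCompactSupport hgs)
  have m2 : MemLp (fun x => φ x • EuclideanSpace.single i (1 : ℝ)) 2 (vol Ω) :=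
    ((by fun_prop : Continuous _).memLp_of_hasCompactSupport hes)
  have key : ∀ w : L2Pair Ω, inner ℝ (m1.toLp) w.fst + inner ℝ (m2.toLp) w.snd
      = ∫ x, w.fst x * (∇ (φ : Eucl n → ℝ) x) i ∂(vol Ω) +
        ∫ x, w.snd x i * φ x ∂(vol Ω) := by
    intro w
    rw [L2.inner_def, L2.inner_def]
    congr 1
    · refine integral_congr_ae ?_
      filter_upwards [m1.coeFn_toLp] with x hx
      rw [hx]
      simp
    · refine integral_congr_ae ?_
      filter_upwards [m2.coeFn_toLp] with x hx
      rw [hx]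
      simp [inner_smul_left, EuclideanSpace.inner_single_left, mul_comm]
  suffices h : inner ℝ (m1.toLp) (v : L2Pair Ω).fst + inner ℝ (m2.toLp) (v : L2Pair Ω).snd = 0 by
    rw [key] at h
    exact eq_neg_of_add_eq_zero_left h
  have hcl : IsClosed {w : L2Pair Ω | inner ℝ (m1.toLp) w.fst + inner ℝ (m2.toLp) w.snd = 0} :=
    isClosed_eq (by fun_prop) continuous_const
  refine closure_minimal ?_ hcl v.2
  rintro w ⟨ψ, h1, h2⟩
  show _ = _
  rw [key]
  have hdψ : Differentiable ℝ (ψ : Eucl n → ℝ) := ψ.contDiff.differentiable (by simp)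
  have hgrψ : Continuous fun x => ∇ (ψ : Eucl n → ℝ) x := by
    unfold gradient
    exact (LinearIsometryEquiv.continuous _).comp (ψ.contDiff.continuous_fderiv (by simp))
  have gi : ∀ (χ : 𝓓(Ω, ℝ)) (x : Eucl n), (∇ (χ : Eucl n → ℝ) x) i
      = fderiv ℝ (χ : Eucl n → ℝ) x (EuclideanSpace.single i 1) := by
    intro χ x
    have h : inner ℝ (∇ (χ : Eucl n → ℝ) x) (EuclideanSpace.single i (1 : ℝ))
        = fderiv ℝ (χ : Eucl n → ℝ) x (EuclideanSpace.single i 1) := by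
      rw [gradient, InnerProductSpace.toDual_symm_apply]
    rw [← h, EuclideanSpace.inner_single_right]
    simp
  have e1 : ∫ x, w.fst x * (∇ (φ : Eucl n → ℝ) x) i ∂(vol Ω)
      = ∫ x, ψ x * fderiv ℝ (φ : Eucl n → ℝ) x (EuclideanSpace.single i 1) := by
    refine Eq.trans (integral_congr_ae ?_) (setIntegral_eq_integral_of_forall_compl_eq_zero ?_)
    · filter_upwards [h1] with x hx
      rw [hx, gi]
    · intro x hx
      rw [image_eq_zero_of_notMem_tsupport fun h => hx (ψ.tsupport_subset h), zero_mul]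
  have e2 : ∫ x, w.snd x i * φ x ∂(vol Ω)
      = ∫ x, fderiv ℝ (ψ : Eucl n → ℝ) x (EuclideanSpace.single i 1) * φ x := by
    refine Eq.trans (integral_congr_ae ?_) (setIntegral_eq_integral_of_forall_compl_eq_zero ?_)
    · filter_upwards [h2] with x hx
      rw [hx, gi]
    · intro x hx
      rw [image_eq_zero_of_notMem_tsupport fun h => hx (φ.tsupport_subset h), mul_zero]
  have c1 : Continuous fun x => fderiv ℝ (ψ : Eucl n → ℝ) x (EuclideanSpace.single i 1) := by
    simp only [← gi]; fun_prop
  have c2 : Continuous fun x => fderiv ℝ (φ : Eucl n → ℝ) x (EuclideanSpace.single i 1) := by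
    simp only [← gi]; fun_prop
  have hψc : Continuous (ψ : Eucl n → ℝ) := ψ.contDiff.continuous
  rw [e1, e2, integral_mul_fderiv_eq_neg_fderiv_mul_of_integrable]
  · simp
  · exact (c1.mul hφc).integrable_of_hasCompactSupport φ.hasCompactSupport.mul_left
  · exact (hψc.mul c2).integrable_of_hasCompactSupport ψ.hasCompactSupport.mul_right
  · exact (hψc.mul hφc).integrable_of_hasCompactSupport ψ.hasCompactSupport.mul_right
  · exact fun x _ => hdψ x
  · exact fun x _ => hd x

/-- An element of `H¹₀(Ω)` is determined by its underlying function. -/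
theorem fn_injective : Function.Injective (fn : H01 Ω → L2 Ω) := by
  intro v w h
  have hg : grad v = grad w := by
    have hae : ∀ i : Fin n, ∀ᵐ x ∂(vol Ω), grad v x i - grad w x i = 0 := by
      intro i
      have hi : ∀ u : H01 Ω, MemLp (fun x => grad u x i) 2 (vol Ω) := fun u =>
        (EuclideanSpace.proj (𝕜 := ℝ) i).comp_memLp' (Lp.memLp (grad u))
      have hloc : LocallyIntegrable (fun x => grad v x i - grad w x i) (vol Ω) :=
        ((hi v).sub (hi w)).locallyIntegrable (by norm_num)
      have := Ω.isOpen.ae_eq_zero_of_integral_contDiff_smul_eq_zero (μ := vol Ω)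
        (hloc.locallyIntegrableOn _) (by
          intro g hg1 hg2 hg3
          let φ : 𝓓(Ω, ℝ) := ⟨g, hg1, hg2, hg3⟩
          have m : MemLp g 2 (vol Ω) := hg1.continuous.memLp_of_hasCompactSupport hg2
          have a := isWeakGradient v φ i
          have b := isWeakGradient w φ i
          rw [h] at a
          have c := neg_injective (a.symm.trans b)
          simp only [smul_eq_mul, mul_sub]
          rw [integral_sub]
          · simpa [φ, mul_comm, sub_eq_zero] using c
          · exact m.integrable_mul (hi v)
          · exact m.integrable_mul (hi w))
      filter_upwards [this, ae_restrict_mem Ω.isOpen.measurableSet] with x hx hm using hx hm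
    refine Lp.ext ?_
    filter_upwards [ae_all_iff.2 hae] with x hx
    ext i
    exact sub_eq_zero.1 (hx i)
  apply Subtype.ext
  have h' : (v : L2Pair Ω).fst = (w : L2Pair Ω).fst := h
  have hg' : (v : L2Pair Ω).snd = (w : L2Pair Ω).snd := hg
  exact (WithLp.ofLp_injective 2) (Prod.ext h' hg')

end Sobolev

/-! ### The mean field game system -/

section System

variable {n : ℕ} {A : Type*} (b : Eucl n → A → Eucl n) (f : Eucl n → A → ℝ)

/-- The Hamiltonian `H(x, p) = sup_α (b(x, α) · p - f(x, α))`. -/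
def hamiltonian (x p : Eucl n) : ℝ :=
  ⨆ α : A, (inner ℝ (b x α) p - f x α)

/-- The pointwise partial subdifferential `∂_p H(x, p)`. -/
def subdifferential (x p : Eucl n) : Set (Eucl n) :=
  {β | ∀ q : Eucl n, hamiltonian b f x p + inner ℝ β (q - p) ≤ hamiltonian b f x q}

variable {Ω : TopologicalSpace.Opens (Eucl n)}

/-- The set `D_pH[v]` of all `β ∈ L^∞(Ω; ℝⁿ)` with `β(x) ∈ ∂_p H(x, ∇v(x))` for a.e. `x ∈ Ω`. -/
def DpH (v : H01 Ω) : Set (Lp (Eucl n) ∞ (vol Ω)) :=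
  {β | ∀ᵐ x ∂(vol Ω), β x ∈ subdifferential b f x (grad v x)}

/-- `F` is strictly monotone on `H¹₀(Ω)`. -/
def IsStrictlyMonotone (F : L2 Ω → Hneg1 Ω) : Prop :=
  ∀ m₁ m₂ : H01 Ω, (F (fn m₁) - F (fn m₂)) (m₁ - m₂) ≤ 0 → m₁ = m₂

/-- `G ∈ H⁻¹(Ω)` is nonnegative in the sense of distributions. -/
def IsNonnegDistribution (G : Hneg1 Ω) : Prop :=
  ∀ φ : H01 Ω, (∀ᵐ x ∂(vol Ω), 0 ≤ fn φ x) → 0 ≤ G φ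

/-- `(u, m) ∈ H¹₀(Ω) × H¹₀(Ω)` is a weak solution of the mean field game partial differential
inclusion `-ν Δu + H(x, ∇u) + κ u = F[m]`, `-ν Δm + κ m - G ∈ div (m ∂_p H(x, ∇u))` in `Ω` with
`u = m = 0` on the boundary. -/
def IsWeakSolution (ν κ : ℝ) (F : L2 Ω → Hneg1 Ω) (G : Hneg1 Ω) (u m : H01 Ω) : Prop :=
  ∃ β ∈ DpH b f u,
    (∀ ψ : H01 Ω,
      ∫ x, (ν * inner ℝ (grad u x) (grad ψ x) + hamiltonian b f x (grad u x) * fn ψ x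
        + κ * fn u x * fn ψ x) ∂(vol Ω) = F (fn m) ψ) ∧
    (∀ φ : H01 Ω,
      ∫ x, (ν * inner ℝ (grad m x) (grad φ x) + fn m x * inner ℝ (β x) (grad φ x)
        + κ * fn m x * fn φ x) ∂(vol Ω) = G φ)

end System

end MFG

end

/-! Identify `H¹₀(Ω)` with its dual by Riesz, and let `U r` be the solution of the Hamilton–Jacobi
equation with right-hand side `r`. Let `S r` be the set of densities solving the Fokker–Planck
equation with source `g`, the representative of `G`, and with drift some subgradient field along
`∇(U r)`. The system then reads `m ∈ S (F m)`.

Three facts carry the argument. The first is a bound `‖m‖ ≤ C ‖fokkerPlanck ν κ β m‖`, uniform over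
`‖β‖ ≤ M` (`exists_fokkerPlanck_bound`). It comes from Rellich compactness and a weak maximum
principle, and passes by duality to the adjoint operator. Since differences of `H(x, ∇u)` are
bounded linear functions of `∇(u - v)`, the Hamilton–Jacobi operator is therefore bijective with
Lipschitz inverse `U`.

The second is a duality inequality (`inner_fokkerPlanck_sub_le`). A density is nonnegative because
`G` is, so the subgradient inequality may be multiplied by `m`; this gives `⟪g, U r' - U r⟫ ≤ ⟪m, r'
- r⟫` for `m ∈ S r`. Hence `S r` consists of supergradients of the concave function `r ↦ ⟪g, U r⟫`,
and `S` is antitone.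

The third is that the sets `S r` are nonempty, convex and closed, and the graph of `S` has the
compactness stated in `exists_densities_limit`. Convexity rests on averaging two drifts with weights
proportional to the two densities.

For existence, minimising a strongly convex functional gives the resolvents of `S`
(`exists_resolvent`). A contraction built from them solves `m ∈ S (F m + μ m)` for every `μ > 0`
(`exists_mem_of_resolvent`), by monotonicity of `F`. Letting `μ → 0`, Rellich makes `F m` converge
strongly and the graph of `S` is closed under such limits (`exists_solution`).

For uniqueness, adding the duality inequalities of two solutions gives `⟪F m₁ - F m₂, m₁ - m₂⟫ ≤ 0`,
the Lasry–Lions argument. Strict monotonicity yields `m₁ = m₂`, and injectivity of the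
Hamilton–Jacobi operator yields `u₁ = u₂`. -/

noncomputable section

namespace MFG

open Filter Topology
open scoped RealInnerProductSpace

/-! ### Functional analysis in Hilbert spaces -/

section Abstract

/-- Weak convergence of a sequence in a real Hilbert space. -/
def WeakTendsto {H : Type*} [NormedAddCommGroup H] [InnerProductSpace ℝ H]
    (x : ℕ → H) (x₀ : H) : Prop :=
  ∀ y : H, Tendsto (fun k => ⟪x k, y⟫) atTop (𝓝 ⟪x₀, y⟫)

theorem WeakTendsto.subseq {H : Type*} [NormedAddCommGroup H] [InnerProductSpace ℝ H]
    {x : ℕ → H} {x₀ : H} (h : WeakTendsto x x₀) {φ : ℕ → ℕ} (hφ : StrictMono φ) :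
    WeakTendsto (fun k => x (φ k)) x₀ :=
  fun y => (h y).comp hφ.tendsto_atTop

/-- Sequential Banach–Alaoglu in the dual, carried back by the Riesz isomorphism; separability makes
subsequences suffice. -/
theorem exists_subseq_weakTendsto {H : Type*} [NormedAddCommGroup H] [InnerProductSpace ℝ H]
    [CompleteSpace H] [TopologicalSpace.SeparableSpace H] (x : ℕ → H) (C : ℝ)
    (hx : ∀ k, ‖x k‖ ≤ C) :
    ∃ (x₀ : H) (φ : ℕ → ℕ), StrictMono φ ∧ WeakTendsto (fun k => x (φ k)) x₀ := by
  have hs := WeakDual.isSeqCompact_closedBall ℝ (E := H) 0 C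
  obtain ⟨a, -, φ, hφ, hlim⟩ := hs (x := fun k => StrongDual.toWeakDual
    (InnerProductSpace.toDual ℝ H (x k))) (by
      intro k
      simp only [mem_preimage, Metric.mem_closedBall, dist_zero_right]
      have : ‖(InnerProductSpace.toDual ℝ H) (x k)‖ ≤ C := by
        rw [LinearIsometryEquiv.norm_map]; exact hx k
      exact this)
  refine ⟨(InnerProductSpace.toDual ℝ H).symm (WeakDual.toStrongDual a), φ, hφ, fun y => ?_⟩
  have h1 := ((WeakDual.eval_continuous (𝕜 := ℝ) y).tendsto a).comp hlim
  rw [InnerProductSpace.toDual_symm_apply]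
  exact h1

theorem WeakTendsto.inner_tendsto {H : Type*} [NormedAddCommGroup H] [InnerProductSpace ℝ H]
    {x y : ℕ → H} {x₀ y₀ : H} (hx : WeakTendsto x x₀) {C : ℝ} (hC : ∀ k, ‖x k‖ ≤ C)
    (hy : Tendsto y atTop (𝓝 y₀)) :
    Tendsto (fun k => ⟪x k, y k⟫) atTop (𝓝 ⟪x₀, y₀⟫) := by
  have h1 : Tendsto (fun k => ⟪x k, y k - y₀⟫) atTop (𝓝 0) := by
    have hz : Tendsto (fun k => C * ‖y k - y₀‖) atTop (𝓝 0) := by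
      have := (tendsto_iff_norm_sub_tendsto_zero.1 hy).const_mul C
      simpa using this
    refine squeeze_zero_norm (fun k => ?_) hz
    exact (norm_inner_le_norm _ _).trans
      (mul_le_mul_of_nonneg_right (hC k) (norm_nonneg _))
  have h2 := h1.add (hx y₀)
  simpa [inner_sub_right] using h2

/-- A bounded linear map sends weakly convergent sequences to weakly convergent sequences. -/
theorem WeakTendsto.map {H H' : Type*} [NormedAddCommGroup H] [InnerProductSpace ℝ H]
    [CompleteSpace H] [NormedAddCommGroup H'] [InnerProductSpace ℝ H'] [CompleteSpace H']
    {x : ℕ → H} {x₀ : H} (hx : WeakTendsto x x₀) (T : H →L[ℝ] H') :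
    WeakTendsto (fun k => T (x k)) (T x₀) := by
  intro y
  simpa [ContinuousLinearMap.adjoint_inner_right] using hx (ContinuousLinearMap.adjoint T y)

/-- The equation `N x + t K x = y` is the fixed point equation `x = N⁻¹(y - t K x)`. The inverse is
`C`-Lipschitz by `hN`, so the right side contracts by `C |t| ℓ ≤ 1/2`. -/
theorem surjective_of_contraction_step {E W : Type*} [NormedAddCommGroup E] [CompleteSpace E]
    [NormedAddCommGroup W] [NormedSpace ℝ W] {N K : E → W} {C ℓ t : ℝ} (hC : 0 ≤ C)
    (hK : ∀ x y, ‖K x - K y‖ ≤ ℓ * ‖x - y‖) (hN : ∀ x y, ‖x - y‖ ≤ C * ‖N x - N y‖)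
    (hs : Function.Surjective N) (ht : C * (|t| * ℓ) ≤ 1 / 2) :
    Function.Surjective fun x => N x + t • K x := by
  intro y
  choose g hg using hs
  let P : E → E := fun x => g (y - t • K x)
  have hP : ContractingWith (1 / 2) P := by
    refine ⟨by norm_num, LipschitzWith.of_dist_le_mul fun x x' => ?_⟩
    rw [dist_eq_norm, dist_eq_norm]
    have h1 : N (P x) - N (P x') = t • (K x' - K x) := by
      simp only [P, hg, smul_sub]; abel
    calc ‖P x - P x'‖ ≤ C * ‖N (P x) - N (P x')‖ := hN _ _
      _ = C * (|t| * ‖K x' - K x‖) := by rw [h1, norm_smul, Real.norm_eq_abs]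
      _ ≤ C * (|t| * (ℓ * ‖x' - x‖)) := by gcongr; exact hK _ _
      _ = (C * (|t| * ℓ)) * ‖x - x'‖ := by rw [norm_sub_rev]; ring
      _ ≤ (1 / 2) * ‖x - x'‖ := by gcongr
      _ = _ := by simp
  have hfix := hP.fixedPoint_isFixedPt
  refine ⟨ContractingWith.fixedPoint P hP, ?_⟩
  have h2 : N (P (ContractingWith.fixedPoint P hP)) = y - t • K (ContractingWith.fixedPoint P hP) :=
    hg _
  rw [hfix] at h2
  beta_reduce
  rw [h2, sub_add_cancel]

/-- The method of continuity for Lipschitz perturbations. -/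
theorem surjective_of_continuation {E W : Type*} [NormedAddCommGroup E] [CompleteSpace E]
    [NormedAddCommGroup W] [NormedSpace ℝ W] {N K : E → W} {C ℓ : ℝ} (hC : 0 ≤ C) (hℓ : 0 ≤ ℓ)
    (hK : ∀ x y, ‖K x - K y‖ ≤ ℓ * ‖x - y‖)
    (hN : ∀ s : ℝ, 0 ≤ s → s ≤ 1 → ∀ x y, ‖x - y‖ ≤ C * ‖(N x + s • K x) - (N y + s • K y)‖)
    (h0 : Function.Surjective N) :
    Function.Surjective fun x => N x + K x := by
  obtain ⟨n, hn⟩ := exists_nat_gt (2 * C * ℓ)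
  have hn0 : (0 : ℝ) < n := lt_of_le_of_lt (by positivity) hn
  have key : ∀ k : ℕ, k ≤ n → Function.Surjective fun x => N x + ((k : ℝ) / n) • K x := by
    intro k
    induction k with
    | zero => intro _; simpa using h0
    | succ k ih =>
      intro hk
      have hk' : (k : ℝ) ≤ n := by exact_mod_cast (Nat.le_of_succ_le hk)
      have := surjective_of_contraction_step (t := 1 / n) hC hK
        (hN ((k : ℝ) / n) (by positivity) ((div_le_one hn0).2 hk')) (ih (Nat.le_of_succ_le hk)) (by
          rw [abs_of_pos (by positivity)]
          rw [show C * (1 / (n : ℝ) * ℓ) = (C * ℓ) / n by ring, div_le_iff₀ hn0]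
          linarith)
      convert this using 2 with x
      rw [add_assoc, ← add_smul]
      push_cast
      congr 2
      ring
  have h1 := key n le_rfl
  simpa [div_self hn0.ne'] using h1

/-- The supergradients of a concave function form a maximal monotone graph. -/
theorem exists_resolvent {V : Type*} [NormedAddCommGroup V] [InnerProductSpace ℝ V]
    [CompleteSpace V] {gg : V → ℝ} {S : V → Set V} (hne : ∀ r, (S r).Nonempty)
    (hsup : ∀ r, ∀ m ∈ S r, ∀ r', gg r' - gg r ≤ ⟪m, r' - r⟫)
    (hconv : ∀ r, Convex ℝ (S r)) (hcl : ∀ r, IsClosed (S r))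
    (hdir : ∀ r k, ∃ t : ℕ → ℝ, (∀ j, 0 < t j) ∧ Tendsto t atTop (𝓝 0) ∧
      ∃ mm : ℕ → V, (∀ j, mm j ∈ S (r + t j • k)) ∧
        ∃ m ∈ S r, Tendsto (fun j => ⟪mm j, k⟫) atTop (𝓝 ⟪m, k⟫))
    {l : ℝ} (hl : 0 < l) (R : V) : ∃ r, ∃ m ∈ S r, r = R + l • m := by
  -- At a minimiser of `ψ` the stationarity condition is `(r - R) / l ∈ S r`, which is the claim.
  let ψ : V → ℝ := fun r => ‖r - R‖ ^ 2 / (2 * l) - gg r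
  obtain ⟨m₀, hm₀⟩ := hne R
  have hbelow : ∀ r, -gg R - l * ‖m₀‖ ^ 2 / 2 ≤ ψ r := by
    intro r
    have h1 := hsup R m₀ hm₀ r
    have h2 := real_inner_le_norm m₀ (r - R)
    have h3 : ‖m₀‖ * ‖r - R‖ ≤ ‖r - R‖ ^ 2 / (2 * l) + l * ‖m₀‖ ^ 2 / 2 := by
      rw [div_add_div _ _ (by positivity) (by norm_num), le_div_iff₀ (by positivity)]
      nlinarith [sq_nonneg (‖r - R‖ - l * ‖m₀‖)]
    simp only [ψ]
    linarith
  have hbdd : BddBelow (range ψ) := ⟨_, by rintro _ ⟨r, rfl⟩; exact hbelow r⟩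
  -- Strong convexity: the parallelogram law for the quadratic part, and a supergradient at the
  -- midpoint for the concavity of `gg`. It makes minimising sequences Cauchy.
  have hmid : ∀ a c, ‖a - c‖ ^ 2 / (4 * l) ≤ ψ a + ψ c - 2 * ψ ((1 / 2 : ℝ) • (a + c)) := by
    intro a c
    set d := (1 / 2 : ℝ) • (a + c) with hd
    obtain ⟨m, hm⟩ := hne d
    have h1 := hsup d m hm a
    have h2 := hsup d m hm c
    have h3 : ⟪m, a - d⟫ + ⟪m, c - d⟫ = 0 := by
      rw [← inner_add_right]
      have : a - d + (c - d) = 0 := by rw [hd]; module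
      rw [this, inner_zero_right]
    have hp := parallelogram_law_with_norm ℝ (a - R) (c - R)
    have e1 : a - R + (c - R) = (2 : ℝ) • (d - R) := by rw [hd]; module
    have e2 : a - R - (c - R) = a - c := by abel
    rw [e1, e2, norm_smul] at hp
    simp only [Real.norm_ofNat] at hp
    have h4 : ‖a - c‖ ^ 2 = 2 * ‖a - R‖ ^ 2 + 2 * ‖c - R‖ ^ 2 - 4 * ‖d - R‖ ^ 2 := by
      nlinarith [hp]
    have h5 : ‖a - c‖ ^ 2 / (4 * l)
        = ‖a - R‖ ^ 2 / (2 * l) + ‖c - R‖ ^ 2 / (2 * l) - 2 * (‖d - R‖ ^ 2 / (2 * l)) := by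
      rw [h4]; field_simp; ring
    simp only [ψ]
    linarith
  set I := ⨅ r, ψ r with hI
  have hIle : ∀ r, I ≤ ψ r := fun r => ciInf_le hbdd r
  have hseq : ∀ k : ℕ, ∃ r, ψ r < I + 1 / ((k : ℝ) + 1) := fun k =>
    exists_lt_of_ciInf_lt (lt_add_of_pos_right _ (by positivity))
  choose x hx using hseq
  have hcau : CauchySeq x := by
    refine cauchySeq_of_le_tendsto_0 (fun N : ℕ => √(8 * l * (1 / ((N : ℝ) + 1)))) ?_ ?_
    · intro i j N hi hj
      rw [dist_eq_norm]
      refine Real.le_sqrt_of_sq_le ?_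
      have h1 := hmid (x i) (x j)
      have h2 := hIle ((1 / 2 : ℝ) • (x i + x j))
      have hi' : 1 / ((i : ℝ) + 1) ≤ 1 / ((N : ℝ) + 1) := by gcongr
      have hj' : 1 / ((j : ℝ) + 1) ≤ 1 / ((N : ℝ) + 1) := by gcongr
      have h3 : ‖x i - x j‖ ^ 2 / (4 * l) ≤ 2 * (1 / ((N : ℝ) + 1)) := by
        linarith [hx i, hx j]
      rw [div_le_iff₀ (by positivity)] at h3
      linarith
    · have := (tendsto_one_div_add_atTop_nhds_zero_nat (𝕜 := ℝ)).const_mul (8 * l)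
      have h2 := (Real.continuous_sqrt.tendsto _).comp this
      simpa [Function.comp_def] using h2
  obtain ⟨r, hr⟩ := cauchySeq_tendsto_of_complete hcau
  -- No continuity of `gg` is assumed: a supergradient at `r` bounds `gg (x k)` above by `gg r + ⟪m,
  -- x k - r⟫`, which gives the semicontinuity needed.
  have hmin : ∀ r', ψ r ≤ ψ r' := by
    intro r'
    refine le_trans ?_ (hIle r')
    obtain ⟨m, hm⟩ := hne r
    have hc : Tendsto (fun k => ‖x k - R‖ ^ 2 / (2 * l) - gg r - ⟪m, x k - r⟫
        - 1 / ((k : ℝ) + 1)) atTop (𝓝 (‖r - R‖ ^ 2 / (2 * l) - gg r - ⟪m, r - r⟫ - 0)) := by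
      refine Tendsto.sub ?_ tendsto_one_div_add_atTop_nhds_zero_nat
      have hcont : Continuous fun z : V => ‖z - R‖ ^ 2 / (2 * l) - gg r - ⟪m, z - r⟫ := by
        fun_prop
      exact (hcont.tendsto r).comp hr
    have hle : ∀ k, ‖x k - R‖ ^ 2 / (2 * l) - gg r - ⟪m, x k - r⟫ - 1 / ((k : ℝ) + 1) ≤ I := by
      intro k
      have h1 := hsup r m hm (x k)
      have h2 := hx k
      simp only [ψ] at h2
      linarith
    have := le_of_tendsto' hc hle
    simpa [ψ] using this
  -- First variation of `ψ` along `k`: the supergradients at the displaced points are used first,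
  -- and `hdir` supplies their limit in `S r`.
  have hfirst : ∀ k, ∃ m ∈ S r, ⟪m, k⟫ ≤ ⟪(1 / l) • (r - R), k⟫ := by
    intro k
    obtain ⟨t, ht, ht0, mm, hmm, m, hm, hlim⟩ := hdir r k
    refine ⟨m, hm, ?_⟩
    have hle : ∀ j, ⟪mm j, k⟫ ≤ ⟪(1 / l) • (r - R), k⟫ + t j * (‖k‖ ^ 2 / (2 * l)) := by
      intro j
      have h1 := hsup _ _ (hmm j) r
      have h2 := hmin (r + t j • k)
      have e1 : r - (r + t j • k) = -(t j • k) := by abel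
      rw [e1, inner_neg_right, real_inner_smul_right] at h1
      have e2 : r + t j • k - R = (r - R) + t j • k := by abel
      simp only [ψ] at h2
      rw [e2, norm_add_sq_real, real_inner_smul_right, norm_smul, Real.norm_eq_abs,
        abs_of_pos (ht j)] at h2
      rw [real_inner_smul_left]
      have h3 : t j * ⟪mm j, k⟫ ≤ t j * (1 / l * ⟪r - R, k⟫ + t j * (‖k‖ ^ 2 / (2 * l))) := by
        have e3 : (‖r - R‖ ^ 2 + 2 * (t j * ⟪r - R, k⟫) + (t j * ‖k‖) ^ 2) / (2 * l)
            = ‖r - R‖ ^ 2 / (2 * l)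
              + t j * (1 / l * ⟪r - R, k⟫ + t j * (‖k‖ ^ 2 / (2 * l))) := by
          field_simp; ring
        rw [e3] at h2
        linarith
      exact le_of_mul_le_mul_left h3 (ht j)
    have hl2 : Tendsto (fun j => ⟪(1 / l) • (r - R), k⟫ + t j * (‖k‖ ^ 2 / (2 * l))) atTop
        (𝓝 (⟪(1 / l) • (r - R), k⟫ + 0 * (‖k‖ ^ 2 / (2 * l)))) :=
      tendsto_const_nhds.add (ht0.mul_const _)
    have := le_of_tendsto_of_tendsto' hlim hl2 hle
    simpa using this
  -- Otherwise a functional would separate the point strictly from the closed convex set `S r`, and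
  -- `hfirst` fails in that direction.
  have hmem : (1 / l) • (r - R) ∈ S r := by
    by_contra hnot
    obtain ⟨g, u, hgu, hug⟩ := geometric_hahn_banach_point_closed (hconv r) (hcl r) hnot
    obtain ⟨m, hm, hmk⟩ := hfirst ((InnerProductSpace.toDual ℝ V).symm g)
    rw [real_inner_comm, InnerProductSpace.toDual_symm_apply, real_inner_comm,
      InnerProductSpace.toDual_symm_apply] at hmk
    linarith [hug m hm]
  refine ⟨r, _, hmem, ?_⟩
  rw [smul_smul, mul_one_div_cancel hl.ne', one_smul]
  abel

/-- Perturbation of a maximal monotone graph by a monotone Lipschitz map. -/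
theorem exists_mem_of_resolvent {V : Type*} [NormedAddCommGroup V] [InnerProductSpace ℝ V]
    [CompleteSpace V] {S : V → Set V}
    (hmono : ∀ r₁ r₂, ∀ m₁ ∈ S r₁, ∀ m₂ ∈ S r₂, ⟪m₁ - m₂, r₁ - r₂⟫ ≤ 0)
    (hres : ∀ l : ℝ, 0 < l → ∀ R, ∃ r, ∃ m ∈ S r, r = R + l • m)
    {F : V → V} {c : ℝ} (hF : ∀ x y, ‖F x - F y‖ ≤ c * ‖x - y‖)
    (hFm : ∀ x y, 0 ≤ ⟪F x - F y, x - y⟫) {μ : ℝ} (hμ : 0 < μ) :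
    ∃ m, m ∈ S (F m + μ • m) := by
  -- Chosen so that `2 μ (l - μ) = μ² + c²`, hence `l² - (l - μ)² = 2 μ² + c² > c²`; this is the
  -- contraction condition `hq`.
  set l : ℝ := (μ ^ 2 + c ^ 2) / (2 * μ) + μ with hl_def
  have hl : 0 < l := by positivity
  have hlμ : 0 ≤ l - μ := by rw [hl_def]; simp; positivity
  -- Forward–backward splitting: a fixed point `m` of `P` has `r m = F m - (l - μ) m + l m = F m + μ
  -- m`.
  choose r P hP hr using fun x : V => hres l hl (F x - (l - μ) • x)
  have hq : (l - μ) ^ 2 + c ^ 2 < l ^ 2 := by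
    have : 2 * μ * (l - μ) = μ ^ 2 + c ^ 2 := by rw [hl_def]; field_simp; ring
    nlinarith
  set q : ℝ := √((l - μ) ^ 2 + c ^ 2) / l with hqdef
  have hq0 : 0 ≤ q := by positivity
  have hq1 : q < 1 := by
    rw [hqdef, div_lt_one hl]
    exact (Real.sqrt_lt' hl).2 hq
  have hcontr : ContractingWith (⟨q, hq0⟩ : ℝ≥0) P := by
    refine ⟨by exact_mod_cast hq1, LipschitzWith.of_dist_le_mul fun x y => ?_⟩
    rw [dist_eq_norm, dist_eq_norm]
    show _ ≤ q * _
    set δ := (F x - F y) - (l - μ) • (x - y) with hδ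
    -- In the expansion of `‖δ‖²` the cross term has a favourable sign, because `F` is monotone.
    have hδn : ‖δ‖ ≤ √((l - μ) ^ 2 + c ^ 2) * ‖x - y‖ := by
      rw [← Real.sqrt_sq (norm_nonneg (x - y)), ← Real.sqrt_mul (by positivity)]
      refine Real.le_sqrt_of_sq_le ?_
      rw [hδ, norm_sub_sq_real, real_inner_smul_right, norm_smul, Real.norm_eq_abs,
        abs_of_nonneg hlμ]
      have h1 : ‖F x - F y‖ ^ 2 ≤ (c * ‖x - y‖) ^ 2 := by gcongr; exact hF x y
      have h2 := mul_nonneg hlμ (hFm x y)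
      nlinarith
    have hrr : r x - r y = l • (P x - P y) + δ := by
      rw [hr x, hr y, hδ]; module
    have hm := hmono _ _ _ (hP x) _ (hP y)
    rw [hrr, inner_add_right, real_inner_smul_right, real_inner_self_eq_norm_sq] at hm
    have h3 : -(‖P x - P y‖ * ‖δ‖) ≤ ⟪P x - P y, δ⟫ :=
      neg_le_of_abs_le (abs_real_inner_le_norm _ _)
    have h4 : l * ‖P x - P y‖ ≤ ‖δ‖ := by
      by_cases h0 : ‖P x - P y‖ = 0
      · rw [h0]; simp
      · have : 0 < ‖P x - P y‖ := lt_of_le_of_ne (norm_nonneg _) (Ne.symm h0)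
        nlinarith
    rw [hqdef, div_mul_eq_mul_div, le_div_iff₀ hl]
    linarith
  have hfix : P (ContractingWith.fixedPoint P hcontr) = ContractingWith.fixedPoint P hcontr :=
    hcontr.fixedPoint_isFixedPt
  set m := ContractingWith.fixedPoint P hcontr
  refine ⟨m, ?_⟩
  have h1 := hP m
  rw [hr m, hfix] at h1
  convert h1 using 2
  module

end Abstract

/-! ### Sobolev functions with zero boundary values -/

section Translation

variable {n : ℕ}

theorem integral_norm_mul_norm_le {α E E' : Type*} [MeasurableSpace α] {μ : Measure α}
    [NormedAddCommGroup E] [NormedAddCommGroup E'] {f : α → E} {g : α → E'}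
    (hf : MemLp f 2 μ) (hg : MemLp g 2 μ) :
    ∫ x, ‖f x‖ * ‖g x‖ ∂μ ≤ (eLpNorm f 2 μ).toReal * (eLpNorm g 2 μ).toReal := by
  have h := real_inner_le_norm (hf.norm.toLp) (hg.norm.toLp)
  rw [L2.inner_def, Lp.norm_toLp, Lp.norm_toLp, eLpNorm_norm, eLpNorm_norm] at h
  refine le_trans (le_of_eq (integral_congr_ae ?_)) h
  filter_upwards [hf.norm.coeFn_toLp, hg.norm.coeFn_toLp] with x h1 h2
  rw [h1, h2]
  simp [mul_comm]

theorem inner_gradient {φ : Eucl n → ℝ} (x y : Eucl n) : ⟪∇ φ x, y⟫ = fderiv ℝ φ x y := by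
  rw [gradient, InnerProductSpace.toDual_symm_apply]

theorem continuous_gradient {φ : Eucl n → ℝ} (hφ : ContDiff ℝ 1 φ) :
    Continuous fun x => ∇ φ x := by
  unfold gradient
  exact (LinearIsometryEquiv.continuous _).comp (hφ.continuous_fderiv (by simp))

theorem hasCompactSupport_gradient {φ : Eucl n → ℝ} (hφ : HasCompactSupport φ) :
    HasCompactSupport fun x => ∇ φ x := by
  refine (hφ.fderiv (𝕜 := ℝ)).mono ?_
  intro x hx h0
  apply hx
  simp [gradient, h0]

/-- Translating a compactly supported function by `y` changes it by at most `|y|` times its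
gradient, in the weak form `⟨φ, φ - φ(· + y)⟩ ≤ |y| ‖φ‖ ‖∇φ‖`. -/
theorem integral_mul_sub_translate_le {φ : Eucl n → ℝ} (hφ : ContDiff ℝ 1 φ)
    (hc : HasCompactSupport φ) (y : Eucl n) :
    ∫ x, φ x * (φ x - φ (x + y))
      ≤ ‖y‖ * ((eLpNorm φ 2 volume).toReal * (eLpNorm (fun x => ∇ φ x) 2 volume).toReal) := by
  have hcont := hφ.continuous
  have hg := continuous_gradient hφ
  have hgc := hasCompactSupport_gradient hc
  have hm : MemLp φ 2 volume := hcont.memLp_of_hasCompactSupport hc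
  have hgm : MemLp (fun x => ∇ φ x) 2 volume := hg.memLp_of_hasCompactSupport hgc
  obtain ⟨C, hC⟩ := hgc.exists_bound_of_continuous hg
  have hderiv : ∀ (x : Eucl n) (t : ℝ),
      HasDerivAt (fun t : ℝ => φ x * φ (x + t • y)) (φ x * ⟪∇ φ (x + t • y), y⟫) t := by
    intro x t
    have h1 : HasDerivAt (fun t : ℝ => x + t • y) y t := by
      simpa using ((hasDerivAt_id t).smul_const y).const_add x
    have h2 := ((hφ.differentiable (by simp)) (x + t • y)).hasFDerivAt.comp_hasDerivAt t h1
    rw [inner_gradient]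
    exact h2.const_mul (φ x)
  have hint : ∀ t : ℝ, Integrable (fun x => φ x * φ (x + t • y)) :=
    fun t => (by fun_prop : Continuous _).integrable_of_hasCompactSupport hc.mul_right
  -- The correlation `t ↦ ∫ φ(x) φ(x + t y)` is differentiated under the integral; the mean value
  -- inequality on `[0, 1]` then gives the estimate.
  have hpar : ∀ t : ℝ, HasDerivAt (fun t : ℝ => ∫ x, φ x * φ (x + t • y))
      (∫ x, φ x * ⟪∇ φ (x + t • y), y⟫) t := by
    intro t
    refine (hasDerivAt_integral_of_dominated_loc_of_deriv_le (s := univ)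
      (F' := fun t x => φ x * ⟪∇ φ (x + t • y), y⟫)
      (bound := fun x => ‖φ x‖ * (C * ‖y‖)) Filter.univ_mem
      (Eventually.of_forall fun t => (hint t).aestronglyMeasurable) (hint t) ?_ ?_ ?_ ?_).2
    · exact (by fun_prop : Continuous fun x => φ x * ⟪∇ φ (x + t • y), y⟫).aestronglyMeasurable
    · refine Eventually.of_forall fun x s _ => ?_
      rw [norm_mul]
      gcongr
      exact (norm_inner_le_norm _ _).trans (by gcongr; exact hC _)
    · exact ((hcont.integrable_of_hasCompactSupport hc).norm).mul_const _
    · exact Eventually.of_forall fun x s _ => hderiv x s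
  have hbound : ∀ t : ℝ, ‖∫ x, φ x * ⟪∇ φ (x + t • y), y⟫‖ ≤
      ‖y‖ * ((eLpNorm φ 2 volume).toReal * (eLpNorm (fun x => ∇ φ x) 2 volume).toReal) := by
    intro t
    have hmp : MeasurePreserving (fun x : Eucl n => x + t • y) volume volume :=
      measurePreserving_add_right volume _
    have hgt : MemLp (fun x => ∇ φ (x + t • y)) 2 volume := hgm.comp_measurePreserving hmp
    have e := eLpNorm_comp_measurePreserving (p := 2) hgm.1 hmp
    have h1 := integral_norm_mul_norm_le hm hgt
    have hi : Integrable fun x => ‖φ x‖ * ‖∇ φ (x + t • y)‖ := by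
      refine (by fun_prop : Continuous _).integrable_of_hasCompactSupport ?_
      exact hc.norm.mul_right
    calc ‖∫ x, φ x * ⟪∇ φ (x + t • y), y⟫‖ ≤ ∫ x, ‖y‖ * (‖φ x‖ * ‖∇ φ (x + t • y)‖) := by
          refine norm_integral_le_of_norm_le (hi.const_mul _) (Eventually.of_forall fun x => ?_)
          rw [norm_mul]
          have := norm_inner_le_norm (𝕜 := ℝ) (∇ φ (x + t • y)) y
          calc ‖φ x‖ * ‖⟪∇ φ (x + t • y), y⟫‖ ≤ ‖φ x‖ * (‖∇ φ (x + t • y)‖ * ‖y‖) := by gcongr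
            _ = _ := by ring
      _ = ‖y‖ * ∫ x, ‖φ x‖ * ‖∇ φ (x + t • y)‖ := integral_const_mul _ _
      _ ≤ _ := by
          gcongr
          refine h1.trans (le_of_eq ?_)
          congr 2
  have hmv := norm_image_sub_le_of_norm_deriv_le_segment_01'
    (fun t _ => (hpar t).hasDerivWithinAt) (fun t _ => hbound t)
  simp only [one_smul, zero_smul, add_zero] at hmv
  have h1 := hint 1
  have h0 := hint 0
  simp only [one_smul, zero_smul, add_zero] at h1 h0
  have e : ∫ x, φ x * (φ x - φ (x + y)) = -((∫ x, φ x * φ (x + y)) - ∫ x, φ x * φ x) := by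
    simp only [mul_sub]
    rw [integral_sub h0 h1]; ring
  rw [e]
  exact (neg_le_abs _).trans hmv

theorem eLpNorm_toReal_mul_self {φ : Eucl n → ℝ} {μ : Measure (Eucl n)} (hm : MemLp φ 2 μ) :
    (eLpNorm φ 2 μ).toReal * (eLpNorm φ 2 μ).toReal = ∫ x, φ x * φ x ∂μ := by
  have h := real_inner_self_eq_norm_mul_norm (hm.toLp)
  rw [Lp.norm_toLp, L2.inner_def] at h
  rw [← h]
  refine integral_congr_ae ?_
  filter_upwards [hm.coeFn_toLp] with x hx
  simp [hx, pow_two]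

/-- The translation estimate integrated over `‖y‖ < h`. It controls `‖φ‖²` by the pairing of `φ`
with its integrals over small balls, up to an error of order `h`. -/
theorem integral_mul_sub_ball_average_le {φ : Eucl n → ℝ} (hφ : ContDiff ℝ 1 φ)
    (hc : HasCompactSupport φ) (h : ℝ) :
    volume.real (Metric.ball (0 : Eucl n) h) * ∫ x, φ x * φ x
      ≤ (∫ x, φ x * (∫ y in Metric.ball (0 : Eucl n) h, φ (x + y)))
        + volume.real (Metric.ball (0 : Eucl n) h) *
          (h * ((eLpNorm φ 2 volume).toReal * (eLpNorm (fun x => ∇ φ x) 2 volume).toReal)) := by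
  set B := Metric.ball (0 : Eucl n) h with hB
  set A := (eLpNorm φ 2 volume).toReal * (eLpNorm (fun x => ∇ φ x) 2 volume).toReal with hA
  have hA0 : 0 ≤ A := by positivity
  have hBfin : volume B < ∞ := measure_ball_lt_top
  have : IsFiniteMeasure (volume.restrict B) := ⟨by simpa using hBfin⟩
  have hcont := hφ.continuous
  obtain ⟨C, hC⟩ := hc.exists_bound_of_continuous hcont
  have hi : Integrable φ := hcont.integrable_of_hasCompactSupport hc
  have hi2 : Integrable fun x => φ x * φ x :=
    (hcont.mul hcont).integrable_of_hasCompactSupport hc.mul_right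
  have hprod : Integrable (Function.uncurry fun x y => φ x * φ (x + y))
      (volume.prod (volume.restrict B)) := by
    have hb : Integrable (fun z : Eucl n × Eucl n => ‖φ z.1‖ * C)
        (volume.prod (volume.restrict B)) := by
      have : Integrable (fun _ : Eucl n => C) (volume.restrict B) := integrable_const _
      exact hi.norm.mul_prod this
    refine hb.mono' (by
      exact (by fun_prop : Continuous fun z : Eucl n × Eucl n =>
        φ z.1 * φ (z.1 + z.2)).aestronglyMeasurable) (Eventually.of_forall fun z => ?_)
    simp only [Function.uncurry, norm_mul]
    gcongr
    exact hC _
  have e1 : ∫ x, φ x * (∫ y in B, φ (x + y)) = ∫ y in B, ∫ x, φ x * φ (x + y) := by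
    rw [← integral_integral_swap hprod]
    simp only [integral_const_mul]
  have hle : ∀ y ∈ B, (∫ x, φ x * φ x) - h * A ≤ ∫ x, φ x * φ (x + y) := by
    intro y hy
    have h1 := integral_mul_sub_translate_le hφ hc y
    have hi3 : Integrable fun x => φ x * φ (x + y) :=
      (by fun_prop : Continuous _).integrable_of_hasCompactSupport hc.mul_right
    simp only [mul_sub] at h1
    rw [integral_sub hi2 hi3] at h1
    have h2 : ‖y‖ * A ≤ h * A := by
      gcongr
      exact (mem_ball_zero_iff.1 hy).le
    linarith
  have hmono : ∫ _y in B, ((∫ x, φ x * φ x) - h * A) ≤ ∫ y in B, ∫ x, φ x * φ (x + y) := by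
    refine setIntegral_mono_on ?_ ?_ measurableSet_ball hle
    · exact integrable_const _
    · exact hprod.integral_prod_right
  rw [setIntegral_const, smul_eq_mul] at hmono
  rw [e1]
  linarith

end Translation

/-! ### The Hilbert space `H¹₀(Ω)` and the Poincaré inequality. -/

section Embedding

variable {n : ℕ} {Ω : TopologicalSpace.Opens (Eucl n)}

variable (Ω) in
/-- A synonym of `H01 Ω` whose Hilbert space structure is opaque to unification. -/
def V : Type := H01 Ω

instance : NormedAddCommGroup (V Ω) := inferInstanceAs (NormedAddCommGroup (H01 Ω))

instance : InnerProductSpace ℝ (V Ω) := inferInstanceAs (InnerProductSpace ℝ (H01 Ω))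

instance : CompleteSpace (V Ω) := inferInstanceAs (CompleteSpace (H01 Ω))

/-- The underlying pair of a function and its gradient. -/
def toPair : V Ω →L[ℝ] L2Pair Ω := (H01 Ω).subtypeL

/-- The underlying function of an element of `V Ω`. -/
def vfn (v : V Ω) : L2 Ω := fn (Ω := Ω) v

/-- The gradient of an element of `V Ω`. -/
def vgrad (v : V Ω) : Lp (Eucl n) 2 (vol Ω) := grad (Ω := Ω) v

/-- The embedding `H¹₀(Ω) → L²(Ω)`. -/
def fnL : V Ω →L[ℝ] L2 Ω := (WithLp.fstL 2 ℝ _ _).comp toPair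

/-- The gradient as a bounded linear map on `H¹₀(Ω)`. -/
def gradL : V Ω →L[ℝ] Lp (Eucl n) 2 (vol Ω) := (WithLp.sndL 2 ℝ _ _).comp toPair

@[simp] theorem fnL_apply (v : V Ω) : fnL v = vfn v := rfl

@[simp] theorem gradL_apply (v : V Ω) : gradL v = vgrad v := rfl

theorem norm_sq_eq (v : V Ω) : ‖v‖ ^ 2 = ‖vfn v‖ ^ 2 + ‖vgrad v‖ ^ 2 :=
  WithLp.prod_norm_sq_eq_of_L2 (toPair v)

theorem norm_fn_le (v : V Ω) : ‖vfn v‖ ≤ ‖v‖ := by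
  nlinarith [norm_sq_eq v, norm_nonneg v, norm_nonneg (vfn v), sq_nonneg ‖vgrad v‖]

theorem norm_grad_le (v : V Ω) : ‖vgrad v‖ ≤ ‖v‖ := by
  nlinarith [norm_sq_eq v, norm_nonneg v, norm_nonneg (vgrad v), sq_nonneg ‖vfn v‖]

theorem vfn_injective : Function.Injective (vfn : V Ω → L2 Ω) := fn_injective

theorem memLp_test (φ : 𝓓(Ω, ℝ)) : MemLp (φ : Eucl n → ℝ) 2 (vol Ω) :=
  φ.contDiff.continuous.memLp_of_hasCompactSupport φ.hasCompactSupport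

theorem memLp_gradient_test (φ : 𝓓(Ω, ℝ)) :
    MemLp (fun x => ∇ (φ : Eucl n → ℝ) x) 2 (vol Ω) :=
  (continuous_gradient (φ.contDiff.of_le (by simp))).memLp_of_hasCompactSupport
    (hasCompactSupport_gradient φ.hasCompactSupport)

/-- A test function as an element of `H¹₀(Ω)`. -/
def ofTest (φ : 𝓓(Ω, ℝ)) : V Ω :=
  show H01 Ω from ⟨WithLp.toLp 2 ((memLp_test φ).toLp, (memLp_gradient_test φ).toLp),
    subset_closure ⟨φ, (memLp_test φ).coeFn_toLp, (memLp_gradient_test φ).coeFn_toLp⟩⟩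

theorem fn_ofTest (φ : 𝓓(Ω, ℝ)) : vfn (ofTest φ) =ᵐ[vol Ω] fun x => φ x :=
  (memLp_test φ).coeFn_toLp

theorem grad_ofTest (φ : 𝓓(Ω, ℝ)) :
    vgrad (ofTest φ) =ᵐ[vol Ω] fun x => ∇ (φ : Eucl n → ℝ) x :=
  (memLp_gradient_test φ).coeFn_toLp

theorem exists_test_near (v : V Ω) {ε : ℝ} (hε : 0 < ε) : ∃ φ : 𝓓(Ω, ℝ), ‖v - ofTest φ‖ < ε := by
  obtain ⟨w, ⟨φ, h1, h2⟩, hw⟩ := Metric.mem_closure_iff.1 (show H01 Ω from v).2 ε hε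
  refine ⟨φ, ?_⟩
  have : toPair (ofTest φ) = w := by
    refine WithLp.ofLp_injective 2 (Prod.ext ?_ ?_)
    · exact Lp.ext ((fn_ofTest φ).trans h1.symm)
    · exact Lp.ext ((grad_ofTest φ).trans h2.symm)
  rw [← this] at hw
  have hw : dist (toPair v) (toPair (ofTest φ)) < ε := hw
  rw [dist_eq_norm, ← map_sub] at hw
  exact hw

theorem denseRange_ofTest : DenseRange (ofTest (Ω := Ω)) := by
  intro v
  refine Metric.mem_closure_iff.2 fun ε hε => ?_
  obtain ⟨φ, hφ⟩ := exists_test_near v hε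
  exact ⟨_, ⟨φ, rfl⟩, by rwa [dist_eq_norm]⟩

theorem norm_fn_ofTest (φ : 𝓓(Ω, ℝ)) :
    ‖vfn (ofTest φ)‖ = (eLpNorm (φ : Eucl n → ℝ) 2 volume).toReal := by
  have h : ‖vfn (ofTest φ)‖ = (eLpNorm (φ : Eucl n → ℝ) 2 (vol Ω)).toReal :=
    Lp.norm_toLp _ (memLp_test φ)
  rw [h, eLpNorm_restrict_eq_of_support_subset]
  exact (subset_tsupport _).trans φ.tsupport_subset

theorem norm_grad_ofTest (φ : 𝓓(Ω, ℝ)) :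
    ‖vgrad (ofTest φ)‖ = (eLpNorm (fun x => ∇ (φ : Eucl n → ℝ) x) 2 volume).toReal := by
  have h : ‖vgrad (ofTest φ)‖ = (eLpNorm (fun x => ∇ (φ : Eucl n → ℝ) x) 2 (vol Ω)).toReal :=
    Lp.norm_toLp _ (memLp_gradient_test φ)
  rw [h, eLpNorm_restrict_eq_of_support_subset]
  intro x hx
  by_contra hxn
  apply hx
  have : fderiv ℝ (φ : Eucl n → ℝ) x = 0 :=
    fderiv_of_notMem_tsupport ℝ fun h => hxn (φ.tsupport_subset h)
  simp [gradient, this]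

/-- The Poincaré inequality. -/
theorem exists_poincare (hn : 0 < n) (hΩ : Bornology.IsBounded (Ω : Set (Eucl n))) :
    ∃ C : ℝ, 0 < C ∧ ∀ v : V Ω, ‖vfn v‖ ≤ C * ‖vgrad v‖ := by
  obtain ⟨D, hD⟩ := hΩ.subset_ball (0 : Eucl n)
  set C := 2 * |D| + 1 with hCdef
  have hC : 0 < C := by positivity
  refine ⟨C, hC, fun v => ?_⟩
  have hcl : IsClosed {v : V Ω | ‖vfn v‖ ≤ C * ‖vgrad v‖} :=
    isClosed_le (fnL (Ω := Ω)).continuous.norm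
      ((gradL (Ω := Ω)).continuous.norm.const_smul C)
  refine (hcl.closure_subset_iff.2 ?_) (denseRange_ofTest v)
  rintro _ ⟨φ, rfl⟩
  simp only [mem_ofPred_eq, norm_fn_ofTest, norm_grad_ofTest]
  -- This translation is longer than the diameter of the ball containing `Ω`, so `φ(x) φ(x + y) = 0`
  -- and the translation estimate becomes `‖φ‖² ≤ C ‖φ‖ ‖∇φ‖`.
  set y : Eucl n := EuclideanSpace.single ⟨0, hn⟩ C with hy
  have hyn : ‖y‖ = C := by simp [hy, abs_of_pos hC]
  have h1 := integral_mul_sub_translate_le (φ.contDiff.of_le (by simp)) φ.hasCompactSupport y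
  have h2 : ∀ x, φ x * (φ x - φ (x + y)) = φ x * φ x := by
    intro x
    by_cases hx : φ x = 0
    · simp [hx]
    · have hxΩ : x ∈ Metric.ball (0 : Eucl n) D :=
        hD (φ.tsupport_subset (subset_tsupport _ hx))
      have : φ (x + y) = 0 := by
        by_contra hxy
        have hxyΩ : x + y ∈ Metric.ball (0 : Eucl n) D :=
          hD (φ.tsupport_subset (subset_tsupport _ hxy))
        rw [mem_ball_zero_iff] at hxΩ hxyΩ
        have h3 : ‖y‖ ≤ ‖x + y‖ + ‖x‖ := by
          simpa using norm_sub_le (x + y) x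
        have := le_abs_self D
        linarith
      rw [this, sub_zero]
  simp only [h2] at h1
  have hm : MemLp (φ : Eucl n → ℝ) 2 volume :=
    φ.contDiff.continuous.memLp_of_hasCompactSupport φ.hasCompactSupport
  rw [← eLpNorm_toReal_mul_self hm, hyn] at h1
  by_cases h0 : (eLpNorm (φ : Eucl n → ℝ) 2 volume).toReal = 0
  · rw [h0]; positivity
  · have hpos : 0 < (eLpNorm (φ : Eucl n → ℝ) 2 volume).toReal :=
      lt_of_le_of_ne ENNReal.toReal_nonneg (Ne.symm h0)
    nlinarith

end Embedding

/-! ### Norms and dominated convergence in `L²`. -/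

section L2

variable {α E : Type*} [MeasurableSpace α] {μ : Measure α} [NormedAddCommGroup E]
  [InnerProductSpace ℝ E]

theorem L2_norm_sq (f : Lp E 2 μ) : ‖f‖ ^ 2 = ∫ x, ‖f x‖ ^ 2 ∂μ := by
  rw [← real_inner_self_eq_norm_sq, L2.inner_def]
  simp

theorem L2_tendsto_zero_of_dominated {f : ℕ → Lp E 2 μ} {g : α → ℝ}
    (hg : Integrable (fun x => g x ^ 2) μ) (hb : ∀ k, ∀ᵐ x ∂μ, ‖f k x‖ ≤ g x)
    (h0 : ∀ᵐ x ∂μ, Tendsto (fun k => f k x) atTop (𝓝 0)) :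
    Tendsto f atTop (𝓝 0) := by
  rw [tendsto_zero_iff_norm_tendsto_zero]
  have h1 : Tendsto (fun k => ∫ x, ‖f k x‖ ^ 2 ∂μ) atTop (𝓝 (∫ _x, (0 : ℝ) ∂μ)) := by
    refine tendsto_integral_of_dominated_convergence (fun x => g x ^ 2)
      (fun k => (Lp.aestronglyMeasurable (f k)).norm.pow 2) hg (fun k => ?_) ?_
    · filter_upwards [hb k] with x hx
      rw [norm_pow, norm_norm]
      gcongr
    · filter_upwards [h0] with x hx
      simpa using (hx.norm.pow 2)
  rw [integral_zero] at h1
  have h2 := (Real.continuous_sqrt.tendsto _).comp h1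
  simp only [Function.comp_def, Real.sqrt_zero, ← L2_norm_sq, Real.sqrt_sq (norm_nonneg _)] at h2
  exact h2

end L2

/-! ### Rellich compactness and separability. -/

section Compactness

variable {n : ℕ} {Ω : TopologicalSpace.Opens (Eucl n)}

theorem isFiniteMeasure_vol (hΩ : Bornology.IsBounded (Ω : Set (Eucl n))) :
    IsFiniteMeasure (vol Ω) :=
  ⟨by simpa using hΩ.measure_lt_top⟩

/-- A ball integral is a pairing with a fixed `L²` function, so weak convergence makes it converge
at every centre `x`. -/
theorem integral_ball_translate (φ : 𝓓(Ω, ℝ)) (x : Eucl n) (h : ℝ)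
    (hfin : (vol Ω) (Metric.ball x h) ≠ ∞) :
    ∫ y in Metric.ball (0 : Eucl n) h, φ (x + y)
      = ⟪indicatorConstLp 2 (measurableSet_ball (x := x) (ε := h)) hfin (1 : ℝ),
          vfn (ofTest φ)⟫ := by
  rw [L2.inner_indicatorConstLp_one]
  have e1 : ∫ y in Metric.ball x h, vfn (ofTest φ) y ∂(vol Ω)
      = ∫ y, (Metric.ball x h).indicator (φ : Eucl n → ℝ) y ∂(vol Ω) := by
    rw [integral_indicator measurableSet_ball]
    exact integral_congr_ae (ae_restrict_of_ae (fn_ofTest φ))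
  have e2 : ∫ y, (Metric.ball x h).indicator (φ : Eucl n → ℝ) y ∂(vol Ω)
      = ∫ y, (Metric.ball x h).indicator (φ : Eucl n → ℝ) y := by
    refine setIntegral_eq_integral_of_forall_compl_eq_zero fun y hy => ?_
    have : φ y = 0 := image_eq_zero_of_notMem_tsupport fun h => hy (φ.tsupport_subset h)
    simp [indicator, this]
  rw [e1, e2, ← integral_add_left_eq_self ((Metric.ball x h).indicator (φ : Eucl n → ℝ)) x, ← integral_indicator measurableSet_ball]
  refine integral_congr_ae (Eventually.of_forall fun y => ?_)
  simp [indicator]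

/-- The ball integrals of `φ k` tend to zero pointwise and are uniformly bounded, hence tend to zero
in `L²(Ω)`. By `integral_mul_sub_ball_average_le` the norms of `φ k` are then small up to an error
of order `h`. -/
theorem tendsto_fn_ofTest_zero (hΩ : Bornology.IsBounded (Ω : Set (Eucl n)))
    {φ : ℕ → 𝓓(Ω, ℝ)} {C : ℝ} (hC : ∀ k, ‖ofTest (φ k)‖ ≤ C)
    (hw : WeakTendsto (fun k => ofTest (φ k)) 0) :
    Tendsto (fun k => vfn (ofTest (φ k))) atTop (𝓝 0) := by
  have := isFiniteMeasure_vol hΩ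
  have hC0 : 0 ≤ C := (norm_nonneg _).trans (hC 0)
  have hfw : WeakTendsto (fun k => vfn (ofTest (φ k))) (fnL (Ω := Ω) 0) := hw.map fnL
  rw [map_zero] at hfw
  have key : ∀ h : ℝ, 0 < h → Tendsto (fun k => ∫ x, φ k x *
      (∫ y in Metric.ball (0 : Eucl n) h, φ k (x + y))) atTop (𝓝 0) := by
    intro h hh
    set G : ℕ → Eucl n → ℝ := fun k x => ∫ y in Metric.ball (0 : Eucl n) h, φ k (x + y) with hG
    have hGm : ∀ k, StronglyMeasurable (G k) := by
      intro k
      have hcont : Continuous fun z : Eucl n × Eucl n => φ k (z.1 + z.2) :=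
        (φ k).contDiff.continuous.comp (by fun_prop)
      exact hcont.stronglyMeasurable.integral_prod_right
    set D : ℝ := √((vol Ω).real univ) * C with hD
    have hGb : ∀ k x, ‖G k x‖ ≤ D := by
      intro k x
      simp only [hG]
      rw [integral_ball_translate (φ k) x h (measure_ne_top _ _)]
      refine (norm_inner_le_norm _ _).trans ?_
      refine mul_le_mul ?_ ((norm_fn_le _).trans (hC k)) (norm_nonneg _) (Real.sqrt_nonneg _)
      rw [norm_indicatorConstLp (by norm_num) (by norm_num)]
      rw [Real.sqrt_eq_rpow]
      simp only [norm_one, one_mul, ENNReal.toReal_ofNat]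
      exact Real.rpow_le_rpow measureReal_nonneg (measureReal_mono (subset_univ _)) (by norm_num)
    have hG0 : ∀ x, Tendsto (fun k => G k x) atTop (𝓝 0) := by
      intro x
      have := hfw (indicatorConstLp 2 (measurableSet_ball (x := x) (ε := h))
        (measure_ne_top (vol Ω) _) (1 : ℝ))
      rw [inner_zero_left] at this
      refine this.congr fun k => ?_
      rw [real_inner_comm, ← integral_ball_translate]
    have hGmem : ∀ k, MemLp (G k) 2 (vol Ω) := fun k =>
      MemLp.of_bound (hGm k).aestronglyMeasurable D (Eventually.of_forall (hGb k))
    have hGL : Tendsto (fun k => (hGmem k).toLp) atTop (𝓝 0) := by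
      refine L2_tendsto_zero_of_dominated (g := fun _ => D) (integrable_const _) (fun k => ?_) ?_
      · filter_upwards [(hGmem k).coeFn_toLp] with x hx
        rw [hx]; exact hGb k x
      · filter_upwards [ae_all_iff.2 fun k => (hGmem k).coeFn_toLp] with x hx
        simp only [hx]; exact hG0 x
    have hz : Tendsto (fun k => C * ‖(hGmem k).toLp‖) atTop (𝓝 0) := by
      simpa using hGL.norm.const_mul C
    refine squeeze_zero_norm (fun k => ?_) hz
    have e : ∫ x, φ k x * G k x = ⟪vfn (ofTest (φ k)), (hGmem k).toLp⟫ := by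
      rw [L2.inner_def]
      symm
      refine Eq.trans (integral_congr_ae ?_)
        (setIntegral_eq_integral_of_forall_compl_eq_zero (s := (Ω : Set (Eucl n))) ?_)
      · filter_upwards [fn_ofTest (φ k), (hGmem k).coeFn_toLp] with x h1 h2
        rw [h1, h2]
        simp [mul_comm]
      · intro x hx
        rw [image_eq_zero_of_notMem_tsupport fun h => hx ((φ k).tsupport_subset h), zero_mul]
    rw [e]
    refine (norm_inner_le_norm _ _).trans ?_
    gcongr
    exact (norm_fn_le _).trans (hC k)
  rw [Metric.tendsto_atTop]
  intro ε hε
  -- Makes the translation error `h C²` less than `ε² / 2`; the other half of `ε²` is left for the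
  -- ball integrals.
  set h : ℝ := ε ^ 2 / (2 * (C * C + 1)) with hh
  have hh0 : 0 < h := by positivity
  set b : ℝ := volume.real (Metric.ball (0 : Eucl n) h) with hb
  have hb0 : 0 < b := by
    rw [hb, measureReal_def]
    exact ENNReal.toReal_pos (Metric.measure_ball_pos _ _ hh0).ne' measure_ball_lt_top.ne
  obtain ⟨N, hN⟩ := Metric.tendsto_atTop.1 (key h hh0) (b * (ε ^ 2 / 2)) (by positivity)
  refine ⟨N, fun k hk => ?_⟩
  have h1 := hN k hk
  rw [dist_zero_right] at h1 ⊢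
  have h2 := integral_mul_sub_ball_average_le ((φ k).contDiff.of_le (by simp))
    (φ k).hasCompactSupport h
  have hm : MemLp (φ k : Eucl n → ℝ) 2 volume :=
    (φ k).contDiff.continuous.memLp_of_hasCompactSupport (φ k).hasCompactSupport
  rw [← eLpNorm_toReal_mul_self hm, ← norm_fn_ofTest, ← norm_grad_ofTest] at h2
  have h3 := (le_abs_self _).trans h1.le
  have h4 : ‖vfn (ofTest (φ k))‖ * ‖vgrad (ofTest (φ k))‖ ≤ C * C :=
    mul_le_mul ((norm_fn_le _).trans (hC k)) ((norm_grad_le _).trans (hC k)) (norm_nonneg _) hC0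
  have h5 : h * (C * C) < ε ^ 2 / 2 := by
    rw [hh, div_mul_eq_mul_div, div_lt_div_iff₀ (by positivity) (by norm_num)]
    nlinarith [pow_pos hε 2]
  have h6 : b * (h * (‖vfn (ofTest (φ k))‖ * ‖vgrad (ofTest (φ k))‖)) ≤ b * (h * (C * C)) := by
    gcongr
  have h7 : b * (‖vfn (ofTest (φ k))‖ * ‖vfn (ofTest (φ k))‖) < b * ε ^ 2 := by
    have := mul_lt_mul_of_pos_left h5 hb0
    linarith
  have h8 := lt_of_mul_lt_mul_left h7 hb0.le
  rw [← pow_two] at h8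
  exact lt_of_pow_lt_pow_left₀ 2 hε.le h8

/-- The Rellich theorem: weak convergence in `H¹₀(Ω)` gives strong convergence in `L²(Ω)`. -/
theorem tendsto_fn_of_weakTendsto (hΩ : Bornology.IsBounded (Ω : Set (Eucl n)))
    {v : ℕ → V Ω} {v₀ : V Ω} {C : ℝ} (hC : ∀ k, ‖v k‖ ≤ C) (hw : WeakTendsto v v₀) :
    Tendsto (fun k => vfn (v k)) atTop (𝓝 (vfn v₀)) := by
  -- Replacing `v k - v₀` by test functions at vanishing distance changes neither the weak limit nor
  -- strong `L²` convergence.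
  choose φ hφ using fun k : ℕ => exists_test_near (v k - v₀)
    (show (0 : ℝ) < 1 / ((k : ℝ) + 1) by positivity)
  have h0 : Tendsto (fun k => (v k - v₀) - ofTest (φ k)) atTop (𝓝 0) :=
    squeeze_zero_norm (fun k => (hφ k).le) tendsto_one_div_add_atTop_nhds_zero_nat
  have hb : ∀ k, ‖ofTest (φ k)‖ ≤ C + ‖v₀‖ + 1 := by
    intro k
    have h1 : ofTest (φ k) = (v k - v₀) - ((v k - v₀) - ofTest (φ k)) := by abel
    have h2 : 1 / ((k : ℝ) + 1) ≤ 1 := by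
      rw [div_le_one (by positivity)]; linarith [(Nat.cast_nonneg k : (0 : ℝ) ≤ k)]
    calc ‖ofTest (φ k)‖ ≤ ‖v k - v₀‖ + ‖(v k - v₀) - ofTest (φ k)‖ := by
          conv_lhs => rw [h1]
          exact norm_sub_le _ _
      _ ≤ (‖v k‖ + ‖v₀‖) + 1 := add_le_add (norm_sub_le _ _) ((hφ k).le.trans h2)
      _ ≤ _ := by gcongr; exact hC k
  have hwφ : WeakTendsto (fun k => ofTest (φ k)) 0 := by
    intro y
    have h1 : Tendsto (fun k => ⟪(v k - v₀) - ofTest (φ k), y⟫) atTop (𝓝 ⟪(0 : V Ω), y⟫) :=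
      h0.inner tendsto_const_nhds
    have h2 := ((hw y).sub_const ⟪v₀, y⟫).sub h1
    rw [inner_zero_left, sub_self, sub_zero] at h2
    rw [inner_zero_left]
    refine h2.congr fun k => ?_
    rw [inner_sub_left, inner_sub_left]
    ring
  have h1 := tendsto_fn_ofTest_zero hΩ hb hwφ
  have h2 := ((fnL (Ω := Ω)).continuous.tendsto 0).comp h0
  rw [map_zero] at h2
  have h3 := (h1.add h2).add_const (vfn v₀)
  rw [add_zero, zero_add] at h3
  refine h3.congr fun k => ?_
  simp only [Function.comp_apply, ← fnL_apply, map_sub]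
  abel

instance : TopologicalSpace.SeparableSpace (V Ω) := by
  have : SecondCountableTopology (L2Pair Ω) := by
    have : Fact ((2 : ℝ≥0∞) ≠ ∞) := ⟨by norm_num⟩
    have : SecondCountableTopology (L2 Ω) := inferInstance
    have : SecondCountableTopology (Lp (Eucl n) 2 (vol Ω)) := inferInstance
    infer_instance
  exact inferInstanceAs (TopologicalSpace.SeparableSpace (H01 Ω))

end Compactness

/-! ### Smooth functions of elements of `H¹₀(Ω)`. -/

section ChainRule

variable {n : ℕ} {Ω : TopologicalSpace.Opens (Eucl n)}

/-- Composition of a test function with a smooth function vanishing at `0`. -/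
def compTest (Φ : ℝ → ℝ) (hΦ : ContDiff ℝ (⊤ : ℕ∞) Φ) (h0 : Φ 0 = 0) (φ : 𝓓(Ω, ℝ)) : 𝓓(Ω, ℝ) :=
  ⟨fun x => Φ (φ x), hΦ.comp φ.contDiff, φ.hasCompactSupport.comp_left h0,
    (closure_mono (Function.support_comp_subset h0 φ)).trans φ.tsupport_subset⟩

theorem gradient_compTest (Φ : ℝ → ℝ) (hΦ : ContDiff ℝ (⊤ : ℕ∞) Φ) (h0 : Φ 0 = 0) (φ : 𝓓(Ω, ℝ))
    (x : Eucl n) :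
    ∇ (compTest Φ hΦ h0 φ : Eucl n → ℝ) x = deriv Φ (φ x) • ∇ (φ : Eucl n → ℝ) x := by
  have h1 : HasDerivAt Φ (deriv Φ (φ x)) (φ x) :=
    ((hΦ.differentiable (by simp)) (φ x)).hasDerivAt
  have h2 := h1.comp_hasFDerivAt x ((φ.contDiff.differentiable (by simp)) x).hasFDerivAt
  have h3 : fderiv ℝ (compTest Φ hΦ h0 φ : Eucl n → ℝ) x
      = deriv Φ (φ x) • fderiv ℝ (φ : Eucl n → ℝ) x := h2.fderiv
  simp [gradient, h3]

/-- The chain rule in `H¹₀(Ω)`. -/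
theorem exists_comp {Φ : ℝ → ℝ} (hΦ : ContDiff ℝ (⊤ : ℕ∞) Φ) (h0 : Φ 0 = 0) {L : ℝ}
    (hL : ∀ t, |deriv Φ t| ≤ L) (v : V Ω) :
    ∃ w : V Ω, (vfn w =ᵐ[vol Ω] fun x => Φ (vfn v x)) ∧
      (vgrad w =ᵐ[vol Ω] fun x => deriv Φ (vfn v x) • vgrad v x) := by
  have hL0 : 0 ≤ L := (abs_nonneg _).trans (hL 0)
  have hlip : LipschitzWith ⟨L, hL0⟩ Φ :=
    lipschitzWith_of_nnnorm_deriv_le (hΦ.differentiable (by simp)) fun t => hL t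
  have hdc : Continuous (deriv Φ) := hΦ.continuous_deriv (by simp)
  choose φ' hφ' using fun k : ℕ => exists_test_near v
    (show (0 : ℝ) < 1 / ((k : ℝ) + 1) by positivity)
  have hconv' : Tendsto (fun k => ofTest (φ' k)) atTop (𝓝 v) := by
    rw [tendsto_iff_norm_sub_tendsto_zero]
    refine squeeze_zero (fun k => norm_nonneg _) (fun k => ?_)
      tendsto_one_div_add_atTop_nhds_zero_nat
    rw [norm_sub_rev]; exact (hφ' k).le
  -- Almost everywhere convergence is needed because `deriv Φ` is only bounded and continuous here:
  -- `deriv Φ (φ k) ∇v` converges by domination.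
  obtain ⟨σ, hσ, hae⟩ := (tendstoInMeasure_of_tendsto_Lp
    (((fnL (Ω := Ω)).continuous.tendsto v).comp hconv')).exists_seq_tendsto_ae
  set φ : ℕ → 𝓓(Ω, ℝ) := fun k => φ' (σ k) with hφdef
  have hconv : Tendsto (fun k => ofTest (φ k)) atTop (𝓝 v) := hconv'.comp hσ.tendsto_atTop
  have hconvf : Tendsto (fun k => vfn (ofTest (φ k))) atTop (𝓝 (vfn v)) :=
    ((fnL (Ω := Ω)).continuous.tendsto v).comp hconv
  have hconvg : Tendsto (fun k => vgrad (ofTest (φ k))) atTop (𝓝 (vgrad v)) :=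
    ((gradL (Ω := Ω)).continuous.tendsto v).comp hconv
  have hmf : MemLp (fun x => Φ (vfn v x)) 2 (vol Ω) := hlip.comp_memLp h0 (Lp.memLp (vfn v))
  have hmg : ∀ z : L2 Ω, MemLp (fun x => deriv Φ (z x) • vgrad v x) 2 (vol Ω) := by
    intro z
    refine MemLp.of_le_mul (c := L) (Lp.memLp (vgrad v)) ?_ (Eventually.of_forall fun x => ?_)
    · exact (hdc.comp_aestronglyMeasurable (Lp.aestronglyMeasurable z)).smul
        (Lp.aestronglyMeasurable _)
    · rw [norm_smul]; gcongr; exact hL _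
  set w : ℕ → V Ω := fun k => ofTest (compTest Φ hΦ h0 (φ k)) with hw
  have hwf : Tendsto (fun k => vfn (w k)) atTop (𝓝 hmf.toLp) := by
    rw [tendsto_iff_norm_sub_tendsto_zero]
    have hz : Tendsto (fun k => L * ‖vfn (ofTest (φ k)) - vfn v‖) atTop (𝓝 0) := by
      simpa using (tendsto_iff_norm_sub_tendsto_zero.1 hconvf).const_mul L
    refine squeeze_zero (fun k => norm_nonneg _) (fun k => ?_) hz
    refine Lp.norm_le_mul_norm_of_ae_le_mul ?_
    filter_upwards [Lp.coeFn_sub (vfn (w k)) hmf.toLp, Lp.coeFn_sub (vfn (ofTest (φ k))) (vfn v),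
      fn_ofTest (compTest Φ hΦ h0 (φ k)), fn_ofTest (φ k), hmf.coeFn_toLp] with x h1 h2 h3 h4 h5
    rw [h1, h2, Pi.sub_apply, Pi.sub_apply, h5, hw, h3, h4]
    exact hlip.norm_sub_le _ _
  have hwg : Tendsto (fun k => vgrad (w k)) atTop (𝓝 (hmg (vfn v)).toLp) := by
    -- The error splits in two: `hA` replaces `∇(φ k)` by `∇v` using the bound `L`, and `hB`
    -- replaces the argument of `deriv Φ`.
    have hA : Tendsto (fun k => vgrad (w k) - (hmg (vfn (ofTest (φ k)))).toLp) atTop (𝓝 0) := by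
      have hz : Tendsto (fun k => L * ‖vgrad (ofTest (φ k)) - vgrad v‖) atTop (𝓝 0) := by
        simpa using (tendsto_iff_norm_sub_tendsto_zero.1 hconvg).const_mul L
      refine squeeze_zero_norm (fun k => ?_) hz
      refine Lp.norm_le_mul_norm_of_ae_le_mul ?_
      filter_upwards [Lp.coeFn_sub (vgrad (w k)) (hmg (vfn (ofTest (φ k)))).toLp,
        Lp.coeFn_sub (vgrad (ofTest (φ k))) (vgrad v), grad_ofTest (compTest Φ hΦ h0 (φ k)),
        fn_ofTest (φ k), grad_ofTest (φ k), (hmg (vfn (ofTest (φ k)))).coeFn_toLp]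
        with x h1 h2 h3 h4 h5 h6
      rw [h1, h2, Pi.sub_apply, Pi.sub_apply, h6, hw, h3, h4, h5, gradient_compTest, ← smul_sub,
        norm_smul]
      gcongr
      exact hL _
    have hB : Tendsto (fun k => (hmg (vfn (ofTest (φ k)))).toLp - (hmg (vfn v)).toLp) atTop
        (𝓝 0) := by
      refine L2_tendsto_zero_of_dominated (g := fun x => 2 * L * ‖vgrad v x‖) ?_ (fun k => ?_) ?_
      · have := (Lp.memLp (vgrad v)).norm.integrable_sq.const_mul ((2 * L) ^ 2)
        simpa [mul_pow] using this
      · filter_upwards [Lp.coeFn_sub (hmg (vfn (ofTest (φ k)))).toLp (hmg (vfn v)).toLp,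
          (hmg (vfn (ofTest (φ k)))).coeFn_toLp, (hmg (vfn v)).coeFn_toLp] with x h1 h2 h3
        rw [h1, Pi.sub_apply, h2, h3, ← sub_smul, norm_smul]
        gcongr
        rw [Real.norm_eq_abs]
        have := abs_sub (deriv Φ (vfn (ofTest (φ k)) x)) (deriv Φ (vfn v x))
        linarith [hL (vfn (ofTest (φ k)) x), hL (vfn v x)]
      · filter_upwards [ae_all_iff.2 fun k => Lp.coeFn_sub (hmg (vfn (ofTest (φ k)))).toLp
          (hmg (vfn v)).toLp, ae_all_iff.2 fun k => (hmg (vfn (ofTest (φ k)))).coeFn_toLp,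
          (hmg (vfn v)).coeFn_toLp, hae] with x h1 h2 h3 h4
        simp only [h1, Pi.sub_apply, h2, h3]
        have h5 : Tendsto (fun k => deriv Φ (vfn (ofTest (φ k)) x)) atTop
          (𝓝 (deriv Φ (vfn v x))) := (hdc.tendsto _).comp h4
        have h6 := (h5.smul_const (vgrad v x)).sub_const (deriv Φ (vfn v x) • vgrad v x)
        simpa using h6
    have := (hA.add hB).add_const (hmg (vfn v)).toLp
    simpa using this
  have hmem : WithLp.toLp 2 (hmf.toLp, (hmg (vfn v)).toLp) ∈ H01 Ω := by
    refine (testPairs Ω).isClosed_topologicalClosure.mem_of_tendsto (b := atTop)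
      (f := fun k => toPair (w k)) ?_ (Eventually.of_forall fun k => (show H01 Ω from w k).2)
    have := (WithLp.prod_continuous_toLp 2 (L2 Ω) (Lp (Eucl n) 2 (vol Ω))).tendsto
      (hmf.toLp, (hmg (vfn v)).toLp)
    exact this.comp (hwf.prodMk_nhds hwg)
  exact ⟨show H01 Ω from ⟨_, hmem⟩, hmf.coeFn_toLp, (hmg (vfn v)).coeFn_toLp⟩

end ChainRule

/-! ### Truncation functions of logarithmic growth for the maximum principle. -/

section Primitive

/-- The primitive of `g` vanishing at `0`. -/
def prim (g : ℝ → ℝ) (t : ℝ) : ℝ := ∫ s in (0 : ℝ)..t, g s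

theorem prim_zero (g : ℝ → ℝ) : prim g 0 = 0 := by simp [prim]

theorem hasDerivAt_prim {g : ℝ → ℝ} (hg : Continuous g) (t : ℝ) : HasDerivAt (prim g) (g t) t :=
  intervalIntegral.integral_hasDerivAt_right (hg.intervalIntegrable _ _)
    (hg.stronglyMeasurableAtFilter _ _) hg.continuousAt

theorem deriv_prim {g : ℝ → ℝ} (hg : Continuous g) : deriv (prim g) = g :=
  funext fun t => (hasDerivAt_prim hg t).deriv

theorem contDiff_prim {g : ℝ → ℝ} (hg : ContDiff ℝ (⊤ : ℕ∞) g) : ContDiff ℝ (⊤ : ℕ∞) (prim g) := by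
  rw [contDiff_infty_iff_deriv, deriv_prim hg.continuous]
  exact ⟨fun t => (hasDerivAt_prim hg.continuous t).differentiableAt, hg⟩

/-- A smooth nonnegative function that vanishes on the negative half-line and decays like `1/t`. -/
def cutoff (t : ℝ) : ℝ := Real.smoothTransition t / √(1 + t ^ 2)

theorem contDiff_cutoff : ContDiff ℝ (⊤ : ℕ∞) cutoff := by
  refine Real.smoothTransition.contDiff.div ?_ fun t => (Real.sqrt_pos.2 (by positivity)).ne'
  exact ContDiff.sqrt (by fun_prop) fun t => by positivity

theorem cutoff_nonneg (t : ℝ) : 0 ≤ cutoff t :=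
  div_nonneg (Real.smoothTransition.nonneg t) (Real.sqrt_nonneg _)

/-- The decay that lets the drift term `t (cutoff t)² β · ∇v` be absorbed into the diffusion with an
error independent of `t`. -/
theorem cutoff_sq_mul_le (t : ℝ) : cutoff t ^ 2 * (1 + t ^ 2) ≤ 1 := by
  rw [cutoff, div_pow, Real.sq_sqrt (by positivity), div_mul_cancel₀ _ (by positivity)]
  exact pow_le_one₀ (Real.smoothTransition.nonneg t) (Real.smoothTransition.le_one t)

theorem cutoff_sq_le_one (t : ℝ) : cutoff t ^ 2 ≤ 1 := by
  nlinarith [cutoff_sq_mul_le t, sq_nonneg t, sq_nonneg (cutoff t), mul_nonneg (sq_nonneg (cutoff t)) (sq_nonneg t)]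

theorem cutoff_le_one (t : ℝ) : cutoff t ≤ 1 := by
  nlinarith [cutoff_sq_le_one t, cutoff_nonneg t]

theorem cutoff_of_nonpos {t : ℝ} (ht : t ≤ 0) : cutoff t = 0 := by
  simp [cutoff, Real.smoothTransition.zero_of_nonpos ht]

theorem prim_nonneg {g : ℝ → ℝ} (hg : ∀ t, 0 ≤ g t) {t : ℝ} (ht : 0 ≤ t) : 0 ≤ prim g t :=
  intervalIntegral.integral_nonneg ht fun s _ => hg s

theorem prim_of_nonpos {g : ℝ → ℝ} (hg : ∀ t ≤ 0, g t = 0) {t : ℝ} (ht : t ≤ 0) :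
    prim g t = 0 := by
  rw [prim, intervalIntegral.integral_symm, intervalIntegral.integral_zero_ae, neg_zero]
  refine Eventually.of_forall fun s hs => hg s ?_
  rw [uIoc_of_le ht] at hs
  exact hs.2

theorem prim_cutoff_mono : Monotone (prim cutoff) :=
  monotone_of_deriv_nonneg
    (fun t => (hasDerivAt_prim contDiff_cutoff.continuous t).differentiableAt) fun t => by
      rw [deriv_prim contDiff_cutoff.continuous]; exact cutoff_nonneg t

/-- For `s ≥ 1` one has `√(1 + s²) ≤ 2 s`, so the integrand is at least `1 / (2 s)`. What matters
later is that the primitive is unbounded. -/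
theorem log_le_prim_cutoff {t : ℝ} (ht : 1 ≤ t) : Real.log t / 2 ≤ prim cutoff t := by
  have h1 : prim cutoff t = prim cutoff 1 + ∫ s in (1 : ℝ)..t, cutoff s :=
    (intervalIntegral.integral_add_adjacent_intervals
      (contDiff_cutoff.continuous.intervalIntegrable _ _)
      (contDiff_cutoff.continuous.intervalIntegrable _ _)).symm
  have h2 : ∫ s in (1 : ℝ)..t, s⁻¹ * (1 / 2) ≤ ∫ s in (1 : ℝ)..t, cutoff s := by
    refine intervalIntegral.integral_mono_on ht ?_
      (contDiff_cutoff.continuous.intervalIntegrable _ _) fun s hs => ?_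
    · refine ContinuousOn.intervalIntegrable ?_
      rw [uIcc_of_le ht]
      refine (ContinuousOn.inv₀ continuousOn_id fun s hs => ?_).mul continuousOn_const
      exact (lt_of_lt_of_le one_pos hs.1).ne'
    · have hs1 : 1 ≤ s := hs.1
      rw [cutoff, Real.smoothTransition.one_of_one_le hs1, ← one_div, one_div_mul_one_div]
      refine one_div_le_one_div_of_le (Real.sqrt_pos.2 (by positivity)) ?_
      rw [Real.sqrt_le_left (by positivity)]
      nlinarith
  rw [intervalIntegral.integral_mul_const, integral_inv_of_pos one_pos (by linarith), div_one] at h2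
  have h3 := prim_nonneg cutoff_nonneg (zero_le_one (α := ℝ))
  linarith

end Primitive

/-! ### The Fokker–Planck operator and its weak maximum principle. -/

section Operators

variable {n : ℕ} {Ω : TopologicalSpace.Opens (Eucl n)}

theorem ae_norm_le_norm (β : Lp (Eucl n) ∞ (vol Ω)) : ∀ᵐ x ∂(vol Ω), ‖β x‖ ≤ ‖β‖ := by
  have h := ae_le_eLpNormEssSup (f := β) (μ := vol Ω)
  filter_upwards [h] with x hx
  rw [← eLpNorm_exponent_top] at hx
  have h2 := ENNReal.toReal_mono (Lp.memLp β).2.ne hx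
  rwa [toReal_enorm, ← Lp.norm_def] at h2

/-- Pointwise inner product with a bounded vector field. -/
def drift (β : Lp (Eucl n) ∞ (vol Ω)) : Lp (Eucl n) 2 (vol Ω) →L[ℝ] L2 Ω :=
  (innerSL ℝ : Eucl n →L[ℝ] Eucl n →L[ℝ] ℝ).holderL (vol Ω) ∞ 2 2 β

theorem coeFn_drift (β : Lp (Eucl n) ∞ (vol Ω)) (g : Lp (Eucl n) 2 (vol Ω)) :
    drift β g =ᵐ[vol Ω] fun x => ⟪β x, g x⟫ :=
  (innerSL ℝ : Eucl n →L[ℝ] Eucl n →L[ℝ] ℝ).coeFn_holder β g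

theorem norm_drift_le (β : Lp (Eucl n) ∞ (vol Ω)) (g : Lp (Eucl n) 2 (vol Ω)) :
    ‖drift β g‖ ≤ ‖β‖ * ‖g‖ := by
  refine Lp.norm_le_mul_norm_of_ae_le_mul ?_
  filter_upwards [coeFn_drift β g, ae_norm_le_norm β] with x h1 h2
  rw [h1]
  exact (norm_inner_le_norm _ _).trans (by gcongr)

theorem drift_smul (s : ℝ) (β : Lp (Eucl n) ∞ (vol Ω)) (g : Lp (Eucl n) 2 (vol Ω)) :
    drift (s • β) g = s • drift β g := by
  simp [drift]

open ContinuousLinearMap in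
/-- The operator `-ν Δ + κ` on `H¹₀(Ω)`, through the Riesz isomorphism. -/
def diffusion (ν κ : ℝ) : V Ω →L[ℝ] V Ω :=
  ν • (adjoint gradL ∘L gradL) + κ • (adjoint fnL ∘L fnL)

theorem inner_diffusion (ν κ : ℝ) (u φ : V Ω) :
    ⟪diffusion ν κ u, φ⟫ = ν * ⟪vgrad u, vgrad φ⟫ + κ * ⟪vfn u, vfn φ⟫ := by
  simp [diffusion, inner_add_left, real_inner_smul_left, ContinuousLinearMap.adjoint_inner_left]

open ContinuousLinearMap in
/-- The operator `w ↦ β · ∇w`. -/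
def transport (β : Lp (Eucl n) ∞ (vol Ω)) : V Ω →L[ℝ] V Ω :=
  adjoint fnL ∘L drift β ∘L gradL

theorem inner_transport (β : Lp (Eucl n) ∞ (vol Ω)) (u φ : V Ω) :
    ⟪transport β u, φ⟫ = ⟪drift β (vgrad u), vfn φ⟫ := by
  simp [transport, ContinuousLinearMap.adjoint_inner_left]

/-- The Fokker–Planck operator `m ↦ -ν Δm - div (m β) + κ m`. -/
def fokkerPlanck (ν κ : ℝ) (β : Lp (Eucl n) ∞ (vol Ω)) : V Ω →L[ℝ] V Ω :=
  diffusion ν κ + ContinuousLinearMap.adjoint (transport β)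

theorem inner_fokkerPlanck (ν κ : ℝ) (β : Lp (Eucl n) ∞ (vol Ω)) (m φ : V Ω) :
    ⟪fokkerPlanck ν κ β m, φ⟫
      = ν * ⟪vgrad m, vgrad φ⟫ + κ * ⟪vfn m, vfn φ⟫ + ⟪vfn m, drift β (vgrad φ)⟫ := by
  rw [fokkerPlanck, add_apply, inner_add_left, inner_diffusion,
    ContinuousLinearMap.adjoint_inner_left, real_inner_comm _ m, inner_transport,
    real_inner_comm (vfn m)]

/-- Duality between the Fokker–Planck operator and its adjoint. -/
theorem inner_fokkerPlanck_eq (ν κ : ℝ) (β : Lp (Eucl n) ∞ (vol Ω)) (m w : V Ω) :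
    ⟪fokkerPlanck ν κ β m, w⟫ = ⟪diffusion ν κ w, m⟫ + ⟪drift β (vgrad w), vfn m⟫ := by
  rw [inner_fokkerPlanck, inner_diffusion, real_inner_comm (vgrad m), real_inner_comm (vfn m),
    real_inner_comm (vfn m) (drift β (vgrad w))]

theorem integrable_fokkerPlanck (ν κ : ℝ) (β : Lp (Eucl n) ∞ (vol Ω)) (m φ : V Ω) :
    Integrable (fun x => ν * inner ℝ (vgrad m x) (vgrad φ x) + vfn m x * inner ℝ (β x) (vgrad φ x)
        + κ * vfn m x * vfn φ x) (vol Ω) := by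
  have h1 := (L2.integrable_inner (𝕜 := ℝ) (vgrad m) (vgrad φ)).const_mul ν
  have h2 := L2.integrable_inner (𝕜 := ℝ) (vfn m) (drift β (vgrad φ))
  have h3 := (L2.integrable_inner (𝕜 := ℝ) (vfn m) (vfn φ)).const_mul κ
  refine ((h1.add h2).add h3).congr ?_
  filter_upwards [coeFn_drift β (vgrad φ)] with x hx
  simp only [Pi.add_apply, hx]
  simp
  ring

theorem inner_fokkerPlanck_eq_integral (ν κ : ℝ) (β : Lp (Eucl n) ∞ (vol Ω)) (m φ : V Ω) :
    ⟪fokkerPlanck ν κ β m, φ⟫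
      = ∫ x, (ν * inner ℝ (vgrad m x) (vgrad φ x) + vfn m x * inner ℝ (β x) (vgrad φ x)
        + κ * vfn m x * vfn φ x) ∂(vol Ω) := by
  have h1 := (L2.integrable_inner (𝕜 := ℝ) (vgrad m) (vgrad φ)).const_mul ν
  have h2 := L2.integrable_inner (𝕜 := ℝ) (vfn m) (drift β (vgrad φ))
  have h3 := (L2.integrable_inner (𝕜 := ℝ) (vfn m) (vfn φ)).const_mul κ
  rw [inner_fokkerPlanck, L2.inner_def, L2.inner_def, L2.inner_def, ← integral_const_mul,
    ← integral_const_mul, ← integral_add h1 h3]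
  refine (integral_add (h1.add h3) h2).symm.trans ?_
  refine integral_congr_ae ?_
  filter_upwards [coeFn_drift β (vgrad φ)] with x hx
  simp only [Pi.add_apply, hx]
  simp
  ring

/-- An a priori bound for subsolutions of the Fokker–Planck equation. -/
theorem norm_prim_cutoff_le (hΩ : Bornology.IsBounded (Ω : Set (Eucl n))) {ν κ : ℝ} (hν : 0 < ν)
    (hκ : 0 ≤ κ) {β : Lp (Eucl n) ∞ (vol Ω)} {C : ℝ} (hC0 : 0 < C)
    (hC : ∀ v : V Ω, ‖vfn v‖ ≤ C * ‖vgrad v‖)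
    {v : V Ω} (hv : ∀ φ : V Ω, (∀ᵐ x ∂(vol Ω), 0 ≤ vfn φ x) → ⟪fokkerPlanck ν κ β v, φ⟫ ≤ 0) :
    ∃ w : V Ω, (vfn w =ᵐ[vol Ω] fun x => prim cutoff (vfn v x)) ∧
      ‖vfn w‖ ^ 2 ≤ C ^ 2 * (‖β‖ ^ 2 / ν ^ 2 * (vol Ω).real univ) := by
  have := isFiniteMeasure_vol hΩ
  set M := ‖β‖ with hM
  have hg := contDiff_cutoff
  have hg2 : ContDiff ℝ (⊤ : ℕ∞) fun t => cutoff t ^ 2 := hg.pow 2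
  -- The test function is `p`, with `∇p = cutoff(v)² ∇v`, while `∇w = cutoff(v) ∇v`; thus `∇v · ∇p =
  -- |∇w|²`.
  obtain ⟨w, hwf, hwg⟩ := exists_comp (contDiff_prim hg) (prim_zero _) (L := 1) (fun t => by
    rw [deriv_prim hg.continuous, abs_of_nonneg (cutoff_nonneg t)]; exact cutoff_le_one t) v
  obtain ⟨p, hpf, hpg⟩ := exists_comp (contDiff_prim hg2) (prim_zero _) (L := 1) (fun t => by
    rw [deriv_prim hg2.continuous, abs_of_nonneg (sq_nonneg _)]; exact cutoff_sq_le_one t) v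
  rw [deriv_prim hg.continuous] at hwg
  rw [deriv_prim hg2.continuous] at hpg
  refine ⟨w, hwf, ?_⟩
  have hpn : ∀ t, 0 ≤ prim (fun t => cutoff t ^ 2) t ∧ 0 ≤ t * prim (fun t => cutoff t ^ 2) t := by
    intro t
    rcases le_total 0 t with ht | ht
    · have := prim_nonneg (g := fun t => cutoff t ^ 2) (fun _ => sq_nonneg _) ht
      exact ⟨this, mul_nonneg ht this⟩
    · have := prim_of_nonpos (g := fun t => cutoff t ^ 2)
        (fun s hs => by simp [cutoff_of_nonpos hs]) ht
      simp [this]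
  have h1 := hv p (by filter_upwards [hpf] with x hx; rw [hx]; exact (hpn _).1)
  rw [inner_fokkerPlanck_eq_integral] at h1
  have hwi : Integrable (fun x => ‖vgrad w x‖ ^ 2) (vol Ω) := (Lp.memLp (vgrad w)).norm.integrable_sq
  have h2 : ∫ x, (ν / 2 * ‖vgrad w x‖ ^ 2 - M ^ 2 / (2 * ν)) ∂(vol Ω)
      ≤ ∫ x, (ν * inner ℝ (vgrad v x) (vgrad p x) + vfn v x * inner ℝ (β x) (vgrad p x)
        + κ * vfn v x * vfn p x) ∂(vol Ω) := by
    refine integral_mono_ae ((hwi.const_mul _).sub (integrable_const _))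
      (integrable_fokkerPlanck ν κ β v p) ?_
    filter_upwards [hwg, hpf, hpg, ae_norm_le_norm β] with x hx1 hx2 hx3 hx4
    rw [hx1, hx2, hx3, norm_smul, real_inner_smul_right, real_inner_smul_right,
      real_inner_self_eq_norm_sq, Real.norm_eq_abs, abs_of_nonneg (cutoff_nonneg _)]
    set t := vfn v x
    set c := cutoff t
    have hκt : 0 ≤ κ * t * prim (fun t => cutoff t ^ 2) t := by
      rw [mul_assoc]; exact mul_nonneg hκ (hpn t).2
    have hin : -(M * ‖vgrad v x‖) ≤ inner ℝ (β x) (vgrad v x) ∧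
        inner ℝ (β x) (vgrad v x) ≤ M * ‖vgrad v x‖ := by
      rw [← abs_le]
      exact (abs_real_inner_le_norm _ _).trans (by gcongr)
    have hc2 : c ^ 2 * t ^ 2 ≤ 1 := by nlinarith [cutoff_sq_mul_le t, sq_nonneg c]
    have hb : -(|t| * (c ^ 2 * (M * ‖vgrad v x‖))) ≤ t * (c ^ 2 * inner ℝ (β x) (vgrad v x)) := by
      refine neg_le_of_abs_le ?_
      rw [abs_mul, abs_mul, abs_of_nonneg (sq_nonneg c)]
      gcongr
      exact abs_le.2 hin
    -- Young's inequality gives half of the diffusion; the remainder is bounded by `M² / (2 ν)`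
    -- since `c² t² ≤ 1`. The final bound therefore does not involve `v`.
    have hy : |t| * (c ^ 2 * (M * ‖vgrad v x‖))
        ≤ ν / 2 * (c * ‖vgrad v x‖) ^ 2 + M ^ 2 / (2 * ν) * (c ^ 2 * t ^ 2) := by
      have hsq : 0 ≤ (ν * (c * ‖vgrad v x‖) - M * (c * |t|)) ^ 2 / (2 * ν) := by positivity
      have : (ν * (c * ‖vgrad v x‖) - M * (c * |t|)) ^ 2 / (2 * ν)
          = ν / 2 * (c * ‖vgrad v x‖) ^ 2 + M ^ 2 / (2 * ν) * (c ^ 2 * t ^ 2)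
            - |t| * (c ^ 2 * (M * ‖vgrad v x‖)) := by
        rw [← sq_abs t]; field_simp; ring
      linarith
    have hM2 : M ^ 2 / (2 * ν) * (c ^ 2 * t ^ 2) ≤ M ^ 2 / (2 * ν) := by
      have : 0 ≤ M ^ 2 / (2 * ν) := by positivity
      nlinarith
    have e : ν * (c ^ 2 * ‖vgrad v x‖ ^ 2) = ν * (c * ‖vgrad v x‖) ^ 2 := by ring
    linarith
  rw [integral_sub (hwi.const_mul _) (integrable_const _), integral_const_mul, ← L2_norm_sq,
    integral_const, smul_eq_mul] at h2
  have h3 : ν / 2 * ‖vgrad w‖ ^ 2 ≤ (vol Ω).real univ * (M ^ 2 / (2 * ν)) := by linarith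
  have h4 : ‖vgrad w‖ ^ 2 ≤ M ^ 2 / ν ^ 2 * (vol Ω).real univ := by
    have := mul_le_mul_of_nonneg_left h3 (show 0 ≤ 2 / ν by positivity)
    have e1 : 2 / ν * (ν / 2 * ‖vgrad w‖ ^ 2) = ‖vgrad w‖ ^ 2 := by field_simp
    have e2 : 2 / ν * ((vol Ω).real univ * (M ^ 2 / (2 * ν)))
      = M ^ 2 / ν ^ 2 * (vol Ω).real univ := by field_simp
    linarith
  calc ‖vfn w‖ ^ 2 ≤ (C * ‖vgrad w‖) ^ 2 := by gcongr; exact hC w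
    _ = C ^ 2 * ‖vgrad w‖ ^ 2 := by ring
    _ ≤ _ := by gcongr

/-- The weak maximum principle for the Fokker–Planck operator. -/
theorem fn_nonpos_of_fokkerPlanck (hn : 0 < n) (hΩ : Bornology.IsBounded (Ω : Set (Eucl n)))
    {ν κ : ℝ} (hν : 0 < ν) (hκ : 0 ≤ κ) {β : Lp (Eucl n) ∞ (vol Ω)} {v : V Ω}
    (hv : ∀ φ : V Ω, (∀ᵐ x ∂(vol Ω), 0 ≤ vfn φ x) → ⟪fokkerPlanck ν κ β v, φ⟫ ≤ 0) :
    ∀ᵐ x ∂(vol Ω), vfn v x ≤ 0 := by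
  have := isFiniteMeasure_vol hΩ
  obtain ⟨C, hC0, hC⟩ := exists_poincare hn hΩ
  set K := C ^ 2 * (‖β‖ ^ 2 / ν ^ 2 * (vol Ω).real univ) with hK
  have hpos : ∀ η : ℝ, 0 < η → ∀ᵐ x ∂(vol Ω), ¬ η ≤ vfn v x := by
    intro η hη
    rw [ae_iff]
    simp only [not_not]
    by_contra hne
    have hE : 0 < (vol Ω).real {x | η ≤ vfn v x} := ENNReal.toReal_pos hne (measure_ne_top _ _)
    set e := (vol Ω).real {x | η ≤ vfn v x} with he
    -- Positive multiples `k v` are subsolutions too and obey the same bound `K`. On `{v ≥ η}` their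
    -- truncations are at least `log (k η) / 2`, so a set of positive measure contradicts the bound
    -- for large `k`.
    have hlim : Tendsto (fun k : ℝ => Real.log (k * η) / 2) atTop atTop :=
      (Real.tendsto_log_atTop.comp (tendsto_id.atTop_mul_const hη)).atTop_div_const (by norm_num)
    obtain ⟨k, hk1, hk2, hk3⟩ := ((hlim.eventually_gt_atTop (√(K / e))).and
      ((eventually_ge_atTop (1 / η)).and (eventually_gt_atTop 0))).exists
    obtain ⟨w, hwf, hwn⟩ := norm_prim_cutoff_le hΩ hν hκ hC0 hC (v := k • v) (β := β) (by
      intro φ hφ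
      rw [(fokkerPlanck ν κ β).map_smul, real_inner_smul_left]
      exact mul_nonpos_of_nonneg_of_nonpos hk3.le (hv φ hφ))
    have hkη : 1 ≤ k * η := by rwa [div_le_iff₀ hη] at hk2
    set P := prim cutoff (k * η) with hP
    have hPK : √(K / e) < P := hk1.trans_le (log_le_prim_cutoff hkη)
    have hP0 : 0 < P := (Real.sqrt_nonneg _).trans_lt hPK
    have hPK2 : K < P ^ 2 * e := by
      rw [Real.sqrt_lt' hP0, div_lt_iff₀ hE] at hPK
      exact hPK
    have hcheb := mul_meas_ge_le_integral_of_nonneg (μ := vol Ω) (f := fun x => ‖vfn w x‖ ^ 2)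
      (Eventually.of_forall fun x => by positivity) (Lp.memLp (vfn w)).norm.integrable_sq (P ^ 2)
    rw [← L2_norm_sq] at hcheb
    have hsub : e ≤ (vol Ω).real {x | P ^ 2 ≤ ‖vfn w x‖ ^ 2} := by
      refine ENNReal.toReal_mono (measure_ne_top _ _) (measure_mono_ae ?_)
      filter_upwards [hwf, Lp.coeFn_smul k (vfn v)] with x hx1 hx2 hx3
      show P ^ 2 ≤ ‖vfn w x‖ ^ 2
      have hx3' : η ≤ vfn v x := hx3
      have e1 : vfn (k • v) x = k * vfn v x := by
        have : vfn (k • v) = k • vfn v := (fnL (Ω := Ω)).map_smul k v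
        rw [this, hx2]; simp
      rw [hx1, e1, Real.norm_eq_abs, sq_abs]
      have := prim_cutoff_mono (mul_le_mul_of_nonneg_left hx3' hk3.le)
      gcongr
    have : P ^ 2 * e ≤ P ^ 2 * (vol Ω).real {x | P ^ 2 ≤ ‖vfn w x‖ ^ 2} := by gcongr
    linarith
  filter_upwards [ae_all_iff.2 fun j : ℕ => hpos (1 / ((j : ℝ) + 1)) (by positivity)] with x hx
  by_contra hxp
  obtain ⟨j, hj⟩ := exists_nat_one_div_lt (not_le.1 hxp)
  exact hx j hj.le

theorem fn_nonneg_of_fokkerPlanck (hn : 0 < n) (hΩ : Bornology.IsBounded (Ω : Set (Eucl n)))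
    {ν κ : ℝ} (hν : 0 < ν) (hκ : 0 ≤ κ) {β : Lp (Eucl n) ∞ (vol Ω)} {v : V Ω}
    (hv : ∀ φ : V Ω, (∀ᵐ x ∂(vol Ω), 0 ≤ vfn φ x) → 0 ≤ ⟪fokkerPlanck ν κ β v, φ⟫) :
    ∀ᵐ x ∂(vol Ω), 0 ≤ vfn v x := by
  have h := fn_nonpos_of_fokkerPlanck hn hΩ hν hκ (β := β) (v := -v) (fun φ hφ => by
    rw [map_neg, inner_neg_left]
    linarith [hv φ hφ])
  have e : vfn (-v) = -vfn v := (fnL (Ω := Ω)).map_neg v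
  rw [e] at h
  filter_upwards [h, Lp.coeFn_neg (vfn v)] with x hx1 hx2
  rw [hx2, Pi.neg_apply] at hx1
  linarith

theorem eq_zero_of_fokkerPlanck_eq_zero (hn : 0 < n)
    (hΩ : Bornology.IsBounded (Ω : Set (Eucl n)))
    {ν κ : ℝ} (hν : 0 < ν) (hκ : 0 ≤ κ) {β : Lp (Eucl n) ∞ (vol Ω)} {v : V Ω}
    (hv : fokkerPlanck ν κ β v = 0) : v = 0 := by
  have h1 := fn_nonneg_of_fokkerPlanck hn hΩ hν hκ (β := β) (v := v) (fun φ _ => by simp [hv])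
  have h2 := fn_nonpos_of_fokkerPlanck hn hΩ hν hκ (β := β) (v := v) (fun φ _ => by simp [hv])
  refine vfn_injective (Lp.ext ?_)
  have e : vfn (0 : V Ω) = 0 := (fnL (Ω := Ω)).map_zero
  rw [e]
  filter_upwards [h1, h2, Lp.coeFn_zero ℝ 2 (vol Ω)] with x hx1 hx2 hx3
  rw [hx3]
  exact le_antisymm hx2 hx1

end Operators

/-! ### Pointwise inequalities under weak convergence. -/

section WeakFields

variable {α E : Type*} [MeasurableSpace α] {μ : Measure α} [IsFiniteMeasure μ]
  [NormedAddCommGroup E]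

/-- A bounded field as a square integrable field. -/
def toL2 (β : Lp E ∞ μ) : Lp E 2 μ := ((Lp.memLp β).mono_exponent le_top).toLp

theorem coeFn_toL2 (β : Lp E ∞ μ) : toL2 β =ᵐ[μ] β := MemLp.coeFn_toLp _

variable [InnerProductSpace ℝ E]

theorem setIntegral_inner_eq (b w : Lp E 2 μ) {s : Set α} (hs : MeasurableSet s) :
    ∫ x in s, ⟪b x, w x⟫ ∂μ
      = ⟪b, (indicatorConstLp ∞ hs (measure_ne_top μ s) (1 : ℝ)) • w⟫ := by
  rw [L2.inner_def, ← integral_indicator hs]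
  refine integral_congr_ae ?_
  filter_upwards [Lp.coeFn_lpSMul (r := 2)
    (indicatorConstLp ∞ hs (measure_ne_top μ s) (1 : ℝ)) w,
    indicatorConstLp_coeFn (p := ∞) (hs := hs) (hμs := measure_ne_top μ s) (c := (1 : ℝ))]
    with x h1 h2
  rw [h1, Pi.smul_apply', h2]
  by_cases hx : x ∈ s <;> simp [hx]

/-- Pointwise affine inequalities pass to limits along weakly convergent sequences. -/
theorem ae_nonneg_of_weakTendsto {b : ℕ → Lp E 2 μ} {b₀ : Lp E 2 μ} (hb : WeakTendsto b b₀)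
    {C : ℝ} (hC : ∀ k, ‖b k‖ ≤ C) {w : ℕ → Lp E 2 μ} {w₀ : Lp E 2 μ}
    (hw : Tendsto w atTop (𝓝 w₀)) {z : ℕ → Lp ℝ 2 μ} {z₀ : Lp ℝ 2 μ}
    (hz : Tendsto z atTop (𝓝 z₀)) (h : ∀ k, ∀ᵐ x ∂μ, 0 ≤ ⟪b k x, w k x⟫ + z k x) :
    ∀ᵐ x ∂μ, 0 ≤ ⟪b₀ x, w₀ x⟫ + z₀ x := by
  have hint : ∀ (b w : Lp E 2 μ) (z : Lp ℝ 2 μ), Integrable (fun x => ⟪b x, w x⟫ + z x) μ :=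
    fun b w z => (L2.integrable_inner b w).add ((Lp.memLp z).integrable (by norm_num))
  refine ae_nonneg_of_forall_setIntegral_nonneg (hint b₀ w₀ z₀) fun s hs _ => ?_
  -- The indicator of `s` is moved onto the strongly convergent factor, so the weak–strong pairing
  -- applies on each measurable set.
  set χ := indicatorConstLp ∞ hs (measure_ne_top μ s) (1 : ℝ) with hχ
  set χ' := indicatorConstLp 2 hs (measure_ne_top μ s) (1 : ℝ) with hχ'
  have hform : ∀ (b w : Lp E 2 μ) (z : Lp ℝ 2 μ), ∫ x in s, (⟪b x, w x⟫ + z x) ∂μ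
      = ⟪b, (χ • w : Lp E 2 μ)⟫ + ⟪χ', z⟫ := by
    intro b w z
    have i1 : Integrable (fun x => ⟪b x, w x⟫) (μ.restrict s) :=
      (L2.integrable_inner (𝕜 := ℝ) b w).integrableOn
    have i2 : Integrable (fun x => z x) (μ.restrict s) :=
      ((Lp.memLp z).integrable (by norm_num)).integrableOn
    rw [integral_add i1 i2, setIntegral_inner_eq b w hs,
      L2.inner_indicatorConstLp_one]
  have hw' : Tendsto (fun k => (χ • w k : Lp E 2 μ)) atTop (𝓝 (χ • w₀ : Lp E 2 μ)) := by
    rw [tendsto_iff_norm_sub_tendsto_zero] at hw ⊢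
    have hz : Tendsto (fun k => ‖χ‖ * ‖w k - w₀‖) atTop (𝓝 0) := by simpa using hw.const_mul ‖χ‖
    refine squeeze_zero (fun _ => norm_nonneg _) (fun k => ?_) hz
    have e : (χ • w k : Lp E 2 μ) - (χ • w₀ : Lp E 2 μ) = (χ • (w k - w₀) : Lp E 2 μ) := by
      rw [sub_eq_add_neg, sub_eq_add_neg, Lp.add_smul, Lp.smul_neg]
    rw [e]
    exact Lp.norm_smul_le χ (w k - w₀)
  rw [hform]
  have hlim : Tendsto (fun k => ⟪b k, (χ • w k : Lp E 2 μ)⟫ + ⟪χ', z k⟫) atTop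
      (𝓝 (⟪b₀, (χ • w₀ : Lp E 2 μ)⟫ + ⟪χ', z₀⟫)) :=
    (hb.inner_tendsto hC hw').add (tendsto_const_nhds.inner hz)
  refine ge_of_tendsto' hlim fun k => ?_
  rw [← hform]
  exact setIntegral_nonneg_of_ae_restrict (ae_restrict_of_ae (h k))

end WeakFields

/-! ### Weak limits of drifts in the Fokker–Planck equation. -/

section Fields

variable {n : ℕ} {Ω : TopologicalSpace.Opens (Eucl n)}

theorem norm_toL2_le [IsFiniteMeasure (vol Ω)] (β : Lp (Eucl n) ∞ (vol Ω)) :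
    ‖toL2 β‖ ≤ ((vol Ω).real univ) ^ (1 / 2 : ℝ) * ‖β‖ := by
  have h := Lp.norm_le_of_ae_bound (f := toL2 β) (C := ‖β‖) (norm_nonneg _) (by
    filter_upwards [coeFn_toL2 β, ae_norm_le_norm β] with x h1 h2
    rw [h1]; exact h2)
  refine h.trans (le_of_eq ?_)
  simp [measureUnivNNReal, measureReal_def]
  exact Or.inl rfl

/-- Bounded sequences of fields have weak limits that obey the same bound. -/
theorem exists_weak_limit_field [IsFiniteMeasure (vol Ω)] {M : ℝ}
    {β : ℕ → Lp (Eucl n) ∞ (vol Ω)} (hβ : ∀ k, ‖β k‖ ≤ M) :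
    ∃ β₀ : Lp (Eucl n) ∞ (vol Ω), ‖β₀‖ ≤ M ∧ ∃ σ : ℕ → ℕ, StrictMono σ ∧
      WeakTendsto (fun k => toL2 (β (σ k))) (toL2 β₀) := by
  have hM : 0 ≤ M := (norm_nonneg _).trans (hβ 0)
  have hfact : Fact ((2 : ℝ≥0∞) ≠ ∞) := ⟨by norm_num⟩
  have hsc : SecondCountableTopology (Lp (Eucl n) 2 (vol Ω)) := inferInstance
  have hbd : ∀ k, ‖toL2 (β k)‖ ≤ ((vol Ω).real univ) ^ (1 / 2 : ℝ) * M := fun k =>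
    (norm_toL2_le _).trans (by gcongr; exact hβ k)
  obtain ⟨b, σ, hσ, hb⟩ := exists_subseq_weakTendsto _ _ hbd
  -- The ball of radius `M` is the intersection of the half-spaces `⟪·, q⟫ ≤ M ‖q‖`. Each of these
  -- affine conditions survives a weak limit, and a countable dense set of `q` suffices.
  have hq : ∀ q : Eucl n, ∀ᵐ x ∂(vol Ω), ⟪b x, q⟫ ≤ M * ‖q‖ := by
    intro q
    have m1 : MemLp (fun _ : Eucl n => -q) 2 (vol Ω) := memLp_const _
    have m2 : MemLp (fun _ : Eucl n => M * ‖q‖) 2 (vol Ω) := memLp_const _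
    have := ae_nonneg_of_weakTendsto hb (fun k => hbd (σ k)) (tendsto_const_nhds (x := m1.toLp))
      (tendsto_const_nhds (x := m2.toLp)) (fun k => by
        filter_upwards [m1.coeFn_toLp, m2.coeFn_toLp, coeFn_toL2 (β (σ k)),
          ae_norm_le_norm (β (σ k))] with x h1 h2 h3 h4
        rw [h1, h2, h3, inner_neg_right]
        have h5 := real_inner_le_norm (β (σ k) x) q
        have h6 : ‖β (σ k) x‖ * ‖q‖ ≤ M * ‖q‖ := by gcongr; exact h4.trans (hβ _)
        linarith)
    filter_upwards [this, m1.coeFn_toLp, m2.coeFn_toLp] with x h0 h1 h2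
    rw [h1, h2, inner_neg_right] at h0
    linarith
  have hbM : ∀ᵐ x ∂(vol Ω), ‖b x‖ ≤ M := by
    filter_upwards [ae_all_iff.2 fun j => hq (TopologicalSpace.denseSeq (Eucl n) j)] with x hx
    have hall : ∀ q : Eucl n, ⟪b x, q⟫ ≤ M * ‖q‖ := by
      intro q
      have hcl : IsClosed {q : Eucl n | ⟪b x, q⟫ ≤ M * ‖q‖} :=
        isClosed_le (by fun_prop) (by fun_prop)
      refine hcl.closure_subset_iff.2 ?_ (TopologicalSpace.denseRange_denseSeq (Eucl n) q)
      rintro _ ⟨j, rfl⟩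
      exact hx j
    have h1 := hall (b x)
    rw [real_inner_self_eq_norm_sq] at h1
    by_contra hlt
    push Not at hlt
    nlinarith
  have hmem : MemLp b ∞ (vol Ω) := memLp_top_of_bound (Lp.aestronglyMeasurable b) M hbM
  refine ⟨hmem.toLp, ?_, σ, hσ, ?_⟩
  · rw [Lp.norm_toLp]
    refine ENNReal.toReal_le_of_le_ofReal hM ?_
    rw [eLpNorm_exponent_top]
    exact eLpNormEssSup_le_of_ae_bound hbM
  · have : toL2 hmem.toLp = b := Lp.ext ((coeFn_toL2 _).trans hmem.coeFn_toLp)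
    rw [this]
    exact hb

/-- Against a smooth test function the drift term pairs `β` with a fixed `L²` field, so weak
convergence of `β` is enough. The hypothesis `hm` holds for test functions because `∇φ` is bounded.
-/
theorem inner_drift_test [IsFiniteMeasure (vol Ω)] (β : Lp (Eucl n) ∞ (vol Ω)) (f : L2 Ω)
    (φ : 𝓓(Ω, ℝ)) (hm : MemLp (fun x => f x • ∇ (φ : Eucl n → ℝ) x) 2 (vol Ω)) :
    ⟪f, drift β (vgrad (ofTest φ))⟫ = ⟪toL2 β, hm.toLp⟫ := by
  rw [L2.inner_def, L2.inner_def]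
  refine integral_congr_ae ?_
  filter_upwards [coeFn_drift β (vgrad (ofTest φ)), grad_ofTest φ, coeFn_toL2 β, hm.coeFn_toLp]
    with x h1 h2 h3 h4
  rw [h1, h2, h3, h4, real_inner_smul_right]
  simp [mul_comm]

/-- The Fokker–Planck equation passes to weak limits of the drift. -/
theorem fokkerPlanck_limit (hΩ : Bornology.IsBounded (Ω : Set (Eucl n))) [IsFiniteMeasure (vol Ω)]
    (ν κ : ℝ) {M C : ℝ}
    {β : ℕ → Lp (Eucl n) ∞ (vol Ω)} {β₀ : Lp (Eucl n) ∞ (vol Ω)} (hβM : ∀ k, ‖β k‖ ≤ M)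
    (hβ : WeakTendsto (fun k => toL2 (β k)) (toL2 β₀)) {m : ℕ → V Ω} {m₀ : V Ω}
    (hmC : ∀ k, ‖m k‖ ≤ C) (hm : WeakTendsto m m₀) {g : V Ω}
    (hg : Tendsto (fun k => fokkerPlanck ν κ (β k) (m k)) atTop (𝓝 g)) :
    fokkerPlanck ν κ β₀ m₀ = g := by
  have hfn := tendsto_fn_of_weakTendsto hΩ hmC hm
  have hgr : WeakTendsto (fun k => vgrad (m k)) (vgrad m₀) := hm.map gradL
  refine (denseRange_ofTest (Ω := Ω)).eq_of_inner_left (𝕜 := ℝ) ?_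
  intro φ
  have h1 : Tendsto (fun k => ⟪fokkerPlanck ν κ (β k) (m k), ofTest φ⟫) atTop
    (𝓝 ⟪g, ofTest φ⟫) := hg.inner tendsto_const_nhds
  refine tendsto_nhds_unique ?_ h1
  have hmul : ∀ f : L2 Ω, MemLp (fun x => f x • ∇ (φ : Eucl n → ℝ) x) 2 (vol Ω) := by
    intro f
    have hgc := continuous_gradient (φ := (φ : Eucl n → ℝ)) (φ.contDiff.of_le (by simp))
    obtain ⟨D, hD⟩ := (hasCompactSupport_gradient φ.hasCompactSupport).exists_bound_of_continuous hgc
    refine MemLp.of_le_mul (c := D) (Lp.memLp f)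
      ((Lp.aestronglyMeasurable f).smul hgc.aestronglyMeasurable)
      (Eventually.of_forall fun x => ?_)
    rw [norm_smul, mul_comm]
    gcongr
    exact hD x
  -- The product of `m k` and `β k` passes to the limit since `m k` converges strongly in `L²` by
  -- Rellich, while `β k` converges weakly.
  have h2 : Tendsto (fun k => ⟪vfn (m k), drift (β k) (vgrad (ofTest φ))⟫) atTop
      (𝓝 ⟪vfn m₀, drift β₀ (vgrad (ofTest φ))⟫) := by
    have e1 : Tendsto (fun k => ⟪vfn (m k) - vfn m₀, drift (β k) (vgrad (ofTest φ))⟫) atTop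
        (𝓝 0) := by
      have hz : Tendsto (fun k => ‖vfn (m k) - vfn m₀‖ * (M * ‖vgrad (ofTest φ)‖)) atTop (𝓝 0) := by
        simpa using (tendsto_iff_norm_sub_tendsto_zero.1 hfn).mul_const _
      refine squeeze_zero_norm (fun k => ?_) hz
      refine (norm_inner_le_norm _ _).trans ?_
      gcongr
      exact (norm_drift_le _ _).trans (by gcongr; exact hβM k)
    have e2 : Tendsto (fun k => ⟪vfn m₀, drift (β k) (vgrad (ofTest φ))⟫) atTop
        (𝓝 ⟪vfn m₀, drift β₀ (vgrad (ofTest φ))⟫) := by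
      simp only [inner_drift_test _ _ _ (hmul (vfn m₀))]
      exact hβ _
    have := e1.add e2
    simp only [zero_add, inner_sub_left, sub_add_cancel] at this
    exact this
  simp only [inner_fokkerPlanck]
  exact (((hgr _).const_mul ν).add ((hfn.inner tendsto_const_nhds).const_mul κ)).add h2

end Fields

/-! ### Uniform bounds and solvability of the two equations. -/

section Solvability

variable {n : ℕ} {Ω : TopologicalSpace.Opens (Eucl n)}

/-- A large drift destroys coercivity, so the bound is obtained by compactness. Normalised
counterexamples and their drifts have weak limits that solve a homogeneous equation, and the maximum
principle forces the limit to be zero. Rellich then makes the `L²` norms vanish, which the energy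
identity forbids at unit norm. -/
theorem exists_fokkerPlanck_bound (hn : 0 < n) (hΩ : Bornology.IsBounded (Ω : Set (Eucl n)))
    {ν κ : ℝ} (hν : 0 < ν) (hκ : 0 ≤ κ) (M : ℝ) :
    ∃ C : ℝ, 0 < C ∧ ∀ β : Lp (Eucl n) ∞ (vol Ω), ‖β‖ ≤ M → ∀ m : V Ω,
      ‖m‖ ≤ C * ‖fokkerPlanck ν κ β m‖ := by
  have := isFiniteMeasure_vol hΩ
  by_contra hcon
  push Not at hcon
  choose β hβ m hm using fun k : ℕ => hcon ((k : ℝ) + 1) (by positivity)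
  have hM : 0 ≤ M := (norm_nonneg _).trans (hβ 0)
  have hmpos : ∀ k, 0 < ‖m k‖ := fun k => lt_of_le_of_lt (by positivity) (hm k)
  set x : ℕ → V Ω := fun k => ‖m k‖⁻¹ • m k with hx
  have hx1 : ∀ k, ‖x k‖ = 1 := by
    intro k
    rw [hx]
    beta_reduce
    rw [norm_smul, Real.norm_eq_abs, abs_of_pos (inv_pos.2 (hmpos k)), inv_mul_cancel₀ (hmpos k).ne']
  have hTx : ∀ k, ‖fokkerPlanck ν κ (β k) (x k)‖ ≤ 1 / ((k : ℝ) + 1) := by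
    intro k
    rw [hx]
    beta_reduce
    rw [(fokkerPlanck ν κ (β k)).map_smul, norm_smul, Real.norm_eq_abs, abs_of_pos (inv_pos.2 (hmpos k)),
      inv_mul_le_iff₀ (hmpos k), mul_one_div, le_div_iff₀ (by positivity), mul_comm]
    exact (hm k).le
  obtain ⟨β₀, -, σ, hσ, hw⟩ := exists_weak_limit_field hβ
  obtain ⟨x₀, τ, hτ, hxw⟩ := exists_subseq_weakTendsto (fun k => x (σ k)) 1 fun k => (hx1 _).le
  have hT0 : Tendsto (fun k => fokkerPlanck ν κ (β (σ (τ k))) (x (σ (τ k)))) atTop (𝓝 0) := by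
    have h0 : Tendsto (fun k => fokkerPlanck ν κ (β k) (x k)) atTop (𝓝 0) :=
      squeeze_zero_norm hTx tendsto_one_div_add_atTop_nhds_zero_nat
    exact h0.comp (hσ.comp hτ).tendsto_atTop
  have hx0 : fokkerPlanck ν κ β₀ x₀ = 0 :=
    fokkerPlanck_limit hΩ ν κ (fun k => hβ (σ (τ k))) (hw.subseq hτ)
      (fun k => (hx1 (σ (τ k))).le) hxw hT0
  have hx0' := eq_zero_of_fokkerPlanck_eq_zero hn hΩ hν hκ hx0
  have hfn := tendsto_fn_of_weakTendsto hΩ (fun k => (hx1 (σ (τ k))).le) hxw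
  have hfn0 : Tendsto (fun k => ‖vfn (x (σ (τ k)))‖) atTop (𝓝 0) := by
    have e : vfn x₀ = 0 := by rw [hx0']; exact (fnL (Ω := Ω)).map_zero
    rw [e] at hfn
    simpa using hfn.norm
  -- Every term on the right tends to zero along the subsequence, contradicting `0 < ν`.
  have hest : ∀ k, ν ≤ ν * ‖vfn (x k)‖ ^ 2 + ‖fokkerPlanck ν κ (β k) (x k)‖ + M * ‖vfn (x k)‖ := by
    intro k
    have h1 := inner_fokkerPlanck ν κ (β k) (x k) (x k)
    rw [real_inner_self_eq_norm_sq, real_inner_self_eq_norm_sq] at h1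
    have h2 := norm_sq_eq (x k)
    rw [hx1 k] at h2
    have h3 := real_inner_le_norm (fokkerPlanck ν κ (β k) (x k)) (x k)
    rw [hx1 k, mul_one] at h3
    have h4 : -(‖vfn (x k)‖ * ‖drift (β k) (vgrad (x k))‖) ≤ ⟪vfn (x k), drift (β k) (vgrad (x k))⟫ :=
      neg_le_of_abs_le (abs_real_inner_le_norm _ _)
    have h5 : ‖drift (β k) (vgrad (x k))‖ ≤ M := by
      refine (norm_drift_le _ _).trans ?_
      calc ‖β k‖ * ‖vgrad (x k)‖ ≤ M * 1 :=
            mul_le_mul (hβ k) ((norm_grad_le _).trans (hx1 k).le) (norm_nonneg _) hM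
        _ = M := mul_one M
    have h6 : ‖vfn (x k)‖ * ‖drift (β k) (vgrad (x k))‖ ≤ M * ‖vfn (x k)‖ := by
      rw [mul_comm]; gcongr
    have h7 : 0 ≤ κ * ‖vfn (x k)‖ ^ 2 := by positivity
    have h8 : ν * 1 ^ 2 = ν * ‖vfn (x k)‖ ^ 2 + ν * ‖vgrad (x k)‖ ^ 2 := by rw [h2]; ring
    linarith
  have hlim := (((hfn0.pow 2).const_mul ν).add hT0.norm).add (hfn0.const_mul M)
  have := ge_of_tendsto' hlim fun k => hest (σ (τ k))
  norm_num at this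
  linarith

/-- Lax–Milgram by continuation from the identity; coercivity comes from the Poincaré inequality. -/
theorem diffusion_surjective (hn : 0 < n) (hΩ : Bornology.IsBounded (Ω : Set (Eucl n)))
    {ν κ : ℝ} (hν : 0 < ν) (hκ : 0 ≤ κ) :
    Function.Surjective (diffusion ν κ : V Ω →L[ℝ] V Ω) := by
  obtain ⟨P, hP0, hP⟩ := exists_poincare hn hΩ
  set A : V Ω →L[ℝ] V Ω := diffusion ν κ with hA
  -- The minimum with `1` makes the identity `c`-coercive too, hence also every operator between it
  -- and `A`.
  set c := min 1 (ν / (P ^ 2 + 1)) with hc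
  have hc0 : 0 < c := lt_min one_pos (by positivity)
  have hcoer : ∀ u, c * ‖u‖ ^ 2 ≤ ⟪A u, u⟫ := by
    intro u
    rw [hA, inner_diffusion, real_inner_self_eq_norm_sq, real_inner_self_eq_norm_sq]
    have h1 : ‖u‖ ^ 2 ≤ (P ^ 2 + 1) * ‖vgrad u‖ ^ 2 := by
      rw [norm_sq_eq]
      have : ‖vfn u‖ ^ 2 ≤ (P * ‖vgrad u‖) ^ 2 := by gcongr; exact hP u
      linarith [mul_pow P ‖vgrad u‖ 2]
    have h2 : c * ‖u‖ ^ 2 ≤ ν / (P ^ 2 + 1) * ((P ^ 2 + 1) * ‖vgrad u‖ ^ 2) :=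
      mul_le_mul (min_le_right _ _) h1 (by positivity) (by positivity)
    have e : ν / (P ^ 2 + 1) * ((P ^ 2 + 1) * ‖vgrad u‖ ^ 2) = ν * ‖vgrad u‖ ^ 2 := by
      field_simp
    have h3 : 0 ≤ κ * ‖vfn u‖ ^ 2 := by positivity
    linarith
  have h := surjective_of_continuation (E := V Ω) (W := V Ω) (N := fun x => x)
    (K := fun x => A x - x) (C := c⁻¹) (ℓ := ‖A‖ + 1) (by positivity) (by positivity) ?_ ?_
    Function.surjective_id
  · simpa using h
  · intro x y
    calc ‖A x - x - (A y - y)‖ = ‖A (x - y) - (x - y)‖ := by rw [map_sub]; congr 1; abel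
      _ ≤ ‖A (x - y)‖ + ‖x - y‖ := norm_sub_le _ _
      _ ≤ ‖A‖ * ‖x - y‖ + ‖x - y‖ := by gcongr; exact A.le_opNorm _
      _ = _ := by ring
  · intro s hs0 hs1 x y
    set z := x - y with hz
    have e : x + s • (A x - x) - (y + s • (A y - y)) = z + s • (A z - z) := by
      rw [hz, map_sub]; module
    rw [e, inv_mul_eq_div, le_div_iff₀ hc0]
    have h1 : c * ‖z‖ ^ 2 ≤ ⟪z + s • (A z - z), z⟫ := by
      rw [inner_add_left, real_inner_smul_left, inner_sub_left (A z) z, real_inner_self_eq_norm_sq]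
      have h2 := mul_le_mul_of_nonneg_left (hcoer z) hs0
      have h3 : c * ‖z‖ ^ 2 ≤ ‖z‖ ^ 2 :=
        mul_le_of_le_one_left (by positivity) (min_le_left _ _)
      have h4 := mul_le_mul_of_nonneg_left h3 (sub_nonneg.2 hs1)
      linarith
    have h2 := h1.trans (real_inner_le_norm _ _)
    by_cases h0 : ‖z‖ = 0
    · rw [h0]; simp
    · have : 0 < ‖z‖ := lt_of_le_of_ne (norm_nonneg _) (Ne.symm h0)
      nlinarith

theorem transport_smul (s : ℝ) (β : Lp (Eucl n) ∞ (vol Ω)) (u φ : V Ω) :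
    ⟪transport (s • β) u, φ⟫ = s * ⟪transport β u, φ⟫ := by
  rw [inner_transport, inner_transport, drift_smul, real_inner_smul_left]

theorem norm_smul_le_of_mem_unit {s M : ℝ} (hs0 : 0 ≤ s) (hs1 : s ≤ 1)
    {β : Lp (Eucl n) ∞ (vol Ω)} (hβ : ‖β‖ ≤ M) : ‖s • β‖ ≤ M := by
  rw [norm_smul, Real.norm_eq_abs, abs_of_nonneg hs0]
  exact (mul_le_of_le_one_left (norm_nonneg _) hs1).trans hβ

/-- Continuation from the pure diffusion through the drifts `s • β`; these stay in the ball of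
radius `‖β‖`, where the a priori bound is uniform. -/
theorem fokkerPlanck_surjective (hn : 0 < n) (hΩ : Bornology.IsBounded (Ω : Set (Eucl n)))
    {ν κ : ℝ} (hν : 0 < ν) (hκ : 0 ≤ κ) (β : Lp (Eucl n) ∞ (vol Ω)) :
    Function.Surjective (fokkerPlanck ν κ β) := by
  obtain ⟨C, hC0, hC⟩ := exists_fokkerPlanck_bound hn hΩ hν hκ ‖β‖
  set K := ContinuousLinearMap.adjoint (transport β) with hK
  have h := surjective_of_continuation (E := V Ω) (W := V Ω) (N := diffusion ν κ)
    (K := K) (C := C) (ℓ := ‖K‖) hC0.le (ContinuousLinearMap.opNorm_nonneg K) ?_ ?_ (diffusion_surjective hn hΩ hν hκ)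
  · exact h
  · intro x y
    rw [← map_sub]
    exact K.le_opNorm _
  · intro s hs0 hs1 x y
    have e : diffusion ν κ x + s • K x - (diffusion ν κ y + s • K y)
        = fokkerPlanck ν κ (s • β) (x - y) := by
      refine ext_inner_right ℝ fun φ => ?_
      rw [fokkerPlanck, add_apply, inner_add_left, inner_sub_left,
        inner_add_left, inner_add_left, real_inner_smul_left, real_inner_smul_left, hK,
        ContinuousLinearMap.adjoint_inner_left, ContinuousLinearMap.adjoint_inner_left,
        ContinuousLinearMap.adjoint_inner_left, map_sub, inner_sub_left, inner_sub_left,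
        real_inner_comm (transport (s • β) φ), real_inner_comm (transport (s • β) φ),
        transport_smul, transport_smul, real_inner_comm (transport β φ),
        real_inner_comm (transport β φ)]
      ring
    rw [e]
    exact hC _ (norm_smul_le_of_mem_unit hs0 hs1 le_rfl) _

/-- The adjoint problem inherits the a priori bound. -/
theorem exists_adjoint_bound (hn : 0 < n) (hΩ : Bornology.IsBounded (Ω : Set (Eucl n)))
    {ν κ : ℝ} (hν : 0 < ν) (hκ : 0 ≤ κ) (M : ℝ) :
    ∃ C : ℝ, 0 < C ∧ ∀ β : Lp (Eucl n) ∞ (vol Ω), ‖β‖ ≤ M → ∀ w : V Ω,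
      ‖w‖ ≤ C * ‖diffusion ν κ w + transport β w‖ := by
  obtain ⟨C, hC0, hC⟩ := exists_fokkerPlanck_bound (Ω := Ω) hn hΩ hν hκ M
  refine ⟨C, hC0, fun β hβ w => ?_⟩
  -- With `m` solving the dual problem with source `w`, duality gives `‖w‖² = ⟪diffusion w +
  -- transport w, m⟫`, and `‖m‖ ≤ C ‖w‖`.
  obtain ⟨m, hm⟩ := fokkerPlanck_surjective hn hΩ hν hκ β w
  have h1 := inner_fokkerPlanck_eq ν κ β m w
  rw [← inner_transport, ← inner_add_left, hm, real_inner_self_eq_norm_sq] at h1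
  have h2 := real_inner_le_norm (diffusion ν κ w + transport β w) m
  have h3 := hC β hβ m
  rw [hm] at h3
  by_cases h0 : ‖w‖ = 0
  · rw [h0]; positivity
  · have hpos : 0 < ‖w‖ := lt_of_le_of_ne (norm_nonneg _) (Ne.symm h0)
    have h4 : ‖w‖ * ‖w‖ ≤ (C * ‖diffusion ν κ w + transport β w‖) * ‖w‖ := by
      calc ‖w‖ * ‖w‖ = ‖w‖ ^ 2 := (pow_two _).symm
        _ ≤ ‖diffusion ν κ w + transport β w‖ * ‖m‖ := by rw [h1]; exact h2
        _ ≤ ‖diffusion ν κ w + transport β w‖ * (C * ‖w‖) := by gcongr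
        _ = _ := by ring
    exact le_of_mul_le_mul_right h4 hpos

/-- A zeroth order nonlinearity whose differences are bounded linear functions of the gradient. -/
def HasLinearization (M : ℝ) (h : V Ω → L2 Ω) : Prop :=
  ∀ u v, ∃ B : Lp (Eucl n) ∞ (vol Ω), ‖B‖ ≤ M ∧ h u - h v = drift B (vgrad (u - v))

/-- The Hamilton–Jacobi operator `u ↦ -ν Δu + h(u) + κ u`. -/
def hjb (ν κ : ℝ) (h : V Ω → L2 Ω) (u : V Ω) : V Ω :=
  diffusion ν κ u + ContinuousLinearMap.adjoint fnL (h u)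

theorem inner_hjb (ν κ : ℝ) (h : V Ω → L2 Ω) (u φ : V Ω) :
    ⟪hjb ν κ h u, φ⟫ = ⟪diffusion ν κ u, φ⟫ + ⟪h u, vfn φ⟫ := by
  rw [hjb, inner_add_left, ContinuousLinearMap.adjoint_inner_left, fnL_apply]

theorem hjb_eq_add_smul_sub {ν κ s : ℝ} {h : V Ω → L2 Ω} {u v : V Ω}
    {B : Lp (Eucl n) ∞ (vol Ω)} (hB : h u - h v = drift B (vgrad (u - v))) :
    (diffusion ν κ u + s • ContinuousLinearMap.adjoint fnL (h u))
        - (diffusion ν κ v + s • ContinuousLinearMap.adjoint fnL (h v))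
      = diffusion ν κ (u - v) + transport (s • B) (u - v) := by
  refine ext_inner_right ℝ fun φ => ?_
  rw [inner_sub_left, inner_add_left, inner_add_left, inner_add_left, real_inner_smul_left,
    real_inner_smul_left, transport_smul, inner_transport, ← hB, map_sub, inner_sub_left,
    inner_sub_left, ContinuousLinearMap.adjoint_inner_left,
    ContinuousLinearMap.adjoint_inner_left, fnL_apply]
  ring

/-- The difference of two values is a linear adjoint operator with drift `s • B` applied to `u - v`.
The parameter `s` follows the continuation path of `hjb_surjective`; `s = 1` makes the solution
operator Lipschitz. -/
theorem exists_hjb_bound (hn : 0 < n) (hΩ : Bornology.IsBounded (Ω : Set (Eucl n)))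
    {ν κ : ℝ} (hν : 0 < ν) (hκ : 0 ≤ κ) {M : ℝ} {h : V Ω → L2 Ω} (hh : HasLinearization M h) :
    ∃ C : ℝ, 0 < C ∧ ∀ s : ℝ, 0 ≤ s → s ≤ 1 → ∀ u v, ‖u - v‖ ≤
      C * ‖(diffusion ν κ u + s • ContinuousLinearMap.adjoint fnL (h u))
        - (diffusion ν κ v + s • ContinuousLinearMap.adjoint fnL (h v))‖ := by
  obtain ⟨C, hC0, hC⟩ := exists_adjoint_bound (Ω := Ω) hn hΩ hν hκ M
  refine ⟨C, hC0, fun s hs0 hs1 u v => ?_⟩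
  obtain ⟨B, hB, hBe⟩ := hh u v
  rw [hjb_eq_add_smul_sub hBe]
  exact hC _ (norm_smul_le_of_mem_unit hs0 hs1 hB) _

theorem exists_norm_sub_le_hjb (hn : 0 < n) (hΩ : Bornology.IsBounded (Ω : Set (Eucl n)))
    {ν κ : ℝ} (hν : 0 < ν) (hκ : 0 ≤ κ) {M : ℝ} {h : V Ω → L2 Ω} (hh : HasLinearization M h) :
    ∃ C : ℝ, 0 < C ∧ ∀ u v, ‖u - v‖ ≤ C * ‖hjb ν κ h u - hjb ν κ h v‖ := by
  obtain ⟨C, hC0, hC⟩ := exists_hjb_bound hn hΩ hν hκ hh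
  refine ⟨C, hC0, fun u v => ?_⟩
  have := hC 1 zero_le_one le_rfl u v
  rw [one_smul, one_smul] at this
  exact this

theorem norm_adjoint_fnL_sub_le {M : ℝ} {h : V Ω → L2 Ω} (hh : HasLinearization M h)
    (x y : V Ω) : ‖ContinuousLinearMap.adjoint fnL (h x) - ContinuousLinearMap.adjoint fnL (h y)‖
      ≤ M * ‖x - y‖ := by
  obtain ⟨B, hB, hBe⟩ := hh x y
  have hM : 0 ≤ M := (norm_nonneg _).trans hB
  rw [← map_sub, hBe]
  set z := ContinuousLinearMap.adjoint fnL (drift B (vgrad (x - y))) with hz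
  have h1 : ‖z‖ * ‖z‖ ≤ (M * ‖x - y‖) * ‖z‖ := by
    rw [← real_inner_self_eq_norm_mul_norm]
    conv_lhs => rw [hz]
    rw [ContinuousLinearMap.adjoint_inner_left, fnL_apply]
    refine (real_inner_le_norm _ _).trans ?_
    refine mul_le_mul ?_ (norm_fn_le z) (norm_nonneg _) (by positivity)
    exact (norm_drift_le _ _).trans (mul_le_mul hB (norm_grad_le _) (norm_nonneg _) hM)
  by_cases h0 : ‖z‖ = 0
  · rw [h0]; positivity
  · exact le_of_mul_le_mul_right h1 (lt_of_le_of_ne (norm_nonneg _) (Ne.symm h0))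

theorem hjb_surjective (hn : 0 < n) (hΩ : Bornology.IsBounded (Ω : Set (Eucl n)))
    {ν κ : ℝ} (hν : 0 < ν) (hκ : 0 ≤ κ) {M : ℝ} {h : V Ω → L2 Ω} (hh : HasLinearization M h) :
    Function.Surjective (hjb ν κ h) := by
  obtain ⟨C, hC0, hC⟩ := exists_hjb_bound hn hΩ hν hκ hh
  obtain ⟨B₀, hB₀, -⟩ := hh 0 0
  exact surjective_of_continuation (E := V Ω) (W := V Ω) (N := diffusion ν κ)
    (K := fun u => ContinuousLinearMap.adjoint fnL (h u))
    hC0.le ((norm_nonneg _).trans hB₀) (norm_adjoint_fnL_sub_le hh) hC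
    (diffusion_surjective hn hΩ hν hκ)

end Solvability

/-! ### Regularity of the control Hamiltonian. -/

section Hamiltonian

variable {n : ℕ}

/-- The properties of the Hamiltonian on which the analysis of the system depends: it is
Lipschitz in the momentum, a Nemytskii operator on `L²`, and has measurable approximate
subgradients. -/
structure RegularHamiltonian (Ω : TopologicalSpace.Opens (Eucl n)) (H : Eucl n → Eucl n → ℝ)
    (M : ℝ) : Prop where
  lip : ∀ x ∈ Ω, ∀ p q, |H x p - H x q| ≤ M * ‖p - q‖
  memLp : ∀ g : Lp (Eucl n) 2 (vol Ω), MemLp (fun x => H x (g x)) 2 (vol Ω)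
  approx : ∀ (g : Lp (Eucl n) 2 (vol Ω)) (ε : ℝ), 0 < ε → ∃ β : Lp (Eucl n) ∞ (vol Ω), ‖β‖ ≤ M ∧
    ∀ᵐ x ∂(vol Ω), ∀ q, H x (g x) + ⟪β x, q - g x⟫ - ε ≤ H x q

variable {Ω : TopologicalSpace.Opens (Eucl n)}
  {A : Type*} {b : Eucl n → A → Eucl n} {f : Eucl n → A → ℝ}

theorem norm_le_of_norm_toLp_bound {β : Eucl n → Eucl n} {M : ℝ} (hM : 0 ≤ M)
    (hm : AEStronglyMeasurable β (vol Ω)) (hb : ∀ᵐ x ∂(vol Ω), ‖β x‖ ≤ M) :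
    ∃ B : Lp (Eucl n) ∞ (vol Ω), ‖B‖ ≤ M ∧ B =ᵐ[vol Ω] β := by
  have hmem : MemLp β ∞ (vol Ω) := memLp_top_of_bound hm M hb
  refine ⟨hmem.toLp, ?_, hmem.coeFn_toLp⟩
  rw [Lp.norm_toLp]
  refine ENNReal.toReal_le_of_le_ofReal hM ?_
  rw [eLpNorm_exponent_top]
  exact eLpNormEssSup_le_of_ae_bound hb

theorem exists_uniform_bound [MetricSpace A] [CompactSpace A] {E : Type*} [SeminormedAddCommGroup E]
    (hΩ : Bornology.IsBounded (Ω : Set (Eucl n))) {c : Eucl n → A → E}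
    (hc : UniformContinuousOn (fun z : Eucl n × A => c z.1 z.2)
      (closure (Ω : Set (Eucl n)) ×ˢ univ)) :
    ∃ M : ℝ, 0 ≤ M ∧ ∀ x ∈ Ω, ∀ α, ‖c x α‖ ≤ M := by
  have hcomp : IsCompact (closure (Ω : Set (Eucl n)) ×ˢ (univ : Set A)) :=
    hΩ.isCompact_closure.prod isCompact_univ
  obtain ⟨M, hM⟩ := hcomp.exists_bound_of_continuousOn hc.continuousOn
  exact ⟨max M 0, le_max_right _ _, fun x hx α =>
    (hM (x, α) ⟨subset_closure hx, mem_univ _⟩).trans (le_max_left _ _)⟩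

theorem aestronglyMeasurable_slice [MetricSpace A] {E : Type*} [NormedAddCommGroup E] {c : Eucl n → A → E}
    (hc : UniformContinuousOn (fun z : Eucl n × A => c z.1 z.2)
      (closure (Ω : Set (Eucl n)) ×ˢ univ)) (α : A) :
    AEStronglyMeasurable (fun x => c x α) (vol Ω) := by
  refine ContinuousOn.aestronglyMeasurable ?_ Ω.isOpen.measurableSet
  refine hc.continuousOn.comp (f := fun x => (x, α)) (by fun_prop) fun x hx => ?_
  exact ⟨subset_closure hx, mem_univ _⟩

theorem continuous_slice [MetricSpace A] {E : Type*} [SeminormedAddCommGroup E] {c : Eucl n → A → E}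
    (hc : UniformContinuousOn (fun z : Eucl n × A => c z.1 z.2)
      (closure (Ω : Set (Eucl n)) ×ˢ univ)) {x : Eucl n} (hx : x ∈ Ω) :
    Continuous fun α => c x α := by
  rw [← continuousOn_univ]
  refine hc.continuousOn.comp (f := fun α => (x, α)) (by fun_prop) fun α _ => ?_
  exact ⟨subset_closure hx, mem_univ _⟩

variable {M N : ℝ}

theorem le_hamiltonian {x : Eucl n} (hbM : ∀ α, ‖b x α‖ ≤ M) (hfN : ∀ α, ‖f x α‖ ≤ N)
    (p : Eucl n) (α : A) : ⟪b x α, p⟫ - f x α ≤ hamiltonian b f x p := by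
  refine le_ciSup (f := fun α => ⟪b x α, p⟫ - f x α) ⟨M * ‖p‖ + N, ?_⟩ α
  rintro _ ⟨α, rfl⟩
  have h1 := (real_inner_le_norm (b x α) p).trans
    (mul_le_mul_of_nonneg_right (hbM α) (norm_nonneg p))
  have h2 := neg_le_of_abs_le (hfN α)
  simp only
  linarith

theorem hamiltonian_sub_le [Nonempty A] {x : Eucl n} (hbM : ∀ α, ‖b x α‖ ≤ M) (hfN : ∀ α, ‖f x α‖ ≤ N)
    (p q : Eucl n) : hamiltonian b f x p - hamiltonian b f x q ≤ M * ‖p - q‖ := by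
  rw [sub_le_iff_le_add]
  refine ciSup_le fun α => ?_
  have h1 := le_hamiltonian hbM hfN q α
  have h2 := (real_inner_le_norm (b x α) (p - q)).trans
    (mul_le_mul_of_nonneg_right (hbM α) (norm_nonneg _))
  rw [inner_sub_right] at h2
  linarith

theorem abs_hamiltonian_le [Nonempty A] {x : Eucl n} (hbM : ∀ α, ‖b x α‖ ≤ M) (hfN : ∀ α, ‖f x α‖ ≤ N)
    (p : Eucl n) : |hamiltonian b f x p| ≤ M * ‖p‖ + N := by
  have hα := fun α => abs_le.1 ((abs_real_inner_le_norm (b x α) p).trans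
    (mul_le_mul_of_nonneg_right (hbM α) (norm_nonneg p)))
  refine abs_le.2 ⟨?_, ciSup_le fun α => ?_⟩
  · obtain ⟨α⟩ := ‹Nonempty A›
    have h1 := le_hamiltonian hbM hfN p α
    have h2 := le_of_abs_le (hfN α)
    linarith [(hα α).1]
  · have h2 := neg_le_of_abs_le (hfN α)
    linarith [(hα α).2]

/-- A countable supremum is measurable along measurable momenta, and near-maximisers can be selected
by an index in `ℕ`. -/
theorem hamiltonian_eq_iSup_dense [MetricSpace A] [CompactSpace A] [Nonempty A] {x : Eucl n}
    (hbM : ∀ α, ‖b x α‖ ≤ M) (hfN : ∀ α, ‖f x α‖ ≤ N)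
    (hbc : Continuous fun α => b x α) (hfc : Continuous fun α => f x α) (p : Eucl n) :
    hamiltonian b f x p = ⨆ j : ℕ, (⟪b x (TopologicalSpace.denseSeq A j), p⟫
      - f x (TopologicalSpace.denseSeq A j)) := by
  set d := TopologicalSpace.denseSeq A with hd
  have hle : ∀ j : ℕ, ⟪b x (d j), p⟫ - f x (d j) ≤ hamiltonian b f x p := fun j =>
    le_hamiltonian hbM hfN p _
  have hbdd : BddAbove (range fun j : ℕ => ⟪b x (d j), p⟫ - f x (d j)) :=
    ⟨_, by rintro _ ⟨j, rfl⟩; exact hle j⟩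
  refine le_antisymm (ciSup_le fun α => ?_) (ciSup_le hle)
  have hcl : IsClosed {α : A | ⟪b x α, p⟫ - f x α ≤ ⨆ j : ℕ, (⟪b x (d j), p⟫ - f x (d j))} :=
    isClosed_le (by fun_prop) continuous_const
  refine hcl.closure_subset_iff.2 ?_ (TopologicalSpace.denseRange_denseSeq A α)
  rintro _ ⟨j, rfl⟩
  exact le_ciSup hbdd j

/-- The Hamiltonian of a control problem with uniformly continuous data is regular. -/
theorem exists_regularHamiltonian [MetricSpace A] [CompactSpace A] [Nonempty A]
    (hΩ : Bornology.IsBounded (Ω : Set (Eucl n)))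
    (hb : UniformContinuousOn (fun z : Eucl n × A => b z.1 z.2)
      (closure (Ω : Set (Eucl n)) ×ˢ univ))
    (hf : UniformContinuousOn (fun z : Eucl n × A => f z.1 z.2)
      (closure (Ω : Set (Eucl n)) ×ˢ univ)) :
    ∃ M : ℝ, 0 ≤ M ∧ RegularHamiltonian Ω (hamiltonian b f) M := by
  have := isFiniteMeasure_vol hΩ
  obtain ⟨M, hM, hbM⟩ := exists_uniform_bound hΩ hb
  obtain ⟨N, hN, hfN⟩ := exists_uniform_bound hΩ hf
  have hΩae : ∀ᵐ x ∂(vol Ω), x ∈ Ω := ae_restrict_mem Ω.isOpen.measurableSet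
  set d := TopologicalSpace.denseSeq A with hd
  have hθ : ∀ (g : Lp (Eucl n) 2 (vol Ω)) (j : ℕ),
      AEMeasurable (fun x => ⟪b x (d j), g x⟫ - f x (d j)) (vol Ω) := fun g j =>
    (((aestronglyMeasurable_slice hb (d j)).inner (Lp.aestronglyMeasurable g)).sub
      (aestronglyMeasurable_slice hf (d j))).aemeasurable
  have hHm : ∀ g : Lp (Eucl n) 2 (vol Ω),
      AEMeasurable (fun x => hamiltonian b f x (g x)) (vol Ω) := by
    intro g
    refine (AEMeasurable.iSup (hθ g)).congr ?_
    filter_upwards [hΩae] with x hx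
    exact (hamiltonian_eq_iSup_dense (hbM x hx) (hfN x hx) (continuous_slice hb hx)
      (continuous_slice hf hx) (g x)).symm
  refine ⟨M, hM, ⟨?_, ?_, ?_⟩⟩
  · intro x hx p q
    rw [abs_le]
    have h1 := hamiltonian_sub_le (hbM x hx) (hfN x hx) p q
    have h2 := hamiltonian_sub_le (hbM x hx) (hfN x hx) q p
    rw [norm_sub_rev] at h2
    exact ⟨by linarith, h1⟩
  · intro g
    have hdom : MemLp (fun x => M * ‖g x‖ + N) 2 (vol Ω) :=
      ((Lp.memLp g).norm.const_mul M).add (memLp_const N)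
    refine hdom.mono (hHm g).aestronglyMeasurable ?_
    filter_upwards [hΩae] with x hx
    rw [Real.norm_eq_abs]
    exact (abs_hamiltonian_le (hbM x hx) (hfN x hx) (g x)).trans (le_abs_self _)
  · intro g ε hε
    -- Measurable representatives replace functions known only up to null sets, so that the
    -- selection sets are measurable.
    set G : Eucl n → ℝ := (hHm g).mk _ with hG
    set θ : ℕ → Eucl n → ℝ := fun j => (hθ g j).mk _ with hθdef
    set c : ℕ → Eucl n → Eucl n := fun j => (aestronglyMeasurable_slice hb (d j)).mk _ with hc
    have hex : ∀ᵐ x ∂(vol Ω), ∃ j, G x - ε < θ j x := by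
      filter_upwards [hΩae, (hHm g).ae_eq_mk, ae_all_iff.2 fun j => (hθ g j).ae_eq_mk]
        with x hx h1 h2
      have h3 := hamiltonian_eq_iSup_dense (hbM x hx) (hfN x hx) (continuous_slice hb hx)
        (continuous_slice hf hx) (g x)
      obtain ⟨j, hj⟩ := exists_lt_of_lt_ciSup
        (show hamiltonian b f x (g x) - ε < _ by rw [← h3]; linarith)
      refine ⟨j, ?_⟩
      rw [hG, ← h1, hθdef]
      beta_reduce
      rw [← h2 j]
      exact hj
    classical
    -- The second alternative holds only on a null set and serves to make `Nat.find` total.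
    -- Elsewhere the least index gives an `ε`-maximising control, and its `b` is an `ε`-subgradient.
    set P : Eucl n → ℕ → Prop := fun x j => G x - ε < θ j x ∨ ¬ ∃ j, G x - ε < θ j x with hP
    have hPex : ∀ x, ∃ j, P x j := by
      intro x
      by_cases h : ∃ j, G x - ε < θ j x
      · obtain ⟨j, hj⟩ := h; exact ⟨j, Or.inl hj⟩
      · exact ⟨0, Or.inr h⟩
    have hset : ∀ j, MeasurableSet {x | G x - ε < θ j x} := fun j =>
      measurableSet_lt ((hHm g).measurable_mk.sub_const ε) (hθ g j).measurable_mk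
    have hPm : ∀ j, MeasurableSet {x | P x j} := by
      intro j
      refine (hset j).union (MeasurableSet.compl ?_)
      have hU : MeasurableSet {x | ∃ j, G x - ε < θ j x} := by
        have : {x | ∃ j, G x - ε < θ j x} = ⋃ j, {x | G x - ε < θ j x} := by ext; simp
        rw [this]
        exact MeasurableSet.iUnion hset
      exact hU
    set J : Eucl n → ℕ := fun x => Nat.find (hPex x) with hJ
    have hJm : Measurable J := measurable_find hPex hPm
    have hcm : Measurable fun x => c (J x) x := by
      have h2 : Measurable fun z : ℕ × Eucl n => c z.1 z.2 :=
        measurable_from_prod_countable_right fun j =>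
          (aestronglyMeasurable_slice hb (d j)).stronglyMeasurable_mk.measurable
      exact h2.comp (hJm.prodMk measurable_id)
    have hcb : ∀ᵐ x ∂(vol Ω), ∀ j, c j x = b x (d j) := by
      rw [ae_all_iff]
      intro j
      filter_upwards [(aestronglyMeasurable_slice hb (d j)).ae_eq_mk] with x hx
      exact hx.symm
    obtain ⟨B, hB, hBe⟩ := norm_le_of_norm_toLp_bound hM hcm.aestronglyMeasurable (by
      filter_upwards [hcb, hΩae] with x h1 hx
      rw [h1]; exact hbM x hx _)
    refine ⟨B, hB, ?_⟩
    filter_upwards [hBe, hcb, hΩae, hex, (hHm g).ae_eq_mk, ae_all_iff.2 fun j => (hθ g j).ae_eq_mk]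
      with x h1 h2 hx h3 h4 h5 q
    have h6 : G x - ε < θ (J x) x := by
      rcases Nat.find_spec (hPex x) with h | h
      · exact h
      · exact absurd h3 h
    rw [hG, ← h4, hθdef] at h6
    beta_reduce at h6
    rw [← h5 (J x)] at h6
    rw [h1, h2, inner_sub_right]
    have h7 := le_hamiltonian (hbM x hx) (hfN x hx) q (d (J x))
    linarith

end Hamiltonian

/-! ### The superposition operator of the Hamiltonian. -/

section Nemytskii

variable {n : ℕ} {Ω : TopologicalSpace.Opens (Eucl n)} {H : Eucl n → Eucl n → ℝ} {M : ℝ}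

/-- The function `x ↦ H(x, ∇u(x))` in `L²(Ω)`. -/
def nemytskii (hH : RegularHamiltonian Ω H M) (u : V Ω) : L2 Ω := (hH.memLp (vgrad u)).toLp

theorem coeFn_nemytskii (hH : RegularHamiltonian Ω H M) (u : V Ω) :
    nemytskii hH u =ᵐ[vol Ω] fun x => H x (vgrad u x) := MemLp.coeFn_toLp _

theorem coeFn_vgrad_sub (u v : V Ω) :
    vgrad (u - v) =ᵐ[vol Ω] fun x => vgrad u x - vgrad v x := by
  have e : vgrad (u - v) = vgrad u - vgrad v := (gradL (Ω := Ω)).map_sub u v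
  rw [e]
  exact Lp.coeFn_sub _ _

/-- With `w = ∇u - ∇v` and `δ` the difference of Hamiltonians, the field is `δ w / |w|²`, bounded by
the Lipschitz constant. Where `w = 0`, division by zero gives the value `0`, and `δ = 0` there as
well. -/
theorem hasLinearization_nemytskii (hM : 0 ≤ M) (hH : RegularHamiltonian Ω H M) :
    HasLinearization M (nemytskii hH) := by
  intro u v
  have hΩae : ∀ᵐ x ∂(vol Ω), x ∈ Ω := ae_restrict_mem Ω.isOpen.measurableSet
  set w : Eucl n → Eucl n := fun x => vgrad u x - vgrad v x with hw
  have hwm : AEStronglyMeasurable w (vol Ω) :=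
    (Lp.aestronglyMeasurable (vgrad u)).sub (Lp.aestronglyMeasurable (vgrad v))
  set δ : Eucl n → ℝ := fun x => H x (vgrad u x) - H x (vgrad v x) with hδ
  have hδm : AEStronglyMeasurable δ (vol Ω) := (hH.memLp (vgrad u)).1.sub (hH.memLp (vgrad v)).1
  have hδle : ∀ᵐ x ∂(vol Ω), |δ x| ≤ M * ‖w x‖ := by
    filter_upwards [hΩae] with x hx using hH.lip x hx _ _
  have hm : AEStronglyMeasurable (fun x => (δ x / ‖w x‖ ^ 2) • w x) (vol Ω) :=
    ((hδm.aemeasurable.div (hwm.norm.aemeasurable.pow_const 2)).aestronglyMeasurable).smul hwm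
  obtain ⟨B, hB, hBe⟩ := norm_le_of_norm_toLp_bound hM hm (by
    filter_upwards [hδle] with x hx
    by_cases h0 : ‖w x‖ = 0
    · simp [norm_eq_zero.1 h0, hM]
    · have hpos : 0 < ‖w x‖ := lt_of_le_of_ne (norm_nonneg _) (Ne.symm h0)
      rw [norm_smul, norm_div, Real.norm_eq_abs, norm_pow, norm_norm, div_mul_eq_mul_div,
        div_le_iff₀ (by positivity)]
      nlinarith)
  refine ⟨B, hB, Lp.ext ?_⟩
  filter_upwards [Lp.coeFn_sub (nemytskii hH u) (nemytskii hH v), coeFn_nemytskii hH u,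
    coeFn_nemytskii hH v, coeFn_drift B (vgrad (u - v)), coeFn_vgrad_sub u v, hBe, hδle]
    with x h1 h2 h3 h4 h5 h6 h7
  rw [h1, Pi.sub_apply, h2, h3, h4, h5, h6]
  show δ x = ⟪(δ x / ‖w x‖ ^ 2) • w x, w x⟫
  rw [real_inner_smul_left, real_inner_self_eq_norm_sq]
  by_cases h0 : ‖w x‖ = 0
  · rw [h0, mul_zero] at h7
    simp [h0, abs_nonpos_iff.1 h7]
  · field_simp

theorem continuous_nemytskii (hM : 0 ≤ M) (hH : RegularHamiltonian Ω H M) :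
    Continuous (nemytskii hH) := by
  refine (LipschitzWith.of_dist_le_mul (K := ⟨M, hM⟩) fun u v => ?_).continuous
  obtain ⟨B, hB, hBe⟩ := hasLinearization_nemytskii hM hH u v
  rw [dist_eq_norm, dist_eq_norm, hBe]
  exact (norm_drift_le _ _).trans (mul_le_mul hB (norm_grad_le _) (norm_nonneg _) hM)

end Nemytskii

/-! ### Subgradient fields and the sets of densities they generate. -/

section Subgradients

variable {n : ℕ} {Ω : TopologicalSpace.Opens (Eucl n)} {H : Eucl n → Eucl n → ℝ} {M : ℝ}

/-- `β` is an `ε`-subgradient of `H` in the momentum variable along `∇u`. -/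
def IsApproxSubgradient (H : Eucl n → Eucl n → ℝ) (u : V Ω) (β : Lp (Eucl n) ∞ (vol Ω))
    (ε : ℝ) : Prop :=
  ∀ᵐ x ∂(vol Ω), ∀ q, H x (vgrad u x) + ⟪β x, q - vgrad u x⟫ - ε ≤ H x q

/-- The subgradient inequality at `q = ∇u + β` and the Lipschitz bound give `|β|² ≤ M |β|`. -/
theorem RegularHamiltonian.norm_le (hM : 0 ≤ M) (hH : RegularHamiltonian Ω H M) {u : V Ω}
    {β : Lp (Eucl n) ∞ (vol Ω)} (hβ : IsApproxSubgradient H u β 0) : ‖β‖ ≤ M := by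
  have hΩae : ∀ᵐ x ∂(vol Ω), x ∈ Ω := ae_restrict_mem Ω.isOpen.measurableSet
  have hbM : ∀ᵐ x ∂(vol Ω), ‖β x‖ ≤ M := by
    filter_upwards [hβ, hΩae] with x h1 hx
    have h2 := h1 (vgrad u x + β x)
    have h3 := (abs_le.1 (hH.lip x hx (vgrad u x + β x) (vgrad u x))).2
    rw [add_sub_cancel_left] at h2 h3
    rw [real_inner_self_eq_norm_sq] at h2
    by_contra hlt
    push Not at hlt
    nlinarith
  rw [Lp.norm_def]
  refine ENNReal.toReal_le_of_le_ofReal hM ?_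
  rw [eLpNorm_exponent_top]
  exact eLpNormEssSup_le_of_ae_bound hbM

/-- Compactness of approximate subgradients. -/
theorem exists_subgradient_limit [IsFiniteMeasure (vol Ω)] (hM : 0 ≤ M)
    (hH : RegularHamiltonian Ω H M) {u : ℕ → V Ω} {u₀ : V Ω} (hu : Tendsto u atTop (𝓝 u₀))
    {β : ℕ → Lp (Eucl n) ∞ (vol Ω)} (hβM : ∀ k, ‖β k‖ ≤ M) {ε : ℕ → ℝ}
    (hε : Tendsto ε atTop (𝓝 0)) (hβ : ∀ k, IsApproxSubgradient H (u k) (β k) (ε k)) :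
    ∃ β₀ : Lp (Eucl n) ∞ (vol Ω), IsApproxSubgradient H u₀ β₀ 0 ∧ ∃ σ : ℕ → ℕ, StrictMono σ ∧
      WeakTendsto (fun k => toL2 (β (σ k))) (toL2 β₀) := by
  have hΩae : ∀ᵐ x ∂(vol Ω), x ∈ Ω := ae_restrict_mem Ω.isOpen.measurableSet
  obtain ⟨β₀, hβ₀, σ, hσ, hw⟩ := exists_weak_limit_field hβM
  refine ⟨β₀, ?_, σ, hσ, hw⟩
  have hbd : ∀ k, ‖toL2 (β (σ k))‖ ≤ ((vol Ω).real univ) ^ (1 / 2 : ℝ) * M := fun k =>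
    (norm_toL2_le _).trans (by gcongr; exact hβM _)
  -- For fixed `q` the inequality is affine in `β` with strongly convergent coefficients, so it
  -- survives the weak limit. A dense set of `q` and continuity of `H x` do the rest.
  have hq : ∀ q : Eucl n, ∀ᵐ x ∂(vol Ω),
      H x (vgrad u₀ x) + ⟪β₀ x, q - vgrad u₀ x⟫ ≤ H x q := by
    intro q
    have mq : MemLp (fun _ : Eucl n => q) 2 (vol Ω) := memLp_const _
    set Q := mq.toLp with hQ
    set HQ : L2 Ω := (hH.memLp Q).toLp with hHQ
    have hHQe : ∀ᵐ x ∂(vol Ω), HQ x = H x q := by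
      filter_upwards [(hH.memLp Q).coeFn_toLp, mq.coeFn_toLp] with x h1 h2
      rw [hHQ, h1, hQ, h2]
    have me : ∀ k, MemLp (fun _ : Eucl n => ε (σ k)) 2 (vol Ω) := fun k => memLp_const _
    have hlimw : Tendsto (fun k => vgrad (u (σ k)) - Q) atTop (𝓝 (vgrad u₀ - Q)) :=
      (((gradL (Ω := Ω)).continuous.tendsto u₀).comp (hu.comp hσ.tendsto_atTop)).sub_const Q
    have hlime : Tendsto (fun k => (me k).toLp) atTop (𝓝 0) := by
      have h1 : Tendsto (fun k => |ε (σ k)| * ((vol Ω).real univ) ^ (1 / 2 : ℝ)) atTop (𝓝 0) := by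
        have := ((hε.comp hσ.tendsto_atTop).abs).mul_const (((vol Ω).real univ) ^ (1 / 2 : ℝ))
        simpa using this
      refine squeeze_zero_norm (fun k => ?_) h1
      have := Lp.norm_le_of_ae_bound (f := (me k).toLp) (C := |ε (σ k)|) (abs_nonneg _) (by
        filter_upwards [(me k).coeFn_toLp] with x hx
        rw [hx, Real.norm_eq_abs])
      refine this.trans (le_of_eq ?_)
      rw [mul_comm]
      congr 1
      simp [measureUnivNNReal, measureReal_def]
      rfl
    have hlimz : Tendsto (fun k => HQ - nemytskii hH (u (σ k)) + (me k).toLp) atTop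
        (𝓝 (HQ - nemytskii hH u₀ + 0)) :=
      (tendsto_const_nhds.sub (((continuous_nemytskii hM hH).tendsto u₀).comp
        (hu.comp hσ.tendsto_atTop))).add hlime
    rw [add_zero] at hlimz
    have := ae_nonneg_of_weakTendsto hw hbd hlimw hlimz (fun k => by
      filter_upwards [coeFn_toL2 (β (σ k)), Lp.coeFn_sub (vgrad (u (σ k))) Q, mq.coeFn_toLp,
        Lp.coeFn_add (HQ - nemytskii hH (u (σ k))) (me k).toLp,
        Lp.coeFn_sub HQ (nemytskii hH (u (σ k))), (me k).coeFn_toLp,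
        coeFn_nemytskii hH (u (σ k)), hHQe, hβ (σ k)] with x h1 h2 h3 h4 h5 h6 h7 h8 h9
      rw [h1, h2, h4, Pi.sub_apply, Pi.add_apply, h5, Pi.sub_apply, h6, h7, h8, hQ, h3]
      have h10 := h9 q
      rw [inner_sub_right] at h10 ⊢
      linarith)
    filter_upwards [this, coeFn_toL2 β₀, Lp.coeFn_sub (vgrad u₀) Q, mq.coeFn_toLp,
      Lp.coeFn_sub HQ (nemytskii hH u₀), coeFn_nemytskii hH u₀, hHQe]
      with x h0 h1 h2 h3 h4 h5 h6
    rw [h1, h2, h4, Pi.sub_apply, Pi.sub_apply, h5, h6, hQ, h3] at h0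
    rw [inner_sub_right] at h0 ⊢
    linarith
  filter_upwards [hΩae, ae_all_iff.2 fun j => hq (TopologicalSpace.denseSeq (Eucl n) j)]
    with x hx hj q
  rw [sub_zero]
  have hcont : Continuous (H x) := by
    refine (LipschitzWith.of_dist_le_mul (K := ⟨M, hM⟩) fun p q => ?_).continuous
    rw [Real.dist_eq, dist_eq_norm]
    exact hH.lip x hx p q
  have hcl : IsClosed {q : Eucl n | H x (vgrad u₀ x) + ⟪β₀ x, q - vgrad u₀ x⟫ ≤ H x q} :=
    isClosed_le (by fun_prop) hcont
  refine hcl.closure_subset_iff.2 ?_ (TopologicalSpace.denseRange_denseSeq (Eucl n) q)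
  rintro _ ⟨j, rfl⟩
  exact hj j

/-- An exact measurable subgradient arises as a weak limit of approximate ones along the constant
sequence `u`. -/
theorem exists_subgradient [IsFiniteMeasure (vol Ω)] (hM : 0 ≤ M)
    (hH : RegularHamiltonian Ω H M) (u : V Ω) :
    ∃ β : Lp (Eucl n) ∞ (vol Ω), IsApproxSubgradient H u β 0 := by
  choose β hβM hβ using fun k : ℕ => hH.approx (vgrad u) (1 / ((k : ℝ) + 1)) (by positivity)
  obtain ⟨β₀, hβ₀, -⟩ := exists_subgradient_limit hM hH (tendsto_const_nhds (x := u)) hβM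
    tendsto_one_div_add_atTop_nhds_zero_nat hβ
  exact ⟨β₀, hβ₀⟩

/-- The densities transported by some subgradient field along `∇u`. -/
def densities (ν κ : ℝ) (H : Eucl n → Eucl n → ℝ) (g u : V Ω) : Set (V Ω) :=
  {m | ∃ β : Lp (Eucl n) ∞ (vol Ω), IsApproxSubgradient H u β 0 ∧ fokkerPlanck ν κ β m = g}

variable {ν κ : ℝ} {g : V Ω}

theorem densities_nonempty (hn : 0 < n) (hΩ : Bornology.IsBounded (Ω : Set (Eucl n)))
    (hν : 0 < ν) (hκ : 0 ≤ κ) (hM : 0 ≤ M) (hH : RegularHamiltonian Ω H M) (u : V Ω) :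
    (densities ν κ H g u).Nonempty := by
  have := isFiniteMeasure_vol hΩ
  obtain ⟨β, hβ⟩ := exists_subgradient hM hH u
  obtain ⟨m, hm⟩ := fokkerPlanck_surjective hn hΩ hν hκ β g
  exact ⟨m, β, hβ, hm⟩

theorem exists_densities_bound (hn : 0 < n) (hΩ : Bornology.IsBounded (Ω : Set (Eucl n)))
    (hν : 0 < ν) (hκ : 0 ≤ κ) (hM : 0 ≤ M) (hH : RegularHamiltonian Ω H M) (g : V Ω) :
    ∃ C : ℝ, ∀ u : V Ω, ∀ m ∈ densities ν κ H g u, ‖m‖ ≤ C := by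
  obtain ⟨C, -, hC⟩ := exists_fokkerPlanck_bound (Ω := Ω) hn hΩ hν hκ M
  refine ⟨C * ‖g‖, ?_⟩
  rintro u m ⟨β, hβ, hm⟩
  rw [← hm]
  exact hC β (hH.norm_le hM hβ) m

/-- The graph of `densities` is sequentially closed and locally compact for the weak topology of
densities. -/
theorem exists_densities_limit (hn : 0 < n) (hΩ : Bornology.IsBounded (Ω : Set (Eucl n)))
    (hν : 0 < ν) (hκ : 0 ≤ κ) (hM : 0 ≤ M) (hH : RegularHamiltonian Ω H M) {u m : ℕ → V Ω}
    {u₀ : V Ω} (hu : Tendsto u atTop (𝓝 u₀)) (hm : ∀ k, m k ∈ densities ν κ H g (u k)) :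
    ∃ m₀ ∈ densities ν κ H g u₀, ∃ σ : ℕ → ℕ, StrictMono σ ∧
      WeakTendsto (fun k => m (σ k)) m₀ := by
  have := isFiniteMeasure_vol hΩ
  obtain ⟨C, hC⟩ := exists_densities_bound hn hΩ hν hκ hM hH g
  have hmC : ∀ k, ‖m k‖ ≤ C := fun k => hC _ _ (hm k)
  choose β hβ hβm using hm
  have hβM : ∀ k, ‖β k‖ ≤ M := fun k => hH.norm_le hM (hβ k)
  obtain ⟨β₀, hβ₀, σ, hσ, hw⟩ := exists_subgradient_limit hM hH hu hβM
    (tendsto_const_nhds (x := (0 : ℝ))) hβ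
  obtain ⟨m₀, τ, hτ, hmw⟩ := exists_subseq_weakTendsto (fun k => m (σ k)) C fun k => hmC _
  refine ⟨m₀, ⟨β₀, hβ₀, ?_⟩, fun k => σ (τ k), hσ.comp hτ, hmw⟩
  refine fokkerPlanck_limit hΩ ν κ (fun k => hβM (σ (τ k))) (hw.subseq hτ)
    (fun k => hmC (σ (τ k))) hmw ?_
  simp only [hβm]
  exact tendsto_const_nhds

theorem WeakTendsto.unique {E : Type*} [NormedAddCommGroup E] [InnerProductSpace ℝ E]
    {x : ℕ → E} {a c : E} (ha : WeakTendsto x a) (hc : WeakTendsto x c) : a = c :=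
  ext_inner_right ℝ fun y => tendsto_nhds_unique (ha y) (hc y)

theorem isClosed_densities (hn : 0 < n) (hΩ : Bornology.IsBounded (Ω : Set (Eucl n)))
    (hν : 0 < ν) (hκ : 0 ≤ κ) (hM : 0 ≤ M) (hH : RegularHamiltonian Ω H M) (u : V Ω) :
    IsClosed (densities ν κ H g u) := by
  refine IsSeqClosed.isClosed fun m m₁ hm hlim => ?_
  obtain ⟨m₀, hm₀, σ, hσ, hw⟩ := exists_densities_limit hn hΩ hν hκ hM hH
    (tendsto_const_nhds (x := u)) hm
  have h1 : WeakTendsto (fun k => m (σ k)) m₁ := fun y =>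
    (hlim.comp hσ.tendsto_atTop).inner tendsto_const_nhds
  rwa [h1.unique hw]

/-- The duality inequality behind the Lasry–Lions monotonicity. -/
theorem inner_fokkerPlanck_sub_le (hH : RegularHamiltonian Ω H M) {u u' m : V Ω}
    {β : Lp (Eucl n) ∞ (vol Ω)} (hβ : IsApproxSubgradient H u β 0)
    (hm : ∀ᵐ x ∂(vol Ω), 0 ≤ vfn m x) :
    ⟪fokkerPlanck ν κ β m, u' - u⟫
      ≤ ⟪m, hjb ν κ (nemytskii hH) u' - hjb ν κ (nemytskii hH) u⟫ := by
  have e : ⟪m, hjb ν κ (nemytskii hH) u' - hjb ν κ (nemytskii hH) u⟫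
      = ⟪diffusion ν κ (u' - u), m⟫ + ⟪nemytskii hH u' - nemytskii hH u, vfn m⟫ := by
    rw [real_inner_comm, inner_sub_left, inner_hjb, inner_hjb, map_sub, inner_sub_left,
      inner_sub_left]
    ring
  rw [e, inner_fokkerPlanck_eq]
  gcongr
  rw [L2.inner_def, L2.inner_def]
  refine integral_mono_ae (L2.integrable_inner _ _) (L2.integrable_inner _ _) ?_
  filter_upwards [hβ, hm, coeFn_drift β (vgrad (u' - u)), coeFn_vgrad_sub u' u,
    Lp.coeFn_sub (nemytskii hH u') (nemytskii hH u), coeFn_nemytskii hH u', coeFn_nemytskii hH u]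
    with x h1 h2 h3 h4 h5 h6 h7
  rw [h3, h4, h5, Pi.sub_apply, h6, h7]
  have h8 := h1 (vgrad u' x)
  have h9 : ⟪β x, vgrad u' x - vgrad u x⟫ ≤ H x (vgrad u' x) - H x (vgrad u x) := by linarith
  simpa [mul_comm] using mul_le_mul_of_nonneg_left h9 h2

/-- The equation is linear in the flux `m β`, not in `β`. The drift `β = l β₁ + (1 - l) β₂` with `l
= s m₁ / m` has flux `s m₁ β₁ + t m₂ β₂`; it is a pointwise convex combination because the densities
are nonnegative, so it is again a subgradient. -/
theorem convex_densities (hn : 0 < n) (hΩ : Bornology.IsBounded (Ω : Set (Eucl n)))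
    (hν : 0 < ν) (hκ : 0 ≤ κ) (hM : 0 ≤ M) (hH : RegularHamiltonian Ω H M)
    (hg : ∀ φ : V Ω, (∀ᵐ x ∂(vol Ω), 0 ≤ vfn φ x) → 0 ≤ ⟪g, φ⟫) (u : V Ω) :
    Convex ℝ (densities ν κ H g u) := by
  rintro m₁ ⟨β₁, hβ₁, hm₁⟩ m₂ ⟨β₂, hβ₂, hm₂⟩ s t hs ht hst
  have hp₁ := fn_nonneg_of_fokkerPlanck hn hΩ hν hκ (β := β₁) (v := m₁) (by rwa [hm₁])
  have hp₂ := fn_nonneg_of_fokkerPlanck hn hΩ hν hκ (β := β₂) (v := m₂) (by rwa [hm₂])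
  set m := s • m₁ + t • m₂ with hm
  have hmfn : ∀ᵐ x ∂(vol Ω), vfn m x = s * vfn m₁ x + t * vfn m₂ x := by
    have e : vfn m = s • vfn m₁ + t • vfn m₂ := by
      rw [hm, ← fnL_apply, map_add, map_smul, map_smul, fnL_apply, fnL_apply]
    rw [e]
    filter_upwards [Lp.coeFn_add (s • vfn m₁) (t • vfn m₂), Lp.coeFn_smul s (vfn m₁),
      Lp.coeFn_smul t (vfn m₂)] with x h1 h2 h3
    rw [h1, Pi.add_apply, h2, h3]
    simp
  set l : Eucl n → ℝ := fun x => s * vfn m₁ x / vfn m x with hl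
  have hlm : AEStronglyMeasurable l (vol Ω) :=
    (((Lp.aestronglyMeasurable (vfn m₁)).aemeasurable.const_mul s).div
      (Lp.aestronglyMeasurable (vfn m)).aemeasurable).aestronglyMeasurable
  have hl01 : ∀ᵐ x ∂(vol Ω), 0 ≤ l x ∧ l x ≤ 1 ∧ vfn m x * l x = s * vfn m₁ x := by
    filter_upwards [hp₁, hp₂, hmfn] with x h1 h2 h3
    have h4 : 0 ≤ s * vfn m₁ x := mul_nonneg hs h1
    have h5 : 0 ≤ t * vfn m₂ x := mul_nonneg ht h2
    have h6 : 0 ≤ vfn m x := by rw [h3]; linarith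
    refine ⟨div_nonneg h4 h6, div_le_one_of_le₀ (by rw [h3]; linarith) h6, ?_⟩
    -- Where `m = 0` both nonnegative summands vanish, so the identity holds there too.
    by_cases h0 : vfn m x = 0
    · rw [h0, zero_mul]; linarith
    · rw [hl]; field_simp
  have hmeas : AEStronglyMeasurable (fun x => l x • β₁ x + (1 - l x) • β₂ x) (vol Ω) :=
    (hlm.smul (Lp.aestronglyMeasurable β₁)).add
      ((aestronglyMeasurable_const.sub hlm).smul (Lp.aestronglyMeasurable β₂))
  obtain ⟨β, -, hβ⟩ := norm_le_of_norm_toLp_bound hM hmeas (by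
    filter_upwards [hl01, ae_norm_le_norm β₁, ae_norm_le_norm β₂] with x h1 h2 h3
    have h4 := h2.trans (hH.norm_le hM hβ₁)
    have h5 := h3.trans (hH.norm_le hM hβ₂)
    refine (norm_add_le _ _).trans ?_
    rw [norm_smul, norm_smul, Real.norm_eq_abs, Real.norm_eq_abs, abs_of_nonneg h1.1,
      abs_of_nonneg (sub_nonneg.2 h1.2.1)]
    have h6 := mul_le_mul_of_nonneg_left h4 h1.1
    have h7 := mul_le_mul_of_nonneg_left h5 (sub_nonneg.2 h1.2.1)
    linarith)
  refine ⟨β, ?_, ?_⟩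
  · filter_upwards [hβ, hβ₁, hβ₂, hl01] with x h0 h1 h2 h3 q
    rw [h0, inner_add_left, real_inner_smul_left, real_inner_smul_left]
    have h4 := mul_le_mul_of_nonneg_left (h1 q) h3.1
    have h5 := mul_le_mul_of_nonneg_left (h2 q) (sub_nonneg.2 h3.2.1)
    linarith
  · refine ext_inner_right ℝ fun φ => ?_
    have hd : ⟪vfn m, drift β (vgrad φ)⟫
        = s * ⟪vfn m₁, drift β₁ (vgrad φ)⟫ + t * ⟪vfn m₂, drift β₂ (vgrad φ)⟫ := by
      rw [← real_inner_smul_right, ← real_inner_smul_right, L2.inner_def, L2.inner_def,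
        L2.inner_def, ← integral_add (L2.integrable_inner _ _) (L2.integrable_inner _ _)]
      refine integral_congr_ae ?_
      filter_upwards [coeFn_drift β (vgrad φ), coeFn_drift β₁ (vgrad φ),
        coeFn_drift β₂ (vgrad φ), Lp.coeFn_smul s (drift β₁ (vgrad φ)),
        Lp.coeFn_smul t (drift β₂ (vgrad φ)), hβ, hl01, hmfn] with x h1 h2 h3 h4 h5 h6 h7 h8
      rw [h1, h4, h5, Pi.smul_apply, Pi.smul_apply, h2, h3, h6, inner_add_left,
        real_inner_smul_left, real_inner_smul_left]
      simp only [smul_eq_mul, RCLike.inner_apply, conj_trivial]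
      have h9 : vfn m x * (1 - l x) = t * vfn m₂ x := by
        rw [mul_sub, h7.2.2, h8]; ring
      linear_combination (⟪β₁ x, vgrad φ x⟫) * h7.2.2 + (⟪β₂ x, vgrad φ x⟫) * h9
    have h1 := congrArg (fun z => ⟪z, φ⟫) hm₁
    have h2 := congrArg (fun z => ⟪z, φ⟫) hm₂
    simp only [inner_fokkerPlanck] at h1 h2
    have e1 : vgrad m = s • vgrad m₁ + t • vgrad m₂ := by
      rw [hm, ← gradL_apply, map_add, map_smul, map_smul, gradL_apply, gradL_apply]
    have e2 : vfn m = s • vfn m₁ + t • vfn m₂ := by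
      rw [hm, ← fnL_apply, map_add, map_smul, map_smul, fnL_apply, fnL_apply]
    rw [inner_fokkerPlanck, hd, e1, e2]
    simp only [inner_add_left, real_inner_smul_left]
    linear_combination s * h1 + t * h2 + ⟪g, φ⟫ * hst

end Subgradients

/-! ### Existence and uniqueness for the coupled system. -/

section System

variable {n : ℕ} {Ω : TopologicalSpace.Opens (Eucl n)} {H : Eucl n → Eucl n → ℝ} {M : ℝ}
  {ν κ : ℝ} {g : V Ω}

/-- Existence for the mean field game system with an abstract monotone Lipschitz coupling. -/
theorem exists_solution (hn : 0 < n) (hΩ : Bornology.IsBounded (Ω : Set (Eucl n)))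
    (hν : 0 < ν) (hκ : 0 ≤ κ) (hM : 0 ≤ M) (hH : RegularHamiltonian Ω H M)
    (hg : ∀ φ : V Ω, (∀ᵐ x ∂(vol Ω), 0 ≤ vfn φ x) → 0 ≤ ⟪g, φ⟫)
    {F : L2 Ω → V Ω} {c : ℝ} (hc : 0 ≤ c) (hF : ∀ x y, ‖F x - F y‖ ≤ c * ‖x - y‖)
    (hFm : ∀ x y : V Ω, 0 ≤ ⟪F (vfn x) - F (vfn y), x - y⟫) :
    ∃ u, ∃ m ∈ densities ν κ H g u, hjb ν κ (nemytskii hH) u = F (vfn m) := by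
  have hlin := hasLinearization_nemytskii hM hH
  obtain ⟨D, hD0, hD⟩ := exists_norm_sub_le_hjb hn hΩ hν hκ hlin
  choose U hU using hjb_surjective hn hΩ hν hκ hlin
  have hUlim : ∀ {r : ℕ → V Ω} {r₀ : V Ω}, Tendsto r atTop (𝓝 r₀) →
      Tendsto (fun k => U (r k)) atTop (𝓝 (U r₀)) := by
    intro r r₀ hr
    rw [tendsto_iff_norm_sub_tendsto_zero] at hr ⊢
    have hz : Tendsto (fun k => D * ‖r k - r₀‖) atTop (𝓝 0) := by simpa using hr.const_mul D
    refine squeeze_zero (fun _ => norm_nonneg _) (fun k => ?_) hz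
    have := hD (U (r k)) (U r₀)
    rwa [hU, hU] at this
  set S : V Ω → Set (V Ω) := fun r => densities ν κ H g (U r) with hS
  have hne : ∀ r, (S r).Nonempty := fun r => densities_nonempty hn hΩ hν hκ hM hH (U r)
  -- The duality inequality read in the variable `r`: each density is a supergradient of `r ↦ ⟪g, U
  -- r⟫`.
  have hsup : ∀ r, ∀ m ∈ S r, ∀ r', ⟪g, U r'⟫ - ⟪g, U r⟫ ≤ ⟪m, r' - r⟫ := by
    rintro r m ⟨β, hβ, hm⟩ r'
    have hpos := fn_nonneg_of_fokkerPlanck hn hΩ hν hκ (β := β) (v := m) (by rwa [hm])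
    have := inner_fokkerPlanck_sub_le (ν := ν) (κ := κ) (u' := U r') hH hβ hpos
    rwa [hm, hU, hU, inner_sub_right] at this
  have hmono : ∀ r₁ r₂, ∀ m₁ ∈ S r₁, ∀ m₂ ∈ S r₂, ⟪m₁ - m₂, r₁ - r₂⟫ ≤ 0 := by
    intro r₁ r₂ m₁ hm₁ m₂ hm₂
    have h1 := hsup r₁ m₁ hm₁ r₂
    have h2 := hsup r₂ m₂ hm₂ r₁
    rw [inner_sub_right] at h1 h2
    rw [inner_sub_left, inner_sub_right, inner_sub_right]
    linarith
  have hdir : ∀ r k, ∃ t : ℕ → ℝ, (∀ j, 0 < t j) ∧ Tendsto t atTop (𝓝 0) ∧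
      ∃ mm : ℕ → V Ω, (∀ j, mm j ∈ S (r + t j • k)) ∧
        ∃ m ∈ S r, Tendsto (fun j => ⟪mm j, k⟫) atTop (𝓝 ⟪m, k⟫) := by
    intro r k
    set t : ℕ → ℝ := fun j => 1 / ((j : ℝ) + 1) with ht
    have ht0 : Tendsto t atTop (𝓝 0) := tendsto_one_div_add_atTop_nhds_zero_nat
    choose mm hmm using fun j => hne (r + t j • k)
    have hr : Tendsto (fun j => r + t j • k) atTop (𝓝 r) := by
      simpa using (ht0.smul_const k).const_add r
    obtain ⟨m, hm, σ, hσ, hw⟩ := exists_densities_limit hn hΩ hν hκ hM hH (hUlim hr) hmm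
    exact ⟨fun j => t (σ j), fun j => by simp only [ht]; positivity, ht0.comp hσ.tendsto_atTop,
      fun j => mm (σ j), fun j => hmm (σ j), m, hm, hw k⟩
  have hres : ∀ l : ℝ, 0 < l → ∀ R, ∃ r, ∃ m ∈ S r, r = R + l • m := fun l hl R =>
    exists_resolvent (gg := fun r => ⟪g, U r⟫) hne hsup
      (fun r => convex_densities hn hΩ hν hκ hM hH hg (U r))
      (fun r => isClosed_densities hn hΩ hν hκ hM hH (U r)) hdir hl R
  -- Solutions of the regularised inclusions `m k ∈ S (F (m k) + μ m k)` with `μ = 1 / (k + 1)`.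
  choose m hm using fun k : ℕ => exists_mem_of_resolvent hmono hres
    (F := fun v => F (vfn v)) (c := c)
    (fun x y => (hF _ _).trans (by
      gcongr
      have e : vfn x - vfn y = vfn (x - y) := ((fnL (Ω := Ω)).map_sub x y).symm
      rw [e]
      exact norm_fn_le _)) hFm (μ := 1 / ((k : ℝ) + 1)) (by positivity)
  obtain ⟨C, hC⟩ := exists_densities_bound hn hΩ hν hκ hM hH g
  have hmC : ∀ k, ‖m k‖ ≤ C := fun k => hC _ _ (hm k)
  obtain ⟨m₁, τ, hτ, hw⟩ := exists_subseq_weakTendsto m C hmC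
  have hfn := tendsto_fn_of_weakTendsto hΩ (fun k => hmC (τ k)) hw
  -- Since `F` is Lipschitz on `L²`, Rellich turns weak convergence of the densities into strong
  -- convergence of the right-hand sides, and hence of the Hamilton–Jacobi solutions.
  have hFlim : Tendsto (fun k => F (vfn (m (τ k)))) atTop (𝓝 (F (vfn m₁))) := by
    rw [tendsto_iff_norm_sub_tendsto_zero] at hfn ⊢
    have hz : Tendsto (fun k => c * ‖vfn (m (τ k)) - vfn m₁‖) atTop (𝓝 0) := by
      simpa using hfn.const_mul c
    exact squeeze_zero (fun _ => norm_nonneg _) (fun k => hF _ _) hz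
  have hreg : Tendsto (fun k : ℕ => (1 / ((k : ℝ) + 1)) • m k) atTop (𝓝 0) := by
    have hz : Tendsto (fun k : ℕ => 1 / ((k : ℝ) + 1) * C) atTop (𝓝 0) := by
      simpa using (tendsto_one_div_add_atTop_nhds_zero_nat (𝕜 := ℝ)).mul_const C
    refine squeeze_zero_norm (fun k => ?_) hz
    rw [norm_smul, Real.norm_eq_abs, abs_of_pos (by positivity)]
    gcongr
    exact hmC k
  have hrlim := hFlim.add (hreg.comp hτ.tendsto_atTop)
  rw [add_zero] at hrlim
  obtain ⟨m₀, hm₀, σ, hσ, hw₀⟩ := exists_densities_limit hn hΩ hν hκ hM hH (hUlim hrlim)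
    (m := fun k => m (τ k)) (fun k => hm (τ k))
  have e : m₁ = m₀ := (hw.subseq hσ).unique hw₀
  exact ⟨U (F (vfn m₁)), m₀, hm₀, by rw [hU, e]⟩

/-- Lasry–Lions: in the sum of the two duality inequalities the terms with `g` cancel. What remains
is the pairing that strict monotonicity excludes unless `m₁ = m₂`. -/
theorem solution_unique (hn : 0 < n) (hΩ : Bornology.IsBounded (Ω : Set (Eucl n)))
    (hν : 0 < ν) (hκ : 0 ≤ κ) (hM : 0 ≤ M) (hH : RegularHamiltonian Ω H M)
    (hg : ∀ φ : V Ω, (∀ᵐ x ∂(vol Ω), 0 ≤ vfn φ x) → 0 ≤ ⟪g, φ⟫)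
    {F : L2 Ω → V Ω}
    (hFm : ∀ x y : V Ω, ⟪F (vfn x) - F (vfn y), x - y⟫ ≤ 0 → x = y)
    {u₁ u₂ m₁ m₂ : V Ω} (hm₁ : m₁ ∈ densities ν κ H g u₁) (hm₂ : m₂ ∈ densities ν κ H g u₂)
    (hu₁ : hjb ν κ (nemytskii hH) u₁ = F (vfn m₁))
    (hu₂ : hjb ν κ (nemytskii hH) u₂ = F (vfn m₂)) : u₁ = u₂ ∧ m₁ = m₂ := by
  have hmeq : m₁ = m₂ := by
    obtain ⟨β₁, hβ₁, h1⟩ := hm₁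
    obtain ⟨β₂, hβ₂, h2⟩ := hm₂
    have hp₁ := fn_nonneg_of_fokkerPlanck hn hΩ hν hκ (β := β₁) (v := m₁) (by rwa [h1])
    have hp₂ := fn_nonneg_of_fokkerPlanck hn hΩ hν hκ (β := β₂) (v := m₂) (by rwa [h2])
    have i1 := inner_fokkerPlanck_sub_le (ν := ν) (κ := κ) (u' := u₂) hH hβ₁ hp₁
    have i2 := inner_fokkerPlanck_sub_le (ν := ν) (κ := κ) (u' := u₁) hH hβ₂ hp₂
    rw [h1, hu₁, hu₂, inner_sub_right, inner_sub_right] at i1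
    rw [h2, hu₁, hu₂, inner_sub_right, inner_sub_right] at i2
    refine hFm m₁ m₂ ?_
    rw [real_inner_comm, inner_sub_left, inner_sub_right, inner_sub_right]
    linarith
  obtain ⟨D, -, hD⟩ := exists_norm_sub_le_hjb hn hΩ hν hκ (hasLinearization_nemytskii hM hH)
  refine ⟨?_, hmeq⟩
  have := hD u₁ u₂
  rw [hu₁, hu₂, hmeq, sub_self, norm_zero, mul_zero, norm_le_zero_iff] at this
  exact sub_eq_zero.1 this

theorem inner_hjb_nemytskii_eq_integral (hH : RegularHamiltonian Ω H M) (u ψ : V Ω) :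
    ⟪hjb ν κ (nemytskii hH) u, ψ⟫
      = ∫ x, (ν * inner ℝ (vgrad u x) (vgrad ψ x) + H x (vgrad u x) * vfn ψ x
        + κ * vfn u x * vfn ψ x) ∂(vol Ω) := by
  have h1 := (L2.integrable_inner (𝕜 := ℝ) (vgrad u) (vgrad ψ)).const_mul ν
  have h2 := L2.integrable_inner (𝕜 := ℝ) (nemytskii hH u) (vfn ψ)
  have h3 := (L2.integrable_inner (𝕜 := ℝ) (vfn u) (vfn ψ)).const_mul κ
  rw [inner_hjb, inner_diffusion, L2.inner_def, L2.inner_def, L2.inner_def, ← integral_const_mul,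
    ← integral_const_mul, ← integral_add h1 h3]
  refine (integral_add (h1.add h3) h2).symm.trans ?_
  refine integral_congr_ae ?_
  filter_upwards [coeFn_nemytskii hH u] with x hx
  simp only [Pi.add_apply, hx]
  simp
  ring

/-- The Riesz representative of an element of `H⁻¹(Ω)`. -/
def riesz (L : Hneg1 Ω) : V Ω := (InnerProductSpace.toDual ℝ (H01 Ω)).symm L

theorem inner_riesz (L : Hneg1 Ω) (φ : V Ω) : ⟪riesz L, φ⟫ = L φ :=
  InnerProductSpace.toDual_symm_apply (𝕜 := ℝ) (E := H01 Ω) (x := φ) (y := L)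

theorem norm_riesz_sub (L L' : Hneg1 Ω) : ‖riesz L - riesz L'‖ = ‖L - L'‖ := by
  have := (InnerProductSpace.toDual ℝ (H01 Ω)).symm.isometry.dist_eq L L'
  rw [dist_eq_norm, dist_eq_norm] at this
  exact this

/-- Bridges the integral formulation and the operator formulation: two elements of a Hilbert space
agree when all their inner products do. -/
theorem isWeakSolution_iff {A : Type*} {b : Eucl n → A → Eucl n} {f : Eucl n → A → ℝ}
    (hH : RegularHamiltonian Ω (hamiltonian b f) M) (F : L2 Ω → Hneg1 Ω) (G : Hneg1 Ω)
    (u m : V Ω) :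
    IsWeakSolution b f ν κ F G u m ↔ m ∈ densities ν κ (hamiltonian b f) (riesz G) u ∧
      hjb ν κ (nemytskii hH) u = riesz (F (vfn m)) := by
  constructor
  · rintro ⟨β, hβ, h1, h2⟩
    refine ⟨⟨β, ?_, ?_⟩, ?_⟩
    · filter_upwards [hβ] with x hx q
      rw [sub_zero]
      exact hx q
    · refine ext_inner_right ℝ fun φ => ?_
      rw [inner_fokkerPlanck_eq_integral, inner_riesz]
      exact h2 φ
    · refine ext_inner_right ℝ fun φ => ?_
      rw [inner_hjb_nemytskii_eq_integral, inner_riesz]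
      exact h1 φ
  · rintro ⟨⟨β, hβ, h2⟩, h1⟩
    refine ⟨β, ?_, fun ψ => ?_, fun φ => ?_⟩
    · filter_upwards [hβ] with x hx q
      have := hx q
      rw [sub_zero] at this
      exact this
    · exact (inner_hjb_nemytskii_eq_integral hH u ψ).symm.trans
        ((congrArg (fun z : V Ω => inner ℝ z (show V Ω from ψ)) h1).trans
          (inner_riesz (F (vfn m)) ψ))
    · exact (inner_fokkerPlanck_eq_integral _ _ β m φ).symm.trans
        ((congrArg (fun z : V Ω => inner ℝ z (show V Ω from φ)) h2).trans (inner_riesz G φ))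

end System

end MFG

end

/-! ### The theorem in its original formulation. -/

theorem mainTheorem2 {n : ℕ} (hn : 2 ≤ n)
    (Ω : TopologicalSpace.Opens (EuclideanSpace ℝ (Fin n)))
    (hΩb : Bornology.IsBounded (Ω : Set (EuclideanSpace ℝ (Fin n))))
    (hΩc : IsConnected (Ω : Set (EuclideanSpace ℝ (Fin n))))
    (hΩL : MFG.HasLipschitzBoundary Ω)
    {A : Type*} [MetricSpace A] [CompactSpace A] [Nonempty A]
    (b : EuclideanSpace ℝ (Fin n) → A → EuclideanSpace ℝ (Fin n))
    (f : EuclideanSpace ℝ (Fin n) → A → ℝ)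
    (hb : UniformContinuousOn (fun z : EuclideanSpace ℝ (Fin n) × A => b z.1 z.2)
      (closure (Ω : Set (EuclideanSpace ℝ (Fin n))) ×ˢ Set.univ))
    (hf : UniformContinuousOn (fun z : EuclideanSpace ℝ (Fin n) × A => f z.1 z.2)
      (closure (Ω : Set (EuclideanSpace ℝ (Fin n))) ×ˢ Set.univ))
    (ν κ : ℝ) (hν : 0 < ν) (hκ : 0 ≤ κ)
    (F : MFG.L2 Ω → MFG.Hneg1 Ω) (G : MFG.Hneg1 Ω)
    (c₁ c₂ : ℝ) (hc₁ : 0 ≤ c₁) (hc₂ : 0 ≤ c₂)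
    (hF₁ : ∀ z : MFG.L2 Ω, ‖F z‖ ≤ c₁ * (‖z‖ + 1))
    (hF₂ : ∀ m₁ m₂ : MFG.L2 Ω, ‖F m₁ - F m₂‖ ≤ c₂ * ‖m₁ - m₂‖)
    (hF : MFG.IsStrictlyMonotone F) (hG : MFG.IsNonnegDistribution G) :
    ∃! w : MFG.H01 Ω × MFG.H01 Ω, MFG.IsWeakSolution b f ν κ F G w.1 w.2 := by
  have hn0 : 0 < n := by omega
  obtain ⟨M, hM, hH⟩ := MFG.exists_regularHamiltonian hΩb hb hf
  have hg : ∀ φ : MFG.V Ω, (∀ᵐ x ∂(MFG.vol Ω), 0 ≤ MFG.vfn φ x) →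
      0 ≤ inner ℝ (MFG.riesz G) φ := fun φ hφ => by
    rw [MFG.inner_riesz]; exact hG φ hφ
  have hinner : ∀ x y : MFG.V Ω,
      inner ℝ (MFG.riesz (F (MFG.vfn x)) - MFG.riesz (F (MFG.vfn y))) (x - y)
        = (F (MFG.vfn x) - F (MFG.vfn y)) (x - y) := by
    intro x y
    rw [inner_sub_left, MFG.inner_riesz, MFG.inner_riesz]
    rfl
  have hstrict : ∀ x y : MFG.V Ω,
      inner ℝ (MFG.riesz (F (MFG.vfn x)) - MFG.riesz (F (MFG.vfn y))) (x - y) ≤ 0 → x = y :=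
    fun x y h => hF x y ((hinner x y).symm.trans_le h)
  -- Strict monotonicity contains monotonicity: a negative pairing would force `x = y`, where the
  -- pairing is zero.
  have hmono : ∀ x y : MFG.V Ω,
      0 ≤ inner ℝ (MFG.riesz (F (MFG.vfn x)) - MFG.riesz (F (MFG.vfn y))) (x - y) := by
    intro x y
    by_contra hlt
    have hxy := hstrict x y (not_le.1 hlt).le
    rw [hxy, sub_self, sub_self, inner_zero_left] at hlt
    exact hlt le_rfl
  obtain ⟨u, m, hm, hu⟩ := MFG.exists_solution (F := fun z => MFG.riesz (F z)) hn0 hΩb hν hκ hM hH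
    hg hc₂ (fun x y => (MFG.norm_riesz_sub _ _).trans_le (hF₂ x y)) hmono
  refine ⟨(u, m), (MFG.isWeakSolution_iff hH F G u m).2 ⟨hm, hu⟩, ?_⟩
  rintro ⟨u', m'⟩ hw
  obtain ⟨hm', hu'⟩ := (MFG.isWeakSolution_iff hH F G u' m').1 hw
  obtain ⟨e1, e2⟩ := MFG.solution_unique (F := fun z => MFG.riesz (F z)) hn0 hΩb hν hκ hM hH hg
    hstrict hm' hm hu' hu
  exact Prod.ext e1 e2
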